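/- **Theorem 1.1.** All commutators are $[a,b]=ab-ba$, and all algebras are over $\mathbb{C}$. *The skew fields $\mathcal{K}_l$.* Let $A_1$ be the algebra with generators $f_0,f_1,f_2,\alpha_0,\alpha_1,h$ and relations $[f_1,f_0]=2hf_2$, $[f_0,f_2]=[f_2,f_1]=h$, $[f_i,\alpha_j]=[h,\alpha_j]=[f_i,h]=[\alpha_i,\alpha_j]=0$. For $l\ge 2$ put $\Gamma=\mathbb{Z}/(l+1)\mathbb{Z}$ and let $A_l$ be the algebra with generators $f_i,\alpha_i$ ($i\in\Gamma$), $h$ and relations $[f_i,f_{i+1}]=h$, $[f_i,f_j]=0$ ($j\ne i\pm1$), $[f_i,\alpha_j]=[\alpha_i,\alpha_j]=[h,f_j]=[h,\alpha_j]=0$ ($i,j\in\Gamma$). Then $A_l$ is an Ore domain for every $l\ge1$, i.e. it has a quotient skew field $\mathcal{K}_l\supset A_l$ (every element of $\mathcal{K}_l$ is a left fraction $s^{-1}a$ and a right fraction $bt^{-1}$ with $a,b,s,t\in A_l$, $s,t\neq0$). Put $k=\alpha_0+\cdots+\alpha_l$. *The Hamiltonian.* For $l\ge2$ and $0\le i\le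 l$ let $\varpi_i=\sum_{r=1}^l\bigl(\min\{i,r\}-\tfrac{ir}{l+1}\bigr)\alpha_r$ (so $\varpi_0=0$), with indices read in $\Gamma$. A proper subset $C\subsetneq\Gamma$ is the disjoint union of its connected components, the maximal segments $C_{i,m}=\{i,i+1,\dots,i+m-1\}\subset C$. Let $\chi(C)$ be the sum of $\varpi_i-\varpi_{i+1}+\cdots+(-1)^{m-1}\varpi_{i+m-1}$ over the components $C_{i,m}$ of $C$, and let $f_C$ be the product of $f_if_{i+1}\cdots f_{i+m-1}$ over the components (factors from different components commute). Let $S_d$ be the set of $K\subset\Gamma$ with $|K|=d$ such that all connected components of $\Gamma\setminus K$ have even length. Define $H_0\in A_l$ by $$H_0=\tfrac12(f_0f_1+f_1f_0)+\alpha_1f_2\quad(l=1),$$ $$H_0=f_0f_1f_2+hf_1+\sum_{K\in S_1}\chi(\Gamma\setminus K)f_K\quad(l=2),$$ $$H_0=\sum_{K\in S_3}f_K+\sum_{K\in S_1}\chi(\Gamma\setminus K)f_K\quad(l=2n,\ n\ge2),$$ $$H_0=f_0f_1f_2f_3+hf_1f_2+\sum_{K\in S_2}\chi(\Gamma\setminus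 K)f_K+\Bigl(\sum_{i=1}^3(-1)^{i-1}\varpi_i\Bigr)^2\quad(l=3),$$ $$H_0=\sum_{K\in S_4}f_K+\sum_{K\in S_2}\chi(\Gamma\setminus K)f_K+\Bigl(\sum_{i=1}^l(-1)^{i-1}\varpi_i\Bigr)^2\quad(l=2n+1,\ n\ge2).$$ *The derivation.* There is exactly one $\mathbb{C}$-derivation $\partial$ of $\mathcal{K}_l$ such that $\partial\alpha_i=\frac1h[H_0,\alpha_i]$ ($0\le i\le l$), $\partial h=\frac1h[H_0,h]$ and $$\partial f_i=\tfrac1h[H_0,f_i]+\delta_{i,0}k\qquad(l=1,\ 0\le i\le2;\quad l=2n,\ n\ge1,\ 0\le i\le l),$$ $$\partial f_i=\tfrac1h[H_0,f_i]-(-1)^i\tfrac k2f_i+\delta_{i,0}k(f_0+f_2+\cdots+f_{l-1})\qquad(l=2n+1,\ n\ge1,\ 0\le i\le l).$$ *The equations.* In all cases $\partial\alpha_i=0$ ($0\le i\le l$) and $\partial h=0$. Moreover: (0) For $l=1$: $\partial f_0=f_0f_2+f_2f_0+\alpha_0$, $\partial f_1=-f_1f_2-f_2f_1+\alpha_1$,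 $\partial f_2=f_1-f_0$. (1) For $l=2n$, $n\ge1$, and all $i\in\Gamma$: $$\partial f_i=f_i\Bigl(\sum_{1\le r\le n}f_{i+2r-1}\Bigr)-\Bigl(\sum_{1\le r\le n}f_{i+2r}\Bigr)f_i+\alpha_i.$$ (2) For $l=2n+1$, $n\ge1$, and all $i\in\Gamma$: $$\partial f_i=f_i\Bigl(\sum_{1\le r\le s\le n}f_{i+2r-1}f_{i+2s}\Bigr)-\Bigl(\sum_{1\le r\le s\le n}f_{i+2r}f_{i+2s+1}\Bigr)f_i+\Bigl(\frac k2-\sum_{1\le r\le n}\alpha_{i+2r}\Bigr)f_i+\alpha_i\sum_{1\le r\le n}f_{i+2r}.$$ -/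

import Mathlib

namespace QPainleve

/-! ## Quotient skew fields and derivations -/

/-- `ι : A → K` exhibits the skew field `K` as the quotient skew field of the (two-sided) Ore domain
`A`: `A` embeds in `K`, and every element of `K` is a left fraction `s⁻¹ a` and a right fraction
`b t⁻¹` of elements of `A`. (Such a `K` exists exactly when `A` is an Ore domain, and it is then
unique up to a unique isomorphism over `A`.) -/
structure IsQuotientSkewField {A K : Type*} [Ring A] [Algebra ℂ A] [DivisionRing K] [Algebra ℂ K]
    (ι : A →ₐ[ℂ] K) : Prop where
  injective : Function.Injective ι
  left_fraction : ∀ x : K, ∃ a s : A, s ≠ 0 ∧ x = (ι s)⁻¹ * ι a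
  right_fraction : ∀ x : K, ∃ b t : A, t ≠ 0 ∧ x = ι b * (ι t)⁻¹

/-- A `ℂ`-linear endomorphism of a (noncommutative) `ℂ`-algebra is a `ℂ`-derivation if it satisfies
the Leibniz rule. (Mathlib's `Derivation` is restricted to commutative algebras.) -/
def IsDerivation {K : Type*} [Ring K] [Algebra ℂ K] (D : K →ₗ[ℂ] K) : Prop :=
  ∀ x y : K, D (x * y) = D x * y + x * D y

/-! ## The algebra for `l = 1` -/

/-- Generators `f₀, f₁, f₂, α₀, α₁, h`. -/
inductive Gen₁ : Type
  | f (i : Fin 3)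
  | α (i : Fin 2)
  | h

/-- The defining relations for `l = 1`; `⁅a, b⁆ = a * b - b * a`. -/
inductive Rel₁ : FreeAlgebra ℂ Gen₁ → FreeAlgebra ℂ Gen₁ → Prop
  | f₁_f₀ : Rel₁ ⁅FreeAlgebra.ι ℂ (Gen₁.f 1), FreeAlgebra.ι ℂ (Gen₁.f 0)⁆
      (2 * FreeAlgebra.ι ℂ Gen₁.h * FreeAlgebra.ι ℂ (Gen₁.f 2))
  | f₀_f₂ : Rel₁ ⁅FreeAlgebra.ι ℂ (Gen₁.f 0), FreeAlgebra.ι ℂ (Gen₁.f 2)⁆ (FreeAlgebra.ι ℂ Gen₁.h)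
  | f₂_f₁ : Rel₁ ⁅FreeAlgebra.ι ℂ (Gen₁.f 2), FreeAlgebra.ι ℂ (Gen₁.f 1)⁆ (FreeAlgebra.ι ℂ Gen₁.h)
  | f_α (i : Fin 3) (j : Fin 2) :
      Rel₁ ⁅FreeAlgebra.ι ℂ (Gen₁.f i), FreeAlgebra.ι ℂ (Gen₁.α j)⁆ 0
  | h_α (j : Fin 2) : Rel₁ ⁅FreeAlgebra.ι ℂ Gen₁.h, FreeAlgebra.ι ℂ (Gen₁.α j)⁆ 0
  | f_h (i : Fin 3) : Rel₁ ⁅FreeAlgebra.ι ℂ (Gen₁.f i), FreeAlgebra.ι ℂ Gen₁.h⁆ 0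
  | α_α (i j : Fin 2) : Rel₁ ⁅FreeAlgebra.ι ℂ (Gen₁.α i), FreeAlgebra.ι ℂ (Gen₁.α j)⁆ 0

/-- The `ℂ`-algebra with the above generators and relations; its quotient skew field is `𝒦₁`. -/
abbrev Alg₁ : Type := RingQuot Rel₁

noncomputable section

/-- The generator `f_i` for `l = 1`. -/
def f₁ (i : Fin 3) : Alg₁ := RingQuot.mkAlgHom ℂ Rel₁ (FreeAlgebra.ι ℂ (Gen₁.f i))

/-- The generator `α_i` for `l = 1`. -/
def α₁ (i : Fin 2) : Alg₁ := RingQuot.mkAlgHom ℂ Rel₁ (FreeAlgebra.ι ℂ (Gen₁.α i))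

/-- The generator `h` for `l = 1`. -/
def h₁ : Alg₁ := RingQuot.mkAlgHom ℂ Rel₁ (FreeAlgebra.ι ℂ Gen₁.h)

/-- `k = α₀ + α₁`. -/
def k₁ : Alg₁ := α₁ 0 + α₁ 1

/-- The Hamiltonian `H₀ = (f₀ f₁ + f₁ f₀) / 2 + α₁ f₂` for `l = 1`. -/
def hamiltonian₁ : Alg₁ :=
  (1 / 2 : ℂ) • (f₁ 0 * f₁ 1 + f₁ 1 * f₁ 0) + α₁ 1 * f₁ 2

/-- `D` is the `ℂ`-derivation `∂` of `𝒦₁`: `∂ = h⁻¹[H₀, ·]` on generators, with the extra term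
`k` on `f₀`. -/
structure IsPainleveDerivation₁ {K : Type*} [DivisionRing K] [Algebra ℂ K] (ι : Alg₁ →ₐ[ℂ] K)
    (D : K →ₗ[ℂ] K) : Prop where
  leibniz : IsDerivation D
  map_f : ∀ i, D (ι (f₁ i)) =
    (ι h₁)⁻¹ * ⁅ι hamiltonian₁, ι (f₁ i)⁆ + if i = 0 then ι k₁ else 0
  map_α : ∀ i, D (ι (α₁ i)) = (ι h₁)⁻¹ * ⁅ι hamiltonian₁, ι (α₁ i)⁆
  map_h : D (ι h₁) = (ι h₁)⁻¹ * ⁅ι hamiltonian₁, ι h₁⁆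

end

/-! ## The algebra for `l ≥ 2` -/

/-- Generators `f_i, α_i (i ∈ ℤ/(l+1)ℤ), h`. -/
inductive Gen (l : ℕ) : Type
  | f (i : ZMod (l + 1))
  | α (i : ZMod (l + 1))
  | h

/-- The defining relations for `l ≥ 2`; `⁅a, b⁆ = a * b - b * a`. -/
inductive Rel (l : ℕ) : FreeAlgebra ℂ (Gen l) → FreeAlgebra ℂ (Gen l) → Prop
  | f_succ (i : ZMod (l + 1)) :
      Rel l ⁅FreeAlgebra.ι ℂ (Gen.f i), FreeAlgebra.ι ℂ (Gen.f (i + 1))⁆ (FreeAlgebra.ι ℂ Gen.h)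
  | f_f (i j : ZMod (l + 1)) (h₁ : j ≠ i + 1) (h₂ : j ≠ i - 1) :
      Rel l ⁅FreeAlgebra.ι ℂ (Gen.f i), FreeAlgebra.ι ℂ (Gen.f j)⁆ 0
  | f_α (i j : ZMod (l + 1)) :
      Rel l ⁅FreeAlgebra.ι ℂ (Gen.f i), FreeAlgebra.ι ℂ (Gen.α j)⁆ 0
  | α_α (i j : ZMod (l + 1)) :
      Rel l ⁅FreeAlgebra.ι ℂ (Gen.α i), FreeAlgebra.ι ℂ (Gen.α j)⁆ 0
  | h_f (j : ZMod (l + 1)) : Rel l ⁅FreeAlgebra.ι ℂ (Gen.h : Gen l), FreeAlgebra.ι ℂ (Gen.f j)⁆ 0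
  | h_α (j : ZMod (l + 1)) : Rel l ⁅FreeAlgebra.ι ℂ (Gen.h : Gen l), FreeAlgebra.ι ℂ (Gen.α j)⁆ 0

/-- The `ℂ`-algebra with the above generators and relations; for `l ≥ 2` its quotient skew field
is `𝒦_l`. -/
abbrev Alg (l : ℕ) : Type := RingQuot (Rel l)

/-! ## Combinatorics of subsets of `Γ = ℤ/(l+1)ℤ` -/

/-- For a proper subset `C ⊂ Γ`, the length `m` of the connected component
`C_{i,m} = {i, i+1, …, i+m-1}` of `C` that starts at `i`, and `0` if no connected component starts
at `i` (that is, unless `i ∈ C` and `i - 1 ∉ C`). Thus the connected components of `C` are the sets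
`C_{i,m}` with `m = compLength C i > 0`. -/
def compLength {l : ℕ} (C : Finset (ZMod (l + 1))) (i : ZMod (l + 1)) : ℕ :=
  if i ∈ C ∧ i - 1 ∉ C then
    Nat.findGreatest (fun m => ∀ t < m, i + (t : ZMod (l + 1)) ∈ C) l
  else 0

/-- `S_d`: the set of the `K ⊂ Γ` with `|K| = d` such that each connected component of `Γ \ K` has
even length. -/
def S (l d : ℕ) : Finset (Finset (ZMod (l + 1))) :=
  {K ∈ Finset.powersetCard d Finset.univ | ∀ i, Even (compLength Kᶜ i)}

noncomputable section

variable {l : ℕ}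

/-- The generator `f_i`. -/
def f (i : ZMod (l + 1)) : Alg l := RingQuot.mkAlgHom ℂ (Rel l) (FreeAlgebra.ι ℂ (Gen.f i))

/-- The generator `α_i`. -/
def α (i : ZMod (l + 1)) : Alg l := RingQuot.mkAlgHom ℂ (Rel l) (FreeAlgebra.ι ℂ (Gen.α i))

/-- The generator `h`. -/
def h : Alg l := RingQuot.mkAlgHom ℂ (Rel l) (FreeAlgebra.ι ℂ Gen.h)

/-- `k = α₀ + ⋯ + α_l`. -/
def k : Alg l := ∑ i : ZMod (l + 1), α i

/-- The fundamental weight `ϖ_i = ∑_{r=1}^l (min(i, r) - i r / (l+1)) α_r` (`0 ≤ i ≤ l`), so that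
`ϖ₀ = 0`. -/
def fundWeight (i : ZMod (l + 1)) : Alg l :=
  ∑ r ∈ Finset.Icc 1 l,
    ((min i.val r : ℕ) - (i.val * r : ℂ) / (l + 1) : ℂ) • α (r : ZMod (l + 1))

/-- `χ(C)` for a proper subset `C ⊂ Γ`: the sum of
`ϖ_i - ϖ_{i+1} + ⋯ + (-1)^{m-1} ϖ_{i+m-1}` over the connected components `C_{i,m}` of `C`. -/
def chi (C : Finset (ZMod (l + 1))) : Alg l :=
  ∑ i : ZMod (l + 1), ∑ t ∈ Finset.range (compLength C i),
    (-1) ^ t * fundWeight (i + (t : ZMod (l + 1)))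

/-- `f_{C_{i,m}} = f_i f_{i+1} ⋯ f_{i+m-1}`. -/
def fSegment (i : ZMod (l + 1)) (m : ℕ) : Alg l :=
  ((List.range m).map fun t => f (i + (t : ZMod (l + 1)))).prod

/-- `f_K` for a proper subset `K ⊂ Γ`: the product of the `f_{C_{i,m}}` over the connected
components `C_{i,m}` of `K`, taken here in the order `i = 0, 1, …, l`; the order is immaterial,
since factors from different components commute. -/
def fSet (K : Finset (ZMod (l + 1))) : Alg l :=
  ((List.range (l + 1)).map fun i =>
    fSegment (i : ZMod (l + 1)) (compLength K (i : ZMod (l + 1)))).prod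

/-! ## Hamiltonian and derivation for `l = 2n` -/

/-- The Hamiltonian `H₀` for `l = 2n`, `n ≥ 1`. -/
def hamiltonianEven (n : ℕ) : Alg (2 * n) :=
  (if n = 1 then f 0 * f 1 * f 2 + h * f 1 else ∑ K ∈ S (2 * n) 3, fSet K)
    + ∑ K ∈ S (2 * n) 1, chi Kᶜ * fSet K

/-- `D` is the `ℂ`-derivation `∂` of `𝒦_l`, `l = 2n`: `∂ = h⁻¹[H₀, ·]` on generators, with the
extra term `δ_{i,0} k` on `f_i`. -/
structure IsPainleveDerivationEven {n : ℕ} {K : Type*} [DivisionRing K] [Algebra ℂ K]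
    (ι : Alg (2 * n) →ₐ[ℂ] K) (D : K →ₗ[ℂ] K) : Prop where
  leibniz : IsDerivation D
  map_f : ∀ i, D (ι (f i)) =
    (ι h)⁻¹ * ⁅ι (hamiltonianEven n), ι (f i)⁆ + if i = 0 then ι k else 0
  map_α : ∀ i, D (ι (α i)) = (ι h)⁻¹ * ⁅ι (hamiltonianEven n), ι (α i)⁆
  map_h : D (ι h) = (ι h)⁻¹ * ⁅ι (hamiltonianEven n), ι h⁆

/-! ## Hamiltonian and derivation for `l = 2n + 1` -/

/-- The Hamiltonian `H₀` for `l = 2n + 1`, `n ≥ 1`. -/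
def hamiltonianOdd (n : ℕ) : Alg (2 * n + 1) :=
  (if n = 1 then f 0 * f 1 * f 2 * f 3 + h * f 1 * f 2 else ∑ K ∈ S (2 * n + 1) 4, fSet K)
    + ∑ K ∈ S (2 * n + 1) 2, chi Kᶜ * fSet K
    + (∑ i ∈ Finset.Icc 1 (2 * n + 1),
        (-1) ^ (i - 1) * fundWeight (i : ZMod (2 * n + 1 + 1))) ^ 2

/-- `x₀ = f₀ + f₂ + ⋯ + f_{l-1}` for `l = 2n + 1`. -/
def x₀ (n : ℕ) : Alg (2 * n + 1) :=
  ∑ r ∈ Finset.range (n + 1), f (2 * (r : ZMod (2 * n + 1 + 1)))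

/-- `D` is the `ℂ`-derivation `∂` of `𝒦_l`, `l = 2n + 1`: `∂ = h⁻¹[H₀, ·]` on generators, with the
extra terms `-(-1)^i (k/2) f_i + δ_{i,0} k x₀` on `f_i`. -/
structure IsPainleveDerivationOdd {n : ℕ} {K : Type*} [DivisionRing K] [Algebra ℂ K]
    (ι : Alg (2 * n + 1) →ₐ[ℂ] K) (D : K →ₗ[ℂ] K) : Prop where
  leibniz : IsDerivation D
  map_f : ∀ i, D (ι (f i)) =
    (ι h)⁻¹ * ⁅ι (hamiltonianOdd n), ι (f i)⁆
      - (-1) ^ i.val * ((1 / 2 : ℂ) • ι k) * ι (f i)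
      + if i = 0 then ι k * ι (x₀ n) else 0
  map_α : ∀ i, D (ι (α i)) = (ι h)⁻¹ * ⁅ι (hamiltonianOdd n), ι (α i)⁆
  map_h : D (ι h) = (ι h)⁻¹ * ⁅ι (hamiltonianOdd n), ι h⁆

end

/-- The `ℂ`-algebra `A` has a quotient skew field, that is, `A` is an Ore domain. -/
def HasQuotientSkewField (A : Type) [Ring A] [Algebra ℂ A] : Prop :=
  ∃ (K : Type) (_ : DivisionRing K) (_ : Algebra ℂ K) (ι : A →ₐ[ℂ] K), IsQuotientSkewField ι

end QPainleve

/-! Ore property. Filter the algebra by word length in generators whose commutators have length at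
most one. Reordering a word changes it only by shorter words, so the filtered pieces are images of
polynomials of bounded degree and grow polynomially. If every generator acts on a polynomial ring as
multiplication by its variable plus an operator that does not raise degree, then the leading term of
a product is the product of the leading terms, and there are no zero divisors. Two nonzero one-sided
ideals that met only in zero would make dimensions double at a fixed cost in degree, against
polynomial growth. This is `hasQuotientSkewField_of_rep`. For `l ≥ 2` the operators are `X_i + X_h
∂_{i+1}`. For `l = 1` the relation `[f₁, f₀] = 2 h f₂` is quadratic, and `f₁` is first traded for
the central element `casimir₁`.

Derivation. A derivation into the skew field is an algebra map into the dual numbers, so it is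
determined by its values on generators, subject to the relations, and it extends to fractions
because elements with nonzero first component are invertible
(`IsQuotientSkewField.exists_derivation`, `IsQuotientSkewField.derivation_ext`). The required
derivation is the inner derivation of `h⁻¹ H₀` plus a derivation supported on the `f_i`. In the odd
case the latter respects the relations because `x₀` is central and the signs `(-1)^i` alternate
around a cycle of even length.

Equations. Everything reduces to computing `[H₀, f_i]` in the algebra and dividing by `h`.
Bracketing `f_K` with `f_i` deletes a neighbour of `i`: `i - 1` with sign plus, `i + 1` with sign
minus (`lie_fSet`). Membership in `S_d` means that the complement of `K` can be tiled by dominoes.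
If `i - 1 ∈ K` and `i ∉ K`, then `i` and `i + 1` form a domino; sliding it back by one step moves
the point `i - 1` of `K` to `i + 1`, and the two deleted sets agree. These terms therefore cancel in
pairs up to a difference of weights (`lie_sum_fSet`), which is a second difference of fundamental
weights, `α_i - δ_{i,0} k` (`fundWeight_second_difference`). The surviving sets contain `i` and a
neighbour, and parity of gaps lists them explicitly (`sum_S_three`, `sum_S_four` and their
companions). Finally the multiples of `k` combine with the non-Hamiltonian part of the derivation
(`oddPerturbation_add` in the odd case). For `l = 2` and `l = 3` the top-degree set would be all of
`Γ`, and the brackets are computed by hand (`lie_cubic`, `lie_quartic`). -/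

namespace QPainleve

open MvPolynomial

/-! ## Ore domains from polynomial representations -/

section OreCriterion

variable {𝕜 A I : Type*} [Field 𝕜] [Ring A] [Algebra 𝕜 A]

/-- Polynomials of total degree `< n`. -/
noncomputable def degreeLT (𝕜 I : Type*) [Field 𝕜] (n : ℕ) : Submodule 𝕜 (MvPolynomial I 𝕜) :=
  restrictSupport 𝕜 {m | m.degree < n}

theorem degreeLT_mono {m n : ℕ} (hmn : m ≤ n) : degreeLT 𝕜 I m ≤ degreeLT 𝕜 I n :=
  restrictSupport_mono _ fun _ hx => lt_of_lt_of_le hx hmn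

theorem mem_degreeLT_succ {p : MvPolynomial I 𝕜} {n : ℕ} :
    p ∈ degreeLT 𝕜 I (n + 1) ↔ p.totalDegree ≤ n := by
  rw [← mem_restrictTotalDegree]
  have : degreeLT 𝕜 I (n + 1) = restrictTotalDegree I 𝕜 n := by
    unfold degreeLT restrictTotalDegree
    congr 1
    ext m
    simp only [Set.mem_ofPred_eq, Nat.lt_succ_iff]
    rfl
  rw [this]

theorem degreeLT_zero : degreeLT 𝕜 I 0 = ⊥ := by
  rw [eq_bot_iff, degreeLT, restrictSupport_eq_span, Submodule.span_le]
  rintro _ ⟨m, hm, -⟩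
  exact absurd hm (Nat.not_lt_zero _)

theorem totalDegree_lt_of_mem_degreeLT {p : MvPolynomial I 𝕜} {n : ℕ} (hp : p ∈ degreeLT 𝕜 I n)
    (h0 : p ≠ 0) : p.totalDegree < n := by
  cases n with
  | zero => rw [degreeLT_zero, Submodule.mem_bot] at hp; exact absurd hp h0
  | succ n => exact Nat.lt_succ_of_le (mem_degreeLT_succ.mp hp)

theorem monomial_mem_degreeLT {m : I →₀ ℕ} {c : 𝕜} {n : ℕ} (hm : m.degree < n) :
    monomial m c ∈ degreeLT 𝕜 I n :=
  (monomial_mem_restrictSupport _).mpr (Or.inl hm)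

/-- The bounds are strict, so the degrees are at most `m` and at most `n - 1`. The asymmetric
indexing avoids truncated subtraction and includes `n = 0`, where `q = 0`. -/
theorem mul_mem_degreeLT {p q : MvPolynomial I 𝕜} {m n : ℕ} (hp : p ∈ degreeLT 𝕜 I (m + 1))
    (hq : q ∈ degreeLT 𝕜 I n) : p * q ∈ degreeLT 𝕜 I (m + n) := by
  by_cases h0 : q = 0
  · simp [h0]
  have hq' := totalDegree_lt_of_mem_degreeLT hq h0
  obtain ⟨n, rfl⟩ : ∃ k, n = k + 1 := ⟨n - 1, by omega⟩
  rw [← add_assoc, mem_degreeLT_succ]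
  rw [mem_degreeLT_succ] at hp hq
  exact (totalDegree_mul _ _).trans (add_le_add hp hq)

/-! ### Word-length filtration and polynomial growth -/

/-- The linear span of the products of fewer than `n` of the elements `u i`. -/
def wordSpan (𝕜 : Type*) [Field 𝕜] [Algebra 𝕜 A] (u : I → A) (n : ℕ) : Submodule 𝕜 A :=
  Submodule.span 𝕜 {a | ∃ L : List I, L.length < n ∧ a = (L.map u).prod}

theorem list_prod_mem_wordSpan (u : I → A) {L : List I} {n : ℕ} (hL : L.length < n) :
    (L.map u).prod ∈ wordSpan 𝕜 u n :=
  Submodule.subset_span ⟨L, hL, rfl⟩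

theorem wordSpan_mono (u : I → A) {m n : ℕ} (hmn : m ≤ n) : wordSpan 𝕜 u m ≤ wordSpan 𝕜 u n :=
  Submodule.span_mono fun _ ⟨L, hL, ha⟩ => ⟨L, lt_of_lt_of_le hL hmn, ha⟩

theorem mul_mem_wordSpan {u : I → A} {a b : A} {m n : ℕ} (ha : a ∈ wordSpan 𝕜 u (m + 1))
    (hb : b ∈ wordSpan 𝕜 u n) : a * b ∈ wordSpan 𝕜 u (m + n) := by
  have key : ∀ L : List I, L.length < m + 1 → (L.map u).prod * b ∈ wordSpan 𝕜 u (m + n) := by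
    intro L hL
    induction hb using Submodule.span_induction with
    | mem x hx =>
      obtain ⟨L', hL', rfl⟩ := hx
      rw [← List.prod_append, ← List.map_append]
      exact list_prod_mem_wordSpan u (by rw [List.length_append]; omega)
    | zero => rw [mul_zero]; exact zero_mem _
    | add x y _ _ hx hy => rw [mul_add]; exact add_mem hx hy
    | smul c x _ hx => rw [mul_smul_comm]; exact Submodule.smul_mem _ _ hx
  induction ha using Submodule.span_induction with
  | mem x hx => obtain ⟨L, hL, rfl⟩ := hx; exact key L hL
  | zero => rw [zero_mul]; exact zero_mem _
  | add x y _ _ hx hy => rw [add_mul]; exact add_mem hx hy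
  | smul c x _ hx => rw [smul_mul_assoc]; exact Submodule.smul_mem _ _ hx

theorem exists_mem_wordSpan {u : I → A} (hgen : Algebra.adjoin 𝕜 (Set.range u) = ⊤) (a : A) :
    ∃ n, a ∈ wordSpan 𝕜 u (n + 1) := by
  have ha : a ∈ Algebra.adjoin 𝕜 (Set.range u) := by rw [hgen]; trivial
  induction ha using Algebra.adjoin_induction with
  | mem x hx =>
    obtain ⟨i, rfl⟩ := hx
    exact ⟨1, by simpa using list_prod_mem_wordSpan (𝕜 := 𝕜) u (L := [i]) (n := 2) (by simp)⟩
  | algebraMap r =>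
    refine ⟨0, ?_⟩
    rw [Algebra.algebraMap_eq_smul_one]
    exact Submodule.smul_mem _ _
      (by simpa using list_prod_mem_wordSpan (𝕜 := 𝕜) u (L := []) (n := 1) (by simp))
  | add x y _ _ hx hy =>
    obtain ⟨m, hm⟩ := hx
    obtain ⟨n, hn⟩ := hy
    exact ⟨max m n, add_mem (wordSpan_mono u (by omega) hm) (wordSpan_mono u (by omega) hn)⟩
  | mul x y _ _ hx hy =>
    obtain ⟨m, hm⟩ := hx
    obtain ⟨n, hn⟩ := hy
    exact ⟨m + n, mul_mem_wordSpan (n := n + 1) hm hn⟩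

/-- A permutation is a chain of adjacent swaps, and each swap replaces two letters by a commutator,
which is a combination of words of length at most one. -/
theorem list_prod_sub_mem_wordSpan {u : I → A} (hcomm : ∀ i j, ⁅u i, u j⁆ ∈ wordSpan 𝕜 u 2)
    {L L' : List I} (hL : L.Perm L') :
    (L.map u).prod - (L'.map u).prod ∈ wordSpan 𝕜 u L.length := by
  induction hL with
  | nil => simp
  | @cons i L L' _ ih =>
    rw [List.map_cons, List.map_cons, List.prod_cons, List.prod_cons, ← mul_sub,
      List.length_cons, add_comm]
    exact mul_mem_wordSpan
      (by simpa using list_prod_mem_wordSpan (𝕜 := 𝕜) u (L := [i]) (n := 2) (by simp)) ih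
  | swap i j L =>
    simp only [List.map_cons, List.prod_cons, ← mul_assoc, ← sub_mul, List.length_cons]
    rw [← Ring.lie_def, show L.length + 1 + 1 = 1 + (L.length + 1) by omega]
    exact mul_mem_wordSpan (hcomm _ _) (list_prod_mem_wordSpan u (Nat.lt_succ_self _))
  | trans h₁ _ ih₁ ih₂ =>
    rw [← h₁.length_eq] at ih₂
    simpa using add_mem ih₁ ih₂

/-- The linear map sending each monomial to the product of the corresponding elements, taken in a
chosen order. -/
noncomputable def quantization (𝕜 : Type*) [Field 𝕜] [Algebra 𝕜 A] (u : I → A) :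
    MvPolynomial I 𝕜 →ₗ[𝕜] A :=
  (basisMonomials I 𝕜).constr 𝕜 fun m => ((Finsupp.toMultiset m).toList.map u).prod

theorem quantization_monomial (u : I → A) (m : I →₀ ℕ) :
    quantization 𝕜 u (monomial m 1) = ((Finsupp.toMultiset m).toList.map u).prod := by
  have h := (basisMonomials I 𝕜).constr_basis 𝕜
    (fun m => ((Finsupp.toMultiset m).toList.map u).prod) m
  rwa [coe_basisMonomials] at h

/-- Each word equals the quantization of its monomial up to shorter words, which the induction
hypothesis already covers. -/
theorem wordSpan_le_map_quantization {u : I → A} (hcomm : ∀ i j, ⁅u i, u j⁆ ∈ wordSpan 𝕜 u 2)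
    (n : ℕ) : wordSpan 𝕜 u n ≤ (degreeLT 𝕜 I n).map (quantization 𝕜 u) := by
  classical
  induction n with
  | zero => exact Submodule.span_le.mpr fun _ ⟨L, hL, _⟩ => absurd hL (Nat.not_lt_zero _)
  | succ n ih =>
    refine Submodule.span_le.mpr ?_
    rintro _ ⟨L, hL, rfl⟩
    have ih' : wordSpan 𝕜 u n ≤ (degreeLT 𝕜 I (n + 1)).map (quantization 𝕜 u) :=
      ih.trans (Submodule.map_mono (degreeLT_mono (Nat.le_succ n)))
    set m := Multiset.toFinsupp (L : Multiset I) with hm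
    have hms : Finsupp.toMultiset m = L := Multiset.toFinsupp_toMultiset _
    have hperm : L.Perm (Finsupp.toMultiset m).toList := by
      rw [← Multiset.coe_eq_coe, Multiset.coe_toList, hms]
    have h1 := ih' (wordSpan_mono u (Nat.lt_succ_iff.mp hL) (list_prod_sub_mem_wordSpan hcomm hperm))
    have hdeg : m.degree = L.length := by
      have := Finsupp.card_toMultiset m
      rw [hms, Multiset.coe_card] at this
      exact this.symm
    have h2 : quantization 𝕜 u (monomial m 1) ∈
        (degreeLT 𝕜 I (n + 1)).map (quantization 𝕜 u) :=
      Submodule.mem_map_of_mem (monomial_mem_degreeLT (by rw [hdeg]; exact hL))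
    rw [quantization_monomial] at h2
    simpa using add_mem h1 h2

theorem exists_quantization_eq {u : I → A} (hgen : Algebra.adjoin 𝕜 (Set.range u) = ⊤)
    (hcomm : ∀ i j, ⁅u i, u j⁆ ∈ wordSpan 𝕜 u 2) (a : A) :
    ∃ p, quantization 𝕜 u p = a := by
  obtain ⟨n, hn⟩ := exists_mem_wordSpan hgen a
  obtain ⟨p, -, hp⟩ := wordSpan_le_map_quantization hcomm _ hn
  exact ⟨p, hp⟩

theorem finrank_wordSpan_le [Fintype I] {u : I → A}
    (hcomm : ∀ i j, ⁅u i, u j⁆ ∈ wordSpan 𝕜 u 2) (n : ℕ) :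
    Module.Finite 𝕜 (wordSpan 𝕜 u n) ∧
      Module.finrank 𝕜 (wordSpan 𝕜 u n) ≤ n ^ Fintype.card I := by
  classical
  -- A monomial of degree less than `n` has all exponents less than `n`, so the simplex of exponents
  -- lies in a cube with `n ^ |I|` points.
  let b : (I → Fin n) → A := fun v =>
    quantization 𝕜 u (monomial (Finsupp.equivFunOnFinite.symm fun i => (v i : ℕ)) 1)
  have hle : wordSpan 𝕜 u n ≤ Submodule.span 𝕜 (Set.range b) := by
    refine (wordSpan_le_map_quantization hcomm n).trans ?_
    rw [degreeLT, restrictSupport_eq_span, Submodule.map_span, Submodule.span_le]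
    rintro _ ⟨_, ⟨m, hm, rfl⟩, rfl⟩
    refine Submodule.subset_span ⟨fun i => ⟨m i, lt_of_le_of_lt (Finsupp.le_degree i m) hm⟩, ?_⟩
    simp only [b]
    congr 2
    ext i
    simp
  have : Module.Finite 𝕜 (Submodule.span 𝕜 (Set.range b)) :=
    Module.Finite.span_of_finite 𝕜 (Set.finite_range b)
  refine ⟨Submodule.finiteDimensional_of_le hle, (Submodule.finrank_mono hle).trans ?_⟩
  refine (finrank_range_le_card b).trans ?_
  simp

/-- Two injective linear maps of bounded filtration degree have a common nonzero value. -/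
theorem exists_eq_of_polynomial_growth [Fintype I] [Nontrivial A] {u : I → A}
    (hcomm : ∀ i j, ⁅u i, u j⁆ ∈ wordSpan 𝕜 u 2) {g₁ g₂ : A →ₗ[𝕜] A} {c : ℕ}
    (h₁ : ∀ n, ∀ x ∈ wordSpan 𝕜 u n, g₁ x ∈ wordSpan 𝕜 u (c + n))
    (h₂ : ∀ n, ∀ x ∈ wordSpan 𝕜 u n, g₂ x ∈ wordSpan 𝕜 u (c + n)) :
    ∃ x y : A, (x ≠ 0 ∨ y ≠ 0) ∧ g₁ x = g₂ y := by
  by_contra! hcon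
  have hfin := fun n => (finrank_wordSpan_le hcomm n).1
  -- With no common nonzero value, `(x, y) ↦ g₁ x - g₂ y` is injective on pairs, so a shift of `c`
  -- in the filtration at least doubles the dimension.
  have hdim : ∀ n, 2 * Module.finrank 𝕜 (wordSpan 𝕜 u n)
      ≤ Module.finrank 𝕜 (wordSpan 𝕜 u (c + n)) := by
    intro n
    let G : (wordSpan 𝕜 u n × wordSpan 𝕜 u n) →ₗ[𝕜] wordSpan 𝕜 u (c + n) :=
      LinearMap.codRestrict _
        ((g₁ ∘ₗ (wordSpan 𝕜 u n).subtype ∘ₗ LinearMap.fst 𝕜 _ _)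
          - (g₂ ∘ₗ (wordSpan 𝕜 u n).subtype ∘ₗ LinearMap.snd 𝕜 _ _))
        (fun z => sub_mem (h₁ n _ z.1.2) (h₂ n _ z.2.2))
    have hG : Function.Injective G := by
      rw [← LinearMap.ker_eq_bot, LinearMap.ker_eq_bot']
      rintro ⟨x, y⟩ hz
      have hz' : g₁ (x : A) = g₂ (y : A) := sub_eq_zero.mp (congrArg Subtype.val hz)
      by_contra hne
      refine hcon x y ?_ hz'
      by_contra! h0
      exact hne (Prod.ext (Subtype.ext h0.1) (Subtype.ext h0.2))
    have := hfin n
    have := hfin (c + n)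
    have := LinearMap.finrank_le_finrank_of_injective hG
    rw [Module.finrank_prod] at this
    omega
  have hone : (1 : A) ∈ wordSpan 𝕜 u 1 := by
    simpa using list_prod_mem_wordSpan (𝕜 := 𝕜) u (L := []) (n := 1) (by simp)
  -- Iterated doubling, starting from the nonzero space containing `1` at index `1`.
  have hpow : ∀ j, 2 ^ j ≤ Module.finrank 𝕜 (wordSpan 𝕜 u (c * j + 1)) := by
    intro j
    induction j with
    | zero =>
      have := hfin 1
      have : Nontrivial (wordSpan 𝕜 u 1) :=
        ⟨⟨⟨1, hone⟩, 0, fun h => one_ne_zero (congrArg Subtype.val h)⟩⟩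
      exact Nat.succ_le_of_lt (Module.finrank_pos (R := 𝕜) (M := wordSpan 𝕜 u 1))
    | succ j ih =>
      have := hdim (c * j + 1)
      rw [show c + (c * j + 1) = c * (j + 1) + 1 by ring] at this
      rw [pow_succ]
      omega
  have hbound : ∀ j, 2 ^ j ≤ (c * j + 1) ^ Fintype.card I := fun j =>
    (hpow j).trans (finrank_wordSpan_le hcomm _).2
  set d := Fintype.card I
  have hlim := tendsto_pow_const_div_const_pow_of_one_lt d (r := (2 : ℝ)) one_lt_two
  -- For `j ≥ 1` one has `c * j + 1 ≤ (c + 1) * j`, so the bound is `(c + 1) ^ d * j ^ d`. The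
  -- threshold is chosen to absorb the constant factor.
  have hev := hlim.eventually (gt_mem_nhds (show (0 : ℝ) < ((c + 1 : ℝ) ^ d)⁻¹ by positivity))
  obtain ⟨j, hj1, hj⟩ := ((Filter.eventually_ge_atTop 1).and hev).exists
  have hb : (2 : ℝ) ^ j ≤ ((c + 1) * j) ^ d := by
    have h3 : (2 : ℝ) ^ j ≤ (c * j + 1) ^ d := by exact_mod_cast hbound j
    refine h3.trans (pow_le_pow_left₀ (by positivity) ?_ d)
    have : (1 : ℝ) ≤ j := by exact_mod_cast hj1
    linarith
  rw [div_lt_iff₀ (by positivity), ← mul_lt_mul_iff_right₀ (show (0 : ℝ) < (c + 1 : ℝ) ^ d by positivity),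
    ← mul_assoc, mul_inv_cancel₀ (by positivity), one_mul, ← mul_pow] at hj
  linarith

/-! ### Leading terms in a polynomial representation -/

variable {u : I → A} {ρ : A →ₐ[𝕜] Module.End 𝕜 (MvPolynomial I 𝕜)}

theorem rho_sub_mem_degreeLT
    (hρ : ∀ i m, ρ (u i) (monomial m 1) - X i * monomial m 1 ∈ degreeLT 𝕜 I (m.degree + 1))
    (i : I) {n : ℕ} {p : MvPolynomial I 𝕜} (hp : p ∈ degreeLT 𝕜 I n) :
    ρ (u i) p - X i * p ∈ degreeLT 𝕜 I n := by
  rw [degreeLT, restrictSupport_eq_span] at hp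
  induction hp using Submodule.span_induction with
  | mem x hx =>
    obtain ⟨m, hm, rfl⟩ := hx
    exact degreeLT_mono hm (hρ i m)
  | zero => simp
  | add x y _ _ hx hy =>
    rw [map_add, mul_add, add_sub_add_comm]
    exact add_mem hx hy
  | smul c x _ hx =>
    rw [map_smul, mul_smul_comm, ← smul_sub]
    exact Submodule.smul_mem _ _ hx

theorem X_mul_mem_degreeLT (i : I) {n : ℕ} {p : MvPolynomial I 𝕜} (hp : p ∈ degreeLT 𝕜 I n) :
    X i * p ∈ degreeLT 𝕜 I (n + 1) := by
  rw [add_comm]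
  refine mul_mem_degreeLT ?_ hp
  rw [mem_degreeLT_succ, totalDegree_X]

theorem list_prod_X_mul_mem_degreeLT (L : List I) {n : ℕ} {p : MvPolynomial I 𝕜}
    (hp : p ∈ degreeLT 𝕜 I n) :
    (L.map X).prod * p ∈ degreeLT 𝕜 I (n + L.length) := by
  induction L with
  | nil => simpa using hp
  | cons i L ih =>
    rw [List.map_cons, List.prod_cons, mul_assoc, List.length_cons, ← add_assoc]
    exact X_mul_mem_degreeLT i ih

theorem rho_list_prod_sub_mem_degreeLT
    (hρ : ∀ i m, ρ (u i) (monomial m 1) - X i * monomial m 1 ∈ degreeLT 𝕜 I (m.degree + 1))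
    (L : List I) {n : ℕ} {p : MvPolynomial I 𝕜} (hp : p ∈ degreeLT 𝕜 I (n + 1)) :
    ρ (L.map u).prod p - (L.map X).prod * p ∈ degreeLT 𝕜 I (n + L.length) := by
  induction L with
  | nil => simp
  | cons i L ih =>
    have h1 := X_mul_mem_degreeLT i ih
    have h2 := rho_sub_mem_degreeLT hρ i ih
    have h3 := rho_sub_mem_degreeLT hρ i (list_prod_X_mul_mem_degreeLT L hp)
    have h2' := degreeLT_mono (Nat.le_succ _) h2
    rw [show n + 1 + L.length = n + L.length + 1 by ring] at h3
    simp only [List.map_cons, List.prod_cons, map_mul, Module.End.mul_apply, List.length_cons,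
      mul_assoc, ← add_assoc]
    -- The three errors are: the variable times the old error, the lower-order part of the new
    -- letter on the old error, and its lower-order part on the leading term.
    have h4 := add_mem (add_mem h1 h2') h3
    rw [map_sub, mul_sub] at h4
    convert h4 using 1
    ring

/-- Says that the quantization of `p` acts with symbol `p`: on polynomials of degree at most `n` it
is multiplication by `p` modulo degree below `N + n`. -/
theorem rho_quantization_sub_mem_degreeLT
    (hρ : ∀ i m, ρ (u i) (monomial m 1) - X i * monomial m 1 ∈ degreeLT 𝕜 I (m.degree + 1))
    {N n : ℕ} {p q : MvPolynomial I 𝕜} (hp : p ∈ degreeLT 𝕜 I (N + 1))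
    (hq : q ∈ degreeLT 𝕜 I (n + 1)) :
    ρ (quantization 𝕜 u p) q - p * q ∈ degreeLT 𝕜 I (N + n) := by
  rw [degreeLT, restrictSupport_eq_span] at hp
  induction hp using Submodule.span_induction with
  | mem x hx =>
    obtain ⟨m, hm, rfl⟩ := hx
    have h1 := rho_list_prod_sub_mem_degreeLT hρ (Finsupp.toMultiset m).toList hq
    have h2 : monomial m (1 : 𝕜) = ((Finsupp.toMultiset m).toList.map X).prod := by
      rw [monomial_eq, C_1, one_mul, ← Multiset.prod_coe, ← Multiset.map_coe, Multiset.coe_toList,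
        Finsupp.toMultiset_map, Finsupp.prod_toMultiset, Finsupp.prod_mapDomain_index]
      · simp
      · intros; rw [pow_add]
    have h3 : (Finsupp.toMultiset m).toList.length = m.degree := by
      rw [Multiset.length_toList, Finsupp.card_toMultiset]
      rfl
    simp only [quantization_monomial]
    rw [h2]
    refine degreeLT_mono ?_ h1
    have : m.degree < N + 1 := hm
    omega
  | zero => simp
  | add x y _ _ hx hy =>
    rw [map_add, map_add, LinearMap.add_apply, add_mul, add_sub_add_comm]
    exact add_mem hx hy
  | smul c x _ hx =>
    rw [map_smul, map_smul, LinearMap.smul_apply, smul_mul_assoc, ← smul_sub]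
    exact Submodule.smul_mem _ _ hx

/-- Apply a product of quantizations of `p` and `q` to the polynomial `1`. If the product vanished,
`p * q` would have degree smaller than the sum of the degrees, which is impossible over a field. -/
theorem noZeroDivisors_of_rep (hgen : Algebra.adjoin 𝕜 (Set.range u) = ⊤)
    (hcomm : ∀ i j, ⁅u i, u j⁆ ∈ wordSpan 𝕜 u 2)
    (hρ : ∀ i m, ρ (u i) (monomial m 1) - X i * monomial m 1 ∈ degreeLT 𝕜 I (m.degree + 1)) :
    NoZeroDivisors A := by
  refine ⟨fun {a b} hab => ?_⟩
  by_contra! h0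
  obtain ⟨p, rfl⟩ := exists_quantization_eq hgen hcomm a
  obtain ⟨q, rfl⟩ := exists_quantization_eq hgen hcomm b
  have hp : p ≠ 0 := fun h => h0.1 (by rw [h, map_zero])
  have hq : q ≠ 0 := fun h => h0.2 (by rw [h, map_zero])
  have hpN : p ∈ degreeLT 𝕜 I (p.totalDegree + 1) := mem_degreeLT_succ.mpr le_rfl
  have hqN : q ∈ degreeLT 𝕜 I (q.totalDegree + 1) := mem_degreeLT_succ.mpr le_rfl
  have h1N : (1 : MvPolynomial I 𝕜) ∈ degreeLT 𝕜 I (0 + 1) :=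
    mem_degreeLT_succ.mpr (by simp)
  have h1 := rho_quantization_sub_mem_degreeLT hρ hqN h1N
  rw [mul_one, add_zero] at h1
  have hr : ρ (quantization 𝕜 u q) 1 ∈ degreeLT 𝕜 I (q.totalDegree + 1) := by
    simpa using add_mem (degreeLT_mono (Nat.le_succ _) h1) hqN
  have h2 := rho_quantization_sub_mem_degreeLT hρ hpN hr
  have h3 : ρ (quantization 𝕜 u p) (ρ (quantization 𝕜 u q) 1) = 0 := by
    rw [← Module.End.mul_apply, ← map_mul, hab, map_zero, LinearMap.zero_apply]
  rw [h3, zero_sub] at h2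
  have h4 : p * q ∈ degreeLT 𝕜 I (p.totalDegree + q.totalDegree) := by
    have h5 := sub_mem (neg_mem h2) (mul_mem_degreeLT hpN h1)
    rw [mul_sub] at h5
    simpa using h5
  have := totalDegree_lt_of_mem_degreeLT h4 (mul_ne_zero hp hq)
  rw [totalDegree_mul_of_isDomain hp hq] at this
  exact lt_irrefl _ this

end OreCriterion

/-! ### From the Ore conditions to the skew field -/

/-- The left Ore condition alone builds the skew field of left fractions. The right condition serves
to rewrite `s⁻¹ r` as `r' s'⁻¹` from `r s' = s r'`. -/
theorem hasQuotientSkewField_of_ore {A : Type} [Ring A] [Algebra ℂ A] [Nontrivial A]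
    [NoZeroDivisors A]
    (hl : ∀ r s : A, s ≠ 0 → ∃ r' s' : A, s' ≠ 0 ∧ s' * r = r' * s)
    (hr : ∀ r s : A, s ≠ 0 → ∃ r' s' : A, s' ≠ 0 ∧ r * s' = s * r') :
    HasQuotientSkewField A := by
  open nonZeroDivisors OreLocalization in
  have hore : Nonempty (OreLocalization.OreSet A⁰) := by
    rw [OreLocalization.nonempty_oreSet_iff_of_noZeroDivisors]
    intro r s
    obtain ⟨r', s', hs', h⟩ := hl r s (nonZeroDivisors.ne_zero s.2)
    exact ⟨r', ⟨s', mem_nonZeroDivisors_of_ne_zero hs'⟩, h⟩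
  obtain ⟨inst⟩ := hore
  let ι : A →ₐ[ℂ] OreLocalization (nonZeroDivisors A) A :=
    { OreLocalization.numeratorRingHom with commutes' := fun _ => rfl }
  have hι : ∀ r, ι r = OreLocalization.numeratorHom r := fun _ => rfl
  have hinj : Function.Injective ι :=
    OreLocalization.numeratorHom_inj (fun s hs => hs.1)
  have hfrac : ∀ (r : A) (s : nonZeroDivisors A), OreLocalization.oreDiv r s = (ι s)⁻¹ * ι r := by
    intro r s
    have hs : ι (s : A) ≠ 0 := by
      rw [ne_eq, map_eq_zero_iff ι hinj]; exact nonZeroDivisors.ne_zero s.2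
    rw [eq_inv_mul_iff_mul_eq₀ hs, hι, hι, OreLocalization.numeratorHom_apply,
      OreLocalization.numeratorHom_apply]
    exact OreLocalization.mul_cancel
  refine ⟨_, inferInstance, inferInstance, ι, hinj, fun x => ?_, fun x => ?_⟩
  · induction x with | _ r s
    exact ⟨r, s, nonZeroDivisors.ne_zero s.2, hfrac r s⟩
  · induction x with | _ r s
    obtain ⟨r', s', hs', h⟩ := hr r s (nonZeroDivisors.ne_zero s.2)
    refine ⟨r', s', hs', ?_⟩
    have h1 : ι (s : A) ≠ 0 := by
      rw [ne_eq, map_eq_zero_iff ι hinj]; exact nonZeroDivisors.ne_zero s.2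
    have h2 : ι s' ≠ 0 := by rwa [ne_eq, map_eq_zero_iff ι hinj]
    rw [hfrac, eq_mul_inv_iff_mul_eq₀ h2, mul_assoc, inv_mul_eq_iff_eq_mul₀ h1, ← map_mul,
      ← map_mul, h]

theorem hasQuotientSkewField_of_rep {A I : Type} [Ring A] [Algebra ℂ A] [Finite I] {u : I → A}
    {ρ : A →ₐ[ℂ] Module.End ℂ (MvPolynomial I ℂ)} (hgen : Algebra.adjoin ℂ (Set.range u) = ⊤)
    (hcomm : ∀ i j, ⁅u i, u j⁆ ∈ wordSpan ℂ u 2)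
    (hρ : ∀ i m, ρ (u i) (monomial m 1) - X i * monomial m 1 ∈ degreeLT ℂ I (m.degree + 1)) :
    HasQuotientSkewField A := by
  have : Fintype I := Fintype.ofFinite I
  have : Nontrivial A := ρ.toRingHom.domain_nontrivial
  have : NoZeroDivisors A := noZeroDivisors_of_rep hgen hcomm hρ
  refine hasQuotientSkewField_of_ore (fun r s hs => ?_) (fun r s hs => ?_)
  · by_cases hr : r = 0
    · exact ⟨0, 1, one_ne_zero, by simp [hr]⟩
    obtain ⟨m, hm⟩ := exists_mem_wordSpan hgen r
    obtain ⟨n, hn⟩ := exists_mem_wordSpan hgen s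
    -- A common value of right multiplication by `r` and by `s` is a common left multiple. Here `c`
    -- bounds the filtration degrees of both, and `y ≠ 0` because `y = 0` would give `x r = 0`,
    -- hence `x = 0`.
    obtain ⟨x, y, hxy, h⟩ := exists_eq_of_polynomial_growth hcomm (c := max m n + 1)
      (g₁ := LinearMap.mulRight ℂ r) (g₂ := LinearMap.mulRight ℂ s)
      (fun k x hx => wordSpan_mono u (by omega) (mul_mem_wordSpan (n := m + 1)
        (wordSpan_mono u (Nat.le_succ k) hx) hm))
      (fun k x hx => wordSpan_mono u (by omega) (mul_mem_wordSpan (n := n + 1)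
        (wordSpan_mono u (Nat.le_succ k) hx) hn))
    simp only [LinearMap.mulRight_apply] at h
    refine ⟨y, x, ?_, h⟩
    rintro rfl
    rw [zero_mul, eq_comm, mul_eq_zero] at h
    simp_all
  · by_cases hr : r = 0
    · exact ⟨0, 1, one_ne_zero, by simp [hr]⟩
    obtain ⟨m, hm⟩ := exists_mem_wordSpan hgen r
    obtain ⟨n, hn⟩ := exists_mem_wordSpan hgen s
    obtain ⟨x, y, hxy, h⟩ := exists_eq_of_polynomial_growth hcomm (c := max m n + 1)
      (g₁ := LinearMap.mulLeft ℂ r) (g₂ := LinearMap.mulLeft ℂ s)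
      (fun k x hx => wordSpan_mono u (by omega) (mul_mem_wordSpan (n := k) hm hx))
      (fun k x hx => wordSpan_mono u (by omega) (mul_mem_wordSpan hn hx))
    simp only [LinearMap.mulLeft_apply] at h
    refine ⟨y, x, ?_, h⟩
    rintro rfl
    rw [mul_zero, eq_comm, mul_eq_zero] at h
    simp_all

/-! ## Derivations of quotient skew fields -/

section Derivations

theorem IsDerivation.map_one {K : Type*} [Ring K] [Algebra ℂ K] {D : K →ₗ[ℂ] K}
    (hD : IsDerivation D) : D 1 = 0 := by
  have h := hD 1 1
  simpa using h

variable {A K : Type*} [Ring A] [Algebra ℂ A] [DivisionRing K] [Algebra ℂ K] {ι : A →ₐ[ℂ] K}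

theorem IsQuotientSkewField.map_ne_zero (hι : IsQuotientSkewField ι) {a : A} (ha : a ≠ 0) :
    ι a ≠ 0 := by
  rwa [ne_eq, map_eq_zero_iff ι hι.injective]

/-- Agreement on generators propagates through sums and products. For `x = s⁻¹ a`, the rule `D a = D
s * x + s * D x` determines `D x` since `s` is invertible. -/
theorem IsQuotientSkewField.derivation_ext (hι : IsQuotientSkewField ι) {S : Set A}
    (hS : Algebra.adjoin ℂ S = ⊤) {D D' : K →ₗ[ℂ] K} (hD : IsDerivation D) (hD' : IsDerivation D')
    (h : ∀ a ∈ S, D (ι a) = D' (ι a)) : D = D' := by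
  have hA : ∀ a, D (ι a) = D' (ι a) := by
    intro a
    have ha : a ∈ Algebra.adjoin ℂ S := by rw [hS]; trivial
    induction ha using Algebra.adjoin_induction with
    | mem x hx => exact h x hx
    | algebraMap r =>
      rw [AlgHom.commutes, Algebra.algebraMap_eq_smul_one, map_smul, map_smul, hD.map_one,
        hD'.map_one]
    | add x y _ _ hx hy => rw [map_add, map_add, map_add, hx, hy]
    | mul x y _ _ hx hy => rw [map_mul, hD, hD', hx, hy]
  ext x
  obtain ⟨a, s, hs, rfl⟩ := hι.left_fraction x
  have hs' := hι.map_ne_zero hs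
  have h1 := hA a
  rw [← mul_inv_cancel_left₀ hs' (ι a), hD, hD', hA s] at h1
  exact mul_left_cancel₀ hs' (add_left_cancel h1)

/-- A derivation from an Ore domain to its quotient skew field, given as a homomorphism to the
dual numbers, extends to the quotient skew field. -/
theorem IsQuotientSkewField.exists_derivation (hι : IsQuotientSkewField ι)
    (φ : A →ₐ[ℂ] DualNumber K) (hφ : ∀ a, (φ a).fst = ι a) :
    ∃ D : K →ₗ[ℂ] K, IsDerivation D ∧ ∀ a, D (ι a) = (φ a).snd := by
  have : Nontrivial A := ι.toRingHom.domain_nontrivial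
  have : NoZeroDivisors A := hι.injective.noZeroDivisors ι (map_zero ι) (map_mul ι)
  have hne : ∀ s : nonZeroDivisors A, ι (s : A) ≠ 0 := fun s =>
    hι.map_ne_zero (nonZeroDivisors.ne_zero s.2)
  -- The left Ore condition is recovered by writing `r s⁻¹` as a left fraction `t⁻¹ a`, that is, `t
  -- r = a s`.
  have hore : Nonempty (OreLocalization.OreSet (nonZeroDivisors A)) := by
    rw [OreLocalization.nonempty_oreSet_iff_of_noZeroDivisors]
    intro r s
    obtain ⟨a, t, ht, h⟩ := hι.left_fraction (ι r * (ι (s : A))⁻¹)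
    refine ⟨a, ⟨t, mem_nonZeroDivisors_of_ne_zero ht⟩, hι.injective ?_⟩
    rw [eq_inv_mul_iff_mul_eq₀ (hι.map_ne_zero ht), ← mul_assoc,
      mul_inv_eq_iff_eq_mul₀ (hne s)] at h
    simpa using h
  obtain ⟨inst⟩ := hore
  let Q := OreLocalization (nonZeroDivisors A) A
  let uK : nonZeroDivisors A →* Kˣ :=
    { toFun := fun s => Units.mk0 (ι (s : A)) (hne s)
      map_one' := Units.ext (by simp)
      map_mul' := fun s t => Units.ext (by simp) }
  have hdual : ∀ s : nonZeroDivisors A,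
      (φ (s : A)).fst ≠ 0 := fun s => by rw [hφ]; exact hne s
  -- A dual number is a unit as soon as its first component is nonzero, so the map into dual numbers
  -- inverts every nonzero element of `A`.
  let uD : nonZeroDivisors A →* (DualNumber K)ˣ :=
    { toFun := fun s => ⟨φ (s : A), (φ (s : A))⁻¹, TrivSqZeroExt.mul_inv_cancel (hdual s),
        TrivSqZeroExt.inv_mul_cancel (hdual s)⟩
      map_one' := Units.ext (by simp)
      map_mul' := fun s t => Units.ext (by simp) }
  let e : Q →+* K := OreLocalization.universalHom ι.toRingHom uK fun _ => rfl
  let ψ : Q →+* DualNumber K := OreLocalization.universalHom φ.toRingHom uD fun _ => rfl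
  have he : ∀ a, e (OreLocalization.numeratorHom a) = ι a := fun a =>
    OreLocalization.universalHom_commutes _ _ _
  have hψ : ∀ a, ψ (OreLocalization.numeratorHom a) = φ a := fun a =>
    OreLocalization.universalHom_commutes _ _ _
  -- This identifies the abstract localization with `K`, so that its universal property may be
  -- applied to `K`.
  have hbij : Function.Bijective e := by
    refine ⟨e.injective, fun x => ?_⟩
    obtain ⟨a, s, hs, rfl⟩ := hι.left_fraction x
    exact ⟨OreLocalization.oreDiv a ⟨s, mem_nonZeroDivisors_of_ne_zero hs⟩, rfl⟩
  let eq := RingEquiv.ofBijective e hbij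
  let Ψ : K →+* DualNumber K := ψ.comp (eq.symm : K →+* Q)
  have hΨ : ∀ a, Ψ (ι a) = φ a := by
    intro a
    rw [← hψ, ← he]
    change ψ (eq.symm (eq (OreLocalization.numeratorHom a))) = _
    rw [eq.symm_apply_apply]
  -- The extended map is a section of the projection to `K`. Multiplicativity of such a section is
  -- exactly the Leibniz rule for its second component.
  have hfst : ∀ x, (Ψ x).fst = x := by
    intro x
    obtain ⟨a, s, hs, rfl⟩ := hι.left_fraction x
    have hs' := hι.map_ne_zero hs
    have h1 : Ψ (ι s) * Ψ ((ι s)⁻¹ * ι a) = Ψ (ι a) := by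
      rw [← map_mul, mul_inv_cancel_left₀ hs']
    have h2 := congrArg TrivSqZeroExt.fst h1
    rw [TrivSqZeroExt.fst_mul, hΨ, hΨ, hφ, hφ] at h2
    exact mul_left_cancel₀ hs' (h2.trans (mul_inv_cancel_left₀ hs' _).symm)
  have hmul : ∀ x y, (Ψ (x * y)).snd = (Ψ x).snd * y + x * (Ψ y).snd := by
    intro x y
    rw [map_mul, TrivSqZeroExt.snd_mul, hfst, hfst, smul_eq_mul, MulOpposite.smul_eq_mul_unop,
      MulOpposite.unop_op, add_comm]
  refine ⟨{ toFun := fun x => (Ψ x).snd, map_add' := fun x y => by simp, map_smul' := ?_ }, hmul,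
    fun a => congrArg TrivSqZeroExt.snd (hΨ a)⟩
  intro c x
  have hc : (Ψ (algebraMap ℂ K c)).snd = 0 := by
    rw [← ι.commutes, hΨ, AlgHom.commutes, TrivSqZeroExt.algebraMap_eq_inl', TrivSqZeroExt.snd_inl]
  rw [Algebra.smul_def, hmul, hc, zero_mul, zero_add, RingHom.id_apply, ← Algebra.smul_def]

/-- The inner derivation given by `z`. -/
noncomputable def innerDerivation {K : Type*} [Ring K] [Algebra ℂ K] (z : K) : K →ₗ[ℂ] K :=
  LinearMap.mulLeft ℂ z - LinearMap.mulRight ℂ z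

theorem innerDerivation_apply {K : Type*} [Ring K] [Algebra ℂ K] (z x : K) :
    innerDerivation z x = z * x - x * z := rfl

theorem isDerivation_innerDerivation {K : Type*} [Ring K] [Algebra ℂ K] (z : K) :
    IsDerivation (innerDerivation z) := by
  intro x y
  simp only [innerDerivation_apply]
  noncomm_ring

theorem IsDerivation.add {K : Type*} [Ring K] [Algebra ℂ K] {D D' : K →ₗ[ℂ] K}
    (hD : IsDerivation D) (hD' : IsDerivation D') : IsDerivation (D + D') := by
  intro x y
  simp only [LinearMap.add_apply, hD x y, hD' x y]
  noncomm_ring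

/-- Turns the prescription `h⁻¹[H, ·]` on generators into a genuine derivation, the inner one of
`h⁻¹ H`. -/
theorem innerDerivation_inv_mul {c x : K} (z : K) (hc : Commute c x) :
    innerDerivation (c⁻¹ * z) x = c⁻¹ * ⁅z, x⁆ := by
  rw [innerDerivation_apply, Ring.lie_def, mul_sub, ← mul_assoc x, ← (hc.inv_left₀).eq]
  simp only [mul_assoc]

end Derivations

/-! ## The algebras `Alg l` -/

section Presentation

variable {l : ℕ}

/-- The image of a generator in `Alg l`. -/
noncomputable def gen (g : Gen l) : Alg l := RingQuot.mkAlgHom ℂ (Rel l) (FreeAlgebra.ι ℂ g)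

theorem adjoin_range_gen : Algebra.adjoin ℂ (Set.range (gen (l := l))) = ⊤ := by
  have h : Set.range (gen (l := l)) =
      RingQuot.mkAlgHom ℂ (Rel l) '' Set.range (FreeAlgebra.ι ℂ) := by
    rw [← Set.range_comp]
    rfl
  rw [h, ← AlgHom.map_adjoin, FreeAlgebra.adjoin_range_ι, Algebra.map_top,
    AlgHom.range_eq_top]
  exact RingQuot.mkAlgHom_surjective ℂ _

theorem lie_f_succ (i : ZMod (l + 1)) : ⁅f i, f (i + 1)⁆ = (h : Alg l) := by
  simpa [Ring.lie_def, f, α, h] using RingQuot.mkAlgHom_rel ℂ (Rel.f_succ i)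

theorem lie_f_pred (i : ZMod (l + 1)) : ⁅f i, f (i - 1)⁆ = (-h : Alg l) := by
  have := lie_f_succ (i - 1)
  rw [sub_add_cancel] at this
  rw [← this, Ring.lie_def, Ring.lie_def, neg_sub]

theorem lie_f_of_ne {i j : ZMod (l + 1)} (h₁ : j ≠ i + 1) (h₂ : j ≠ i - 1) :
    ⁅f i, f j⁆ = (0 : Alg l) := by
  simpa [Ring.lie_def, f, α, h] using RingQuot.mkAlgHom_rel ℂ (Rel.f_f i j h₁ h₂)

theorem commute_f_of_ne {i j : ZMod (l + 1)} (h₁ : j ≠ i + 1) (h₂ : j ≠ i - 1) :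
    Commute (f i : Alg l) (f j) :=
  sub_eq_zero.mp (lie_f_of_ne h₁ h₂)

theorem commute_f_α (i j : ZMod (l + 1)) : Commute (f i : Alg l) (α j) :=
  sub_eq_zero.mp (by simpa [Ring.lie_def, f, α, h] using RingQuot.mkAlgHom_rel ℂ (Rel.f_α i j))

theorem commute_α_α (i j : ZMod (l + 1)) : Commute (α i : Alg l) (α j) :=
  sub_eq_zero.mp (by simpa [Ring.lie_def, f, α, h] using RingQuot.mkAlgHom_rel ℂ (Rel.α_α i j))

theorem commute_h_f (j : ZMod (l + 1)) : Commute (h : Alg l) (f j) :=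
  sub_eq_zero.mp (by simpa [Ring.lie_def, f, α, h] using RingQuot.mkAlgHom_rel ℂ (Rel.h_f j))

theorem commute_h_α (j : ZMod (l + 1)) : Commute (h : Alg l) (α j) :=
  sub_eq_zero.mp (by simpa [Ring.lie_def, f, α, h] using RingQuot.mkAlgHom_rel ℂ (Rel.h_α j))

theorem mem_center_of_commute_gen {A I : Type*} [Ring A] [Algebra ℂ A] {u : I → A}
    (hu : Algebra.adjoin ℂ (Set.range u) = ⊤) {z : A} (hz : ∀ i, Commute z (u i)) :
    z ∈ Subalgebra.center ℂ A := by
  rw [Subalgebra.mem_center_iff]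
  intro b
  have hb : b ∈ Algebra.adjoin ℂ (Set.range u) := by rw [hu]; trivial
  induction hb using Algebra.adjoin_induction with
  | mem x hx => obtain ⟨i, rfl⟩ := hx; exact (hz i).eq.symm
  | algebraMap r => exact Algebra.commutes r z
  | add x y _ _ hx hy => rw [add_mul, mul_add, hx, hy]
  | mul x y _ _ hx hy => rw [mul_assoc, hy, ← mul_assoc, hx, mul_assoc]

theorem h_mem_center : (h : Alg l) ∈ Subalgebra.center ℂ (Alg l) :=
  mem_center_of_commute_gen adjoin_range_gen fun g => match g with
    | .f i => commute_h_f i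
    | .α i => commute_h_α i
    | .h => Commute.refl _

theorem α_mem_center (i : ZMod (l + 1)) : (α i : Alg l) ∈ Subalgebra.center ℂ (Alg l) :=
  mem_center_of_commute_gen adjoin_range_gen fun g => match g with
    | .f j => (commute_f_α j i).symm
    | .α j => commute_α_α i j
    | .h => (commute_h_α i).symm

theorem k_mem_center : (k : Alg l) ∈ Subalgebra.center ℂ (Alg l) :=
  sum_mem fun i _ => α_mem_center i

theorem commute_of_mem_center {A : Type*} [Ring A] [Algebra ℂ A] {z : A}
    (hz : z ∈ Subalgebra.center ℂ A) (a : A) : Commute z a :=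
  (Subalgebra.mem_center_iff.mp hz a).symm

/-- The universal property of `Alg l`, in terms of the images of the generators. -/
theorem exists_algHom {B : Type*} [Ring B] [Algebra ℂ B] (v : Gen l → B)
    (hf : ∀ i, ⁅v (.f i), v (.f (i + 1))⁆ = v .h)
    (hff : ∀ i j, j ≠ i + 1 → j ≠ i - 1 → ⁅v (.f i), v (.f j)⁆ = 0)
    (hα : ∀ j g, Commute (v (.α j)) (v g)) (hh : ∀ g, Commute (v .h) (v g)) :
    ∃ φ : Alg l →ₐ[ℂ] B, ∀ g, φ (gen g) = v g := by
  refine ⟨RingQuot.liftAlgHom ℂ ⟨FreeAlgebra.lift ℂ v, ?_⟩, fun g => ?_⟩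
  · intro x y hxy
    cases hxy with
    | f_succ i => simpa [Ring.lie_def] using hf i
    | f_f i j h₁ h₂ => simpa [Ring.lie_def] using hff i j h₁ h₂
    | f_α i j => simpa [Ring.lie_def, sub_eq_zero] using (hα j (.f i)).eq.symm
    | α_α i j => simpa [Ring.lie_def, sub_eq_zero] using (hα i (.α j)).eq
    | h_f j => simpa [Ring.lie_def, sub_eq_zero] using (hh (.f j)).eq
    | h_α j => simpa [Ring.lie_def, sub_eq_zero] using (hh (.α j)).eq
  · simp [gen]

instance : Finite (Gen l) :=
  Finite.of_surjective
    (fun x : ZMod (l + 1) ⊕ ZMod (l + 1) ⊕ Unit =>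
      Sum.elim Gen.f (Sum.elim Gen.α fun _ => Gen.h) x)
    fun g => match g with
      | .f i => ⟨.inl i, rfl⟩
      | .α i => ⟨.inr (.inl i), rfl⟩
      | .h => ⟨.inr (.inr ()), rfl⟩

end Presentation

/-! ### Representation by Weyl operators -/

theorem pderiv_pderiv_comm {σ R : Type*} [CommSemiring R] (i j : σ) (p : MvPolynomial σ R) :
    pderiv i (pderiv j p) = pderiv j (pderiv i p) := by
  induction p using MvPolynomial.induction_on with
  | C a => simp
  | add p q hp hq => simp [hp, hq]
  | mul_X p n hp =>
    have h1 : ∀ a b : σ, pderiv a (pderiv b (X n : MvPolynomial σ R)) = 0 := by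
      classical
      intro a b
      rw [pderiv_X]
      by_cases hb : n = b
      · subst hb; simp
      · simp [hb]
    simp only [pderiv_mul, map_add, hp, h1]
    ring

/-- The operator `X g * · + X c * ∂/∂X d` on polynomials. -/
noncomputable def weylOp {σ : Type*} (g c d : σ) : Module.End ℂ (MvPolynomial σ ℂ) :=
  LinearMap.mulLeft ℂ (X g) + LinearMap.mulLeft ℂ (X c) ∘ₗ (pderiv d).toLinearMap

theorem weylOp_apply {σ : Type*} (g c d : σ) (p : MvPolynomial σ ℂ) :
    weylOp g c d p = X g * p + X c * pderiv d p := rfl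

/-- Differentiation loses one degree and the variable restores it, so the leading part of `weylOp g
c d` is multiplication by `X g`. -/
theorem X_mul_pderiv_mem_degreeLT {σ : Type*} (c d : σ) (m : σ →₀ ℕ) :
    X c * pderiv d (monomial m (1 : ℂ)) ∈ degreeLT ℂ σ (m.degree + 1) := by
  rw [pderiv_monomial]
  by_cases hd : m d = 0
  · simp [hd]
  · refine X_mul_mem_degreeLT c (monomial_mem_degreeLT ?_)
    have h1 : Finsupp.single d 1 ≤ m := by
      rw [Finsupp.single_le_iff]
      omega
    have h2 := congrArg Finsupp.degree (tsub_add_cancel_of_le h1)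
    rw [map_add, Finsupp.degree_single] at h2
    omega

theorem gen_mem_wordSpan {A I : Type*} [Ring A] [Algebra ℂ A] (u : I → A) (i : I) :
    u i ∈ wordSpan ℂ u 2 := by
  simpa using list_prod_mem_wordSpan (𝕜 := ℂ) u (L := [i]) (n := 2) (by simp)

section

variable {l : ℕ}

/-- The bracket of the operators for `f_i` and `f_j` is `X_h (δ_{j,i+1} - δ_{i,j+1})`. This matches
the relations once `i + 2 ≠ i`, which is where `2 ≤ l` enters. -/
theorem exists_rep (hl : 2 ≤ l) :
    ∃ ρ : Alg l →ₐ[ℂ] Module.End ℂ (MvPolynomial (Gen l) ℂ),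
      (∀ i, ρ (f i) = weylOp (.f i) .h (.f (i + 1))) ∧
      (∀ i, ρ (α i) = LinearMap.mulLeft ℂ (X (.α i))) ∧ ρ h = LinearMap.mulLeft ℂ (X .h) := by
  classical
  have h2 : (2 : ZMod (l + 1)) ≠ 0 := by
    intro h0
    have h1 : ((2 : ℕ) : ZMod (l + 1)) = 0 := by exact_mod_cast h0
    rw [ZMod.natCast_eq_zero_iff] at h1
    exact absurd (Nat.le_of_dvd (by omega) h1) (by omega)
  refine Exists.elim (exists_algHom (l := l) (B := Module.End ℂ (MvPolynomial (Gen l) ℂ))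
    (fun g => match g with
      | .f i => weylOp (.f i) .h (.f (i + 1))
      | .α i => LinearMap.mulLeft ℂ (X (.α i))
      | .h => LinearMap.mulLeft ℂ (X .h)) ?_ ?_ ?_ ?_) ?_
  · intro i
    refine LinearMap.ext fun p => ?_
    have h3 : i ≠ i + 1 + 1 := fun h => h2 (by linear_combination -h)
    simp only [Ring.lie_def, LinearMap.sub_apply, Module.End.mul_apply, weylOp_apply, map_add,
      pderiv_mul, pderiv_X, LinearMap.mulLeft_apply, Pi.single_apply, Gen.f.injEq, reduceCtorEq,
      if_true, if_false, h3, pderiv_pderiv_comm (Gen.f (i + 1 + 1)) (Gen.f (i + 1))]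
    ring
  · intro i j h3 h4
    have h5 : i ≠ j + 1 := fun h => h4 (by rw [h, add_sub_cancel_right])
    refine LinearMap.ext fun p => ?_
    simp only [Ring.lie_def, LinearMap.sub_apply, Module.End.mul_apply, weylOp_apply, map_add,
      pderiv_mul, pderiv_X, LinearMap.zero_apply, Pi.single_apply, Gen.f.injEq, reduceCtorEq,
      if_false, h3, h5, pderiv_pderiv_comm (Gen.f (i + 1)) (Gen.f (j + 1))]
    ring
  · rintro i (j | j | _) <;> refine LinearMap.ext fun p => ?_ <;>
    · simp only [Module.End.mul_apply, weylOp_apply, LinearMap.mulLeft_apply, pderiv_mul,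
        pderiv_X, Pi.single_apply, reduceCtorEq, if_false] <;>
      ring
  · rintro (j | j | _) <;> refine LinearMap.ext fun p => ?_ <;>
    · simp only [Module.End.mul_apply, weylOp_apply, LinearMap.mulLeft_apply, pderiv_mul,
        pderiv_X, Pi.single_apply, reduceCtorEq, if_false] <;>
      ring
  · exact fun ρ hρ => ⟨ρ, fun i => hρ (.f i), fun i => hρ (.α i), hρ .h⟩

/-- In the polynomial representation `h` sends `1` to a variable. -/
theorem h_ne_zero (hl : 2 ≤ l) : (h : Alg l) ≠ 0 := by
  intro h0
  obtain ⟨ρ, -, -, hρ⟩ := exists_rep hl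
  have h1 := congrArg (fun T : Module.End ℂ (MvPolynomial (Gen l) ℂ) => T 1) hρ
  simp only [h0, map_zero, LinearMap.zero_apply, LinearMap.mulLeft_apply, mul_one] at h1
  exact X_ne_zero _ h1.symm

theorem hasQuotientSkewField_alg (hl : 2 ≤ l) : HasQuotientSkewField (Alg l) := by
  obtain ⟨ρ, hf, hα, hh⟩ := exists_rep hl
  refine hasQuotientSkewField_of_rep (u := gen) (ρ := ρ) adjoin_range_gen ?_ ?_
  · have hcentral : ∀ z ∈ Subalgebra.center ℂ (Alg l), ∀ a,
        ⁅z, a⁆ ∈ wordSpan ℂ (gen (l := l)) 2 ∧ ⁅a, z⁆ ∈ wordSpan ℂ (gen (l := l)) 2 := by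
      intro z hz a
      rw [Ring.lie_def, Ring.lie_def, (commute_of_mem_center hz a).eq, sub_self]
      exact ⟨zero_mem _, zero_mem _⟩
    have hh2 : (h : Alg l) ∈ wordSpan ℂ (gen (l := l)) 2 := gen_mem_wordSpan gen .h
    rintro (i | i | _) (j | j | _)
    · change ⁅f i, f j⁆ ∈ _
      by_cases h1 : j = i + 1
      · rw [h1, lie_f_succ]; exact hh2
      by_cases h2 : j = i - 1
      · rw [h2, lie_f_pred]; exact neg_mem hh2
      rw [lie_f_of_ne h1 h2]; exact zero_mem _
    all_goals first
      | exact (hcentral _ h_mem_center _).1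
      | exact (hcentral _ h_mem_center _).2
      | exact (hcentral _ (α_mem_center _) _).1
      | exact (hcentral _ (α_mem_center _) _).2
  · rintro (i | i | _) m
    · change ρ (f i) _ - _ ∈ _
      rw [hf, weylOp_apply, add_sub_cancel_left]
      exact X_mul_pderiv_mem_degreeLT _ _ _
    · change ρ (α i) _ - _ ∈ _
      rw [hα, LinearMap.mulLeft_apply, sub_self]
      exact zero_mem _
    · change ρ h _ - _ ∈ _
      rw [hh, LinearMap.mulLeft_apply, sub_self]
      exact zero_mem _

/-- Existence of a derivation of the quotient skew field with prescribed central-bracket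
perturbation of an inner derivation. -/
theorem exists_derivation_alg {K : Type*} [DivisionRing K] [Algebra ℂ K] {ι : Alg l →ₐ[ℂ] K}
    (hι : IsQuotientSkewField ι) (e : ZMod (l + 1) → Alg l)
    (he : ∀ i, e i * f (i + 1) + f i * e (i + 1) - (e (i + 1) * f i + f (i + 1) * e i) = 0)
    (he' : ∀ i j, j ≠ i + 1 → j ≠ i - 1 → e i * f j + f i * e j - (e j * f i + f j * e i) = 0)
    (H : Alg l) :
    ∃ D : K →ₗ[ℂ] K, IsDerivation D ∧
      (∀ i, D (ι (f i)) = (ι h)⁻¹ * ⁅ι H, ι (f i)⁆ + ι (e i)) ∧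
      (∀ i, D (ι (α i)) = (ι h)⁻¹ * ⁅ι H, ι (α i)⁆) ∧
      D (ι h) = (ι h)⁻¹ * ⁅ι H, ι h⁆ := by
  have hcomm : ∀ a, Commute (ι h) (ι a) := fun a => (commute_of_mem_center h_mem_center a).map ι
  -- The generator `f_i` goes to `f_i + ε e_i`, while the `α_i` and `h` stay constant. The
  -- `ε`-components of the relations among the `f_i` are precisely `he` and `he'`.
  refine Exists.elim (exists_algHom (l := l) (B := DualNumber K)
    (fun g => match g with
      | .f i => TrivSqZeroExt.inl (ι (f i)) + TrivSqZeroExt.inr (ι (e i))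
      | .α i => TrivSqZeroExt.inl (ι (α i))
      | .h => TrivSqZeroExt.inl (ι h)) ?_ ?_ ?_ ?_) ?_
  · intro i
    ext
    · simpa [Ring.lie_def] using congrArg ι (lie_f_succ i)
    · have := congrArg ι (he i)
      simp only [map_sub, map_add, map_mul, map_zero] at this
      simp [Ring.lie_def]
      rw [← this]
      abel
  · intro i j h1 h2
    ext
    · simpa [Ring.lie_def] using congrArg ι (lie_f_of_ne h1 h2)
    · have := congrArg ι (he' i j h1 h2)
      simp only [map_sub, map_add, map_mul, map_zero] at this
      simp [Ring.lie_def]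
      rw [← this]
      abel
  · have hc : ∀ i a, ι (α i) * ι a = ι a * ι (α i) := fun i a =>
      ((commute_of_mem_center (α_mem_center i) a).map ι).eq
    rintro i (j | j | _) <;> refine TrivSqZeroExt.ext ?_ ?_ <;> simp <;> exact hc _ _
  · rintro (j | j | _) <;> refine TrivSqZeroExt.ext ?_ ?_ <;> simp <;> exact (hcomm _).eq
  · intro φ hφ
    have hfst : ∀ a, (φ a).fst = ι a := by
      intro a
      have ha : a ∈ Algebra.adjoin ℂ (Set.range (gen (l := l))) := by
        rw [adjoin_range_gen]; trivial
      induction ha using Algebra.adjoin_induction with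
      | mem x hx =>
        obtain ⟨(i | i | _), rfl⟩ := hx <;> rw [hφ] <;> simp <;> rfl
      | algebraMap r => simp [TrivSqZeroExt.algebraMap_eq_inl']
      | add x y _ _ hx hy => simp [hx, hy]
      | mul x y _ _ hx hy => simp [hx, hy]
    obtain ⟨D, hD, hDφ⟩ := hι.exists_derivation φ hfst
    have h1 : ∀ i, (φ (f i)).snd = ι (e i) := fun i => by
      rw [show f i = gen (.f i) from rfl, hφ]; simp
    have h2 : ∀ i, (φ (α i)).snd = 0 := fun i => by
      rw [show α i = gen (.α i) from rfl, hφ]; simp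
    have h3 : (φ h).snd = 0 := by
      rw [show h = gen .h from rfl, hφ]; simp
    refine ⟨innerDerivation ((ι h)⁻¹ * ι H) + D, (isDerivation_innerDerivation _).add hD,
      fun i => ?_, fun i => ?_, ?_⟩
    · rw [LinearMap.add_apply, hDφ, h1, innerDerivation_inv_mul _ (hcomm _)]
    · rw [LinearMap.add_apply, hDφ, h2, innerDerivation_inv_mul _ (hcomm _), add_zero]
    · rw [LinearMap.add_apply, hDφ, h3, innerDerivation_inv_mul _ (hcomm _), add_zero]

end

/-! ## The case `l = 1` -/

section One

/-- The image of a generator in `Alg₁`. -/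
noncomputable def gen₁ (g : Gen₁) : Alg₁ := RingQuot.mkAlgHom ℂ Rel₁ (FreeAlgebra.ι ℂ g)

theorem adjoin_range_gen₁ : Algebra.adjoin ℂ (Set.range gen₁) = ⊤ := by
  have h : Set.range gen₁ = RingQuot.mkAlgHom ℂ Rel₁ '' Set.range (FreeAlgebra.ι ℂ) := by
    rw [← Set.range_comp]
    rfl
  rw [h, ← AlgHom.map_adjoin, FreeAlgebra.adjoin_range_ι, Algebra.map_top,
    AlgHom.range_eq_top]
  exact RingQuot.mkAlgHom_surjective ℂ _

theorem lie_f₁_one_zero : ⁅f₁ 1, f₁ 0⁆ = 2 * h₁ * f₁ 2 := by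
  simpa [Ring.lie_def, f₁, h₁, two_mul] using RingQuot.mkAlgHom_rel ℂ Rel₁.f₁_f₀

theorem lie_f₁_zero_two : ⁅f₁ 0, f₁ 2⁆ = h₁ := by
  simpa [Ring.lie_def, f₁, h₁] using RingQuot.mkAlgHom_rel ℂ Rel₁.f₀_f₂

theorem lie_f₁_two_one : ⁅f₁ 2, f₁ 1⁆ = h₁ := by
  simpa [Ring.lie_def, f₁, h₁] using RingQuot.mkAlgHom_rel ℂ Rel₁.f₂_f₁

theorem commute_f₁_α₁ (i : Fin 3) (j : Fin 2) : Commute (f₁ i) (α₁ j) :=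
  sub_eq_zero.mp (by simpa [Ring.lie_def, f₁, α₁] using RingQuot.mkAlgHom_rel ℂ (Rel₁.f_α i j))

theorem commute_α₁_α₁ (i j : Fin 2) : Commute (α₁ i) (α₁ j) :=
  sub_eq_zero.mp (by simpa [Ring.lie_def, α₁] using RingQuot.mkAlgHom_rel ℂ (Rel₁.α_α i j))

theorem commute_h₁_α₁ (j : Fin 2) : Commute h₁ (α₁ j) :=
  sub_eq_zero.mp (by simpa [Ring.lie_def, h₁, α₁] using RingQuot.mkAlgHom_rel ℂ (Rel₁.h_α j))

theorem commute_f₁_h₁ (i : Fin 3) : Commute (f₁ i) h₁ :=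
  sub_eq_zero.mp (by simpa [Ring.lie_def, f₁, h₁] using RingQuot.mkAlgHom_rel ℂ (Rel₁.f_h i))

theorem h₁_mem_center : h₁ ∈ Subalgebra.center ℂ Alg₁ :=
  mem_center_of_commute_gen adjoin_range_gen₁ fun g => match g with
    | .f i => (commute_f₁_h₁ i).symm
    | .α i => commute_h₁_α₁ i
    | .h => Commute.refl _

theorem α₁_mem_center (i : Fin 2) : α₁ i ∈ Subalgebra.center ℂ Alg₁ :=
  mem_center_of_commute_gen adjoin_range_gen₁ fun g => match g with
    | .f j => (commute_f₁_α₁ j i).symm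
    | .α j => commute_α₁_α₁ i j
    | .h => (commute_h₁_α₁ i).symm

theorem k₁_mem_center : k₁ ∈ Subalgebra.center ℂ Alg₁ :=
  add_mem (α₁_mem_center 0) (α₁_mem_center 1)

/-- The universal property of `Alg₁`, in terms of the images of the generators. -/
theorem exists_algHom₁ {B : Type*} [Ring B] [Algebra ℂ B] (v : Gen₁ → B)
    (h10 : ⁅v (.f 1), v (.f 0)⁆ = 2 * v .h * v (.f 2))
    (h02 : ⁅v (.f 0), v (.f 2)⁆ = v .h) (h21 : ⁅v (.f 2), v (.f 1)⁆ = v .h)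
    (hα : ∀ j g, Commute (v (.α j)) (v g)) (hh : ∀ i, Commute (v .h) (v (.f i))) :
    ∃ φ : Alg₁ →ₐ[ℂ] B, ∀ g, φ (gen₁ g) = v g := by
  refine ⟨RingQuot.liftAlgHom ℂ ⟨FreeAlgebra.lift ℂ v, ?_⟩, fun g => ?_⟩
  · intro x y hxy
    cases hxy with
    | f₁_f₀ => simpa [Ring.lie_def, two_mul] using h10
    | f₀_f₂ => simpa [Ring.lie_def] using h02
    | f₂_f₁ => simpa [Ring.lie_def] using h21
    | f_α i j => simpa [Ring.lie_def, sub_eq_zero] using (hα j (.f i)).eq.symm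
    | α_α i j => simpa [Ring.lie_def, sub_eq_zero] using (hα i (.α j)).eq
    | h_α j => simpa [Ring.lie_def, sub_eq_zero] using (hα j .h).eq.symm
    | f_h i => simpa [Ring.lie_def, sub_eq_zero] using (hh i).eq.symm
  · simp [gen₁]

/-! ### The Casimir element and Heisenberg generators for `l = 1` -/

/-- The central element `f₀ + f₁ + f₂²`. -/
noncomputable def casimir₁ : Alg₁ := f₁ 0 + f₁ 1 + f₁ 2 * f₁ 2

/-- The bracket `[b, a] = 2 z c` cancels `[c * c, a] = -(c z + z c)`, and `[a, c] = z` cancels `[b,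
c] = -z`. -/
theorem commute_casimir {A : Type*} [Ring A] {a b c z : A} (hba : b * a - a * b = 2 * z * c)
    (hac : a * c - c * a = z) (hcb : c * b - b * c = z) (hzc : z * c = c * z) :
    Commute (a + b + c * c) a ∧ Commute (a + b + c * c) c := by
  constructor
  · change (a + b + c * c) * a = a * (a + b + c * c)
    linear_combination (norm := noncomm_ring) hba - c * hac - hac * c + hzc
  · change (a + b + c * c) * c = c * (a + b + c * c)
    linear_combination (norm := noncomm_ring) hac - hcb

theorem casimir₁_mem_center : casimir₁ ∈ Subalgebra.center ℂ Alg₁ := by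
  obtain ⟨k0, k2⟩ : Commute casimir₁ (f₁ 0) ∧ Commute casimir₁ (f₁ 2) :=
    commute_casimir lie_f₁_one_zero lie_f₁_zero_two lie_f₁_two_one
      (commute_of_mem_center h₁_mem_center _).eq
  have k1 : Commute casimir₁ (f₁ 1) := by
    have : f₁ 1 = casimir₁ - f₁ 0 - f₁ 2 * f₁ 2 := by rw [casimir₁]; abel
    rw [this]
    exact ((Commute.refl _).sub_right k0).sub_right (k2.mul_right k2)
  refine mem_center_of_commute_gen adjoin_range_gen₁ ?_
  rintro (i | i | _)
  · fin_cases i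
    exacts [k0, k1, k2]
  · exact (commute_of_mem_center (α₁_mem_center i) _).symm
  · exact (commute_of_mem_center h₁_mem_center _).symm

/-- Generators of `Alg₁`, with `f₁` replaced by the central element `casimir₁`. -/
noncomputable def heisenbergGen₁ : Gen₁ → Alg₁
  | .f i => if i = 1 then casimir₁ else f₁ i
  | .α i => α₁ i
  | .h => h₁

/-- The growth argument needs commutators of word length at most one, and `[f₁, f₀]` has length two.
After the change of generators the only nonzero bracket is `[f₀, f₂] = h`, up to sign; `f₁` is
recovered as a polynomial in the new generators. -/
theorem adjoin_range_heisenbergGen₁ : Algebra.adjoin ℂ (Set.range heisenbergGen₁) = ⊤ := by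
  rw [← top_le_iff, ← adjoin_range_gen₁, Algebra.adjoin_le_iff]
  have hmem : ∀ g, heisenbergGen₁ g ∈ Algebra.adjoin ℂ (Set.range heisenbergGen₁) := fun g =>
    Algebra.subset_adjoin ⟨g, rfl⟩
  have h0 : f₁ 0 ∈ Algebra.adjoin ℂ (Set.range heisenbergGen₁) := hmem (.f 0)
  have h2 : f₁ 2 ∈ Algebra.adjoin ℂ (Set.range heisenbergGen₁) := hmem (.f 2)
  have hc : casimir₁ ∈ Algebra.adjoin ℂ (Set.range heisenbergGen₁) := hmem (.f 1)
  rintro _ ⟨(i | i | _), rfl⟩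
  · fin_cases i
    · exact h0
    · have : f₁ 1 = casimir₁ - f₁ 0 - f₁ 2 * f₁ 2 := by rw [casimir₁]; abel
      change f₁ 1 ∈ _
      rw [this]
      exact sub_mem (sub_mem hc h0) (mul_mem h2 h2)
    · exact h2
  · exact hmem (.α i)
  · exact hmem .h

theorem exists_rep₁ :
    ∃ ρ : Alg₁ →ₐ[ℂ] Module.End ℂ (MvPolynomial Gen₁ ℂ),
      ρ (f₁ 0) = weylOp (.f 0) .h (.f 2) ∧ ρ (f₁ 2) = LinearMap.mulLeft ℂ (X (.f 2)) ∧
      ρ casimir₁ = LinearMap.mulLeft ℂ (X (.f 1)) ∧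
      (∀ i, ρ (α₁ i) = LinearMap.mulLeft ℂ (X (.α i))) ∧ ρ h₁ = LinearMap.mulLeft ℂ (X .h) := by
  classical
  let x : Gen₁ → Module.End ℂ (MvPolynomial Gen₁ ℂ) := fun g => LinearMap.mulLeft ℂ (X g)
  refine Exists.elim (exists_algHom₁ (B := Module.End ℂ (MvPolynomial Gen₁ ℂ))
    (fun g => match g with
      -- The image of `f₁` is dictated by requiring `casimir₁` to act as multiplication by the
      -- variable `X (.f 1)`.
      | .f i => ![weylOp (.f 0) .h (.f 2),
          x (.f 1) - weylOp (.f 0) .h (.f 2) - x (.f 2) * x (.f 2), x (.f 2)] i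
      | .α i => x (.α i)
      | .h => x .h) ?_ ?_ ?_ ?_ ?_) ?_
  · refine LinearMap.ext fun p => ?_
    simp only [Ring.lie_def, LinearMap.sub_apply, Module.End.mul_apply, weylOp_apply, map_add,
      map_sub, pderiv_mul, pderiv_X, LinearMap.mulLeft_apply, Pi.single_apply, Gen₁.f.injEq,
      reduceCtorEq, Matrix.cons_val, x, two_mul, LinearMap.add_apply]
    simp [show ¬(1 : Fin 3) = 2 by decide]
    ring
  · refine LinearMap.ext fun p => ?_
    simp only [Ring.lie_def, LinearMap.sub_apply, Module.End.mul_apply, weylOp_apply, map_add,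
      map_sub, pderiv_mul, pderiv_X, LinearMap.mulLeft_apply, Pi.single_apply, Matrix.cons_val, x]
    norm_num
    ring
  · refine LinearMap.ext fun p => ?_
    simp only [Ring.lie_def, LinearMap.sub_apply, Module.End.mul_apply, weylOp_apply, map_add,
      map_sub, pderiv_mul, pderiv_X, LinearMap.mulLeft_apply, Pi.single_apply, Matrix.cons_val, x]
    norm_num
    ring
  · rintro j (i | i | _)
    · fin_cases i <;> refine LinearMap.ext fun p => ?_ <;>
      · simp [LinearMap.sub_apply, Module.End.mul_apply, weylOp_apply,
          pderiv_X, LinearMap.mulLeft_apply, x]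
        ring
    all_goals
      refine LinearMap.ext fun p => ?_
      simp only [Module.End.mul_apply, LinearMap.mulLeft_apply, x]
      ring
  · intro i
    fin_cases i <;> refine LinearMap.ext fun p => ?_ <;>
    · simp [LinearMap.sub_apply, Module.End.mul_apply, weylOp_apply,
        pderiv_X, LinearMap.mulLeft_apply, x]
      ring
  · intro ρ hρ
    have h0 := hρ (.f 0)
    have h1 := hρ (.f 1)
    have h2 := hρ (.f 2)
    refine ⟨ρ, h0, h2, ?_, fun i => hρ (.α i), hρ .h⟩
    change ρ (f₁ 0) = _ at h0
    change ρ (f₁ 1) = _ at h1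
    change ρ (f₁ 2) = _ at h2
    rw [casimir₁, map_add, map_add, map_mul, h0, h1, h2]
    simp only [x, Matrix.cons_val]
    abel

instance : Finite Gen₁ :=
  Finite.of_surjective
    (fun x : Fin 3 ⊕ Fin 2 ⊕ Unit => Sum.elim Gen₁.f (Sum.elim Gen₁.α fun _ => Gen₁.h) x)
    fun g => match g with
      | .f i => ⟨.inl i, rfl⟩
      | .α i => ⟨.inr (.inl i), rfl⟩
      | .h => ⟨.inr (.inr ()), rfl⟩

theorem h₁_ne_zero : h₁ ≠ 0 := by
  intro h0
  obtain ⟨ρ, -, -, -, -, hρ⟩ := exists_rep₁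
  have h1 := congrArg (fun T : Module.End ℂ (MvPolynomial Gen₁ ℂ) => T 1) hρ
  simp only [h0, map_zero, LinearMap.zero_apply, LinearMap.mulLeft_apply, mul_one] at h1
  exact X_ne_zero _ h1.symm

theorem hasQuotientSkewField_alg₁ : HasQuotientSkewField Alg₁ := by
  obtain ⟨ρ, h0, h2, hc, hα, hh⟩ := exists_rep₁
  refine hasQuotientSkewField_of_rep (u := heisenbergGen₁) (ρ := ρ)
    adjoin_range_heisenbergGen₁ ?_ ?_
  · have hcentral : ∀ z ∈ Subalgebra.center ℂ Alg₁, ∀ a,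
        ⁅z, a⁆ ∈ wordSpan ℂ heisenbergGen₁ 2 ∧ ⁅a, z⁆ ∈ wordSpan ℂ heisenbergGen₁ 2 := by
      intro z hz a
      rw [Ring.lie_def, Ring.lie_def, (commute_of_mem_center hz a).eq, sub_self]
      exact ⟨zero_mem _, zero_mem _⟩
    have hh2 : h₁ ∈ wordSpan ℂ heisenbergGen₁ 2 := gen_mem_wordSpan heisenbergGen₁ .h
    have hself : ∀ a : Alg₁, ⁅a, a⁆ ∈ wordSpan ℂ heisenbergGen₁ 2 := fun a => by
      rw [Ring.lie_def, sub_self]; exact zero_mem _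
    rintro (i | i | _) (j | j | _)
    · fin_cases i <;> fin_cases j
      · exact hself _
      · exact (hcentral _ casimir₁_mem_center _).2
      · change ⁅f₁ 0, f₁ 2⁆ ∈ _
        rw [lie_f₁_zero_two]; exact hh2
      · exact (hcentral _ casimir₁_mem_center _).1
      · exact (hcentral _ casimir₁_mem_center _).1
      · exact (hcentral _ casimir₁_mem_center _).1
      · change ⁅f₁ 2, f₁ 0⁆ ∈ _
        rw [Ring.lie_def, ← neg_sub, ← Ring.lie_def, lie_f₁_zero_two]; exact neg_mem hh2
      · exact (hcentral _ casimir₁_mem_center _).2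
      · exact hself _
    all_goals first
      | exact (hcentral _ h₁_mem_center _).1
      | exact (hcentral _ h₁_mem_center _).2
      | exact (hcentral _ (α₁_mem_center _) _).1
      | exact (hcentral _ (α₁_mem_center _) _).2
  · rintro (i | i | _) m
    · fin_cases i
      · change ρ (f₁ 0) _ - X (Gen₁.f 0) * _ ∈ _
        rw [h0, weylOp_apply, add_sub_cancel_left]
        exact X_mul_pderiv_mem_degreeLT _ _ _
      · change ρ casimir₁ _ - X (Gen₁.f 1) * _ ∈ _
        rw [hc, LinearMap.mulLeft_apply, sub_self]
        exact zero_mem _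
      · change ρ (f₁ 2) _ - X (Gen₁.f 2) * _ ∈ _
        rw [h2, LinearMap.mulLeft_apply, sub_self]
        exact zero_mem _
    · change ρ (α₁ i) _ - _ ∈ _
      rw [hα, LinearMap.mulLeft_apply, sub_self]
      exact zero_mem _
    · change ρ h₁ _ - _ ∈ _
      rw [hh, LinearMap.mulLeft_apply, sub_self]
      exact zero_mem _

/-! ### The derivation and the equations for `l = 1` -/

/-- Adding the central `ε k` to `f₀` changes no bracket, and neither `f₂` nor `h` on the right-hand
sides moves, so all relations survive in the dual numbers. -/
theorem exists_derivation₁ {K : Type*} [DivisionRing K] [Algebra ℂ K] {ι : Alg₁ →ₐ[ℂ] K}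
    (hι : IsQuotientSkewField ι) : ∃ D : K →ₗ[ℂ] K, IsPainleveDerivation₁ ι D := by
  have hcomm : ∀ a, Commute (ι h₁) (ι a) := fun a => (commute_of_mem_center h₁_mem_center a).map ι
  have hk : ∀ a, ι k₁ * ι a = ι a * ι k₁ := fun a =>
    ((commute_of_mem_center k₁_mem_center a).map ι).eq
  obtain ⟨perturb, hp⟩ : ∃ e : Fin 3 → Alg₁, ∀ i, ι (e i) = if i = 0 then ι k₁ else 0 :=
    ⟨fun i => if i = 0 then k₁ else 0, fun i => by simp only [apply_ite ι, map_zero]⟩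
  refine Exists.elim (exists_algHom₁ (B := DualNumber K)
    (fun g => match g with
      | .f i => TrivSqZeroExt.inl (ι (f₁ i)) + TrivSqZeroExt.inr (ι (perturb i))
      | .α i => TrivSqZeroExt.inl (ι (α₁ i))
      | .h => TrivSqZeroExt.inl (ι h₁)) ?_ ?_ ?_ ?_ ?_) ?_
  · ext
    · simpa [Ring.lie_def, two_mul, add_mul] using congrArg ι lie_f₁_one_zero
    · simp [Ring.lie_def, two_mul, add_mul, hk, hp]
  · ext
    · simpa [Ring.lie_def] using congrArg ι lie_f₁_zero_two
    · simp [Ring.lie_def, hk, hp]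
  · ext
    · simpa [Ring.lie_def] using congrArg ι lie_f₁_two_one
    · simp [Ring.lie_def, hp]
  · have hc : ∀ i a, ι (α₁ i) * ι a = ι a * ι (α₁ i) := fun i a =>
      ((commute_of_mem_center (α₁_mem_center i) a).map ι).eq
    rintro i (j | j | _)
    · refine TrivSqZeroExt.ext ?_ ?_ <;> simp
      · exact hc _ _
      · exact hc _ _
    all_goals refine TrivSqZeroExt.ext ?_ ?_ <;> simp <;> exact hc _ _
  · intro j
    refine TrivSqZeroExt.ext ?_ ?_ <;> simp
    · exact (hcomm _).eq
    · exact (hcomm _).eq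
  intro φ hφ
  have hfst : ∀ a, (φ a).fst = ι a := by
    intro a
    have ha : a ∈ Algebra.adjoin ℂ (Set.range gen₁) := by
      rw [adjoin_range_gen₁]; trivial
    induction ha using Algebra.adjoin_induction with
    | mem x hx =>
      obtain ⟨(i | i | _), rfl⟩ := hx <;> rw [hφ] <;> simp <;> rfl
    | algebraMap r => simp [TrivSqZeroExt.algebraMap_eq_inl']
    | add x y _ _ hx hy => simp [hx, hy]
    | mul x y _ _ hx hy => simp [hx, hy]
  obtain ⟨D, hD, hDφ⟩ := hι.exists_derivation φ hfst
  have h1 : ∀ i, (φ (f₁ i)).snd = if i = 0 then ι k₁ else 0 := fun i => by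
    rw [show f₁ i = gen₁ (.f i) from rfl, hφ, ← hp]; simp
  have h2 : ∀ i, (φ (α₁ i)).snd = 0 := fun i => by
    rw [show α₁ i = gen₁ (.α i) from rfl, hφ]; simp
  have h3 : (φ h₁).snd = 0 := by
    rw [show h₁ = gen₁ .h from rfl, hφ]; simp
  refine ⟨innerDerivation ((ι h₁)⁻¹ * ι hamiltonian₁) + D,
    (isDerivation_innerDerivation _).add hD, fun i => ?_, fun i => ?_, ?_⟩
  · rw [LinearMap.add_apply, hDφ, h1, innerDerivation_inv_mul _ (hcomm _)]
  · rw [LinearMap.add_apply, hDφ, h2, innerDerivation_inv_mul _ (hcomm _), add_zero]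
  · rw [LinearMap.add_apply, hDφ, h3, innerDerivation_inv_mul _ (hcomm _), add_zero]

theorem IsPainleveDerivation₁.unique {K : Type*} [DivisionRing K] [Algebra ℂ K]
    {ι : Alg₁ →ₐ[ℂ] K} (hι : IsQuotientSkewField ι) {D D' : K →ₗ[ℂ] K}
    (hD : IsPainleveDerivation₁ ι D) (hD' : IsPainleveDerivation₁ ι D') : D = D' := by
  refine hι.derivation_ext adjoin_range_gen₁ hD.leibniz hD'.leibniz ?_
  rintro _ ⟨(i | i | _), rfl⟩
  · exact (hD.map_f i).trans (hD'.map_f i).symm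
  · exact (hD.map_α i).trans (hD'.map_α i).symm
  · exact hD.map_h.trans hD'.map_h.symm

/-- Lets each bracket with the Hamiltonian be computed inside the algebra, as a multiple of `h`,
before passing to the skew field. -/
theorem inv_mul_lie_eq {A K : Type*} [Ring A] [Algebra ℂ A] [DivisionRing K] [Algebra ℂ K]
    {ι : A →ₐ[ℂ] K} (hι : IsQuotientSkewField ι) {c : A} (hc : c ≠ 0) {a b y : A}
    (hab : ⁅a, b⁆ = c * y) : (ι c)⁻¹ * ⁅ι a, ι b⁆ = ι y := by
  have h1 : ⁅ι a, ι b⁆ = ι c * ι y := by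
    rw [← map_mul, ← hab, Ring.lie_def, Ring.lie_def, map_sub, map_mul, map_mul]
  rw [h1, inv_mul_cancel_left₀ (hι.map_ne_zero hc)]

theorem inv_mul_lie_eq_zero {A K : Type*} [Ring A] [Algebra ℂ A] [DivisionRing K] [Algebra ℂ K]
    (ι : A →ₐ[ℂ] K) {c z : A} (a : A) (hz : z ∈ Subalgebra.center ℂ A) :
    (ι c)⁻¹ * ⁅ι a, ι z⁆ = 0 := by
  rw [Ring.lie_def, ((commute_of_mem_center hz a).map ι).eq, sub_self, mul_zero]

theorem lie_quadratic {A : Type*} [Ring A] [Algebra ℂ A] {a b c z e : A}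
    (hba : b * a - a * b = 2 * z * c) (hac : a * c - c * a = z) (hcb : c * b - b * c = z)
    (hza : z * a = a * z) (hzb : z * b = b * z) (hzc : z * c = c * z)
    (hea : e * a = a * e) (heb : e * b = b * e) (hec : e * c = c * e) (hez : e * z = z * e) :
    ⁅(1 / 2 : ℂ) • (a * b + b * a) + e * c, a⁆ = z * (a * c + c * a - e) ∧
    ⁅(1 / 2 : ℂ) • (a * b + b * a) + e * c, b⁆ = z * (-(b * c) - c * b + e) ∧
    ⁅(1 / 2 : ℂ) • (a * b + b * a) + e * c, c⁆ = z * (b - a) := by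
  -- The relation `b a = a b + 2 z c` removes the symmetrization and the factor one half.
  have h1 : (1 / 2 : ℂ) • (a * b + b * a) = a * b + z * c := by
    have : a * b + b * a = (2 : ℂ) • (a * b + z * c) := by
      rw [two_smul]
      linear_combination (norm := noncomm_ring) hba
    rw [this, smul_smul]
    norm_num
  simp only [h1, Ring.lie_def]
  refine ⟨?_, ?_, ?_⟩
  · linear_combination (norm := noncomm_ring) a * hba - e * hac - hez - hza * c + hea * c
  · linear_combination (norm := noncomm_ring) -hba * b + e * hcb + hez + heb * c + hzb * c
  · linear_combination (norm := noncomm_ring) -a * hcb + hac * b + hza + hzc * c + hec * c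

theorem lie_hamiltonian₁ :
    ⁅hamiltonian₁, f₁ 0⁆ = h₁ * (f₁ 0 * f₁ 2 + f₁ 2 * f₁ 0 - α₁ 1) ∧
    ⁅hamiltonian₁, f₁ 1⁆ = h₁ * (-(f₁ 1 * f₁ 2) - f₁ 2 * f₁ 1 + α₁ 1) ∧
    ⁅hamiltonian₁, f₁ 2⁆ = h₁ * (f₁ 1 - f₁ 0) := by
  have hz := fun a => (commute_of_mem_center h₁_mem_center a).eq
  have he := fun a => (commute_of_mem_center (α₁_mem_center 1) a).eq
  exact lie_quadratic lie_f₁_one_zero lie_f₁_zero_two lie_f₁_two_one (hz _) (hz _) (hz _)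
    (he _) (he _) (he _) (he _)

theorem IsPainleveDerivation₁.equations {K : Type*} [DivisionRing K] [Algebra ℂ K]
    {ι : Alg₁ →ₐ[ℂ] K} (hι : IsQuotientSkewField ι) {D : K →ₗ[ℂ] K}
    (hD : IsPainleveDerivation₁ ι D) :
    D (ι (f₁ 0)) = ι (f₁ 0) * ι (f₁ 2) + ι (f₁ 2) * ι (f₁ 0) + ι (α₁ 0) ∧
    D (ι (f₁ 1)) = -(ι (f₁ 1) * ι (f₁ 2)) - ι (f₁ 2) * ι (f₁ 1) + ι (α₁ 1) ∧
    D (ι (f₁ 2)) = ι (f₁ 1) - ι (f₁ 0) ∧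
    (∀ i, D (ι (α₁ i)) = 0) ∧ D (ι h₁) = 0 := by
  obtain ⟨h0, h1, h2⟩ := lie_hamiltonian₁
  refine ⟨?_, ?_, ?_, fun i => ?_, ?_⟩
  -- Here `-α₁` from the bracket and `k = α₀ + α₁` leave `α₀`.
  · rw [hD.map_f, inv_mul_lie_eq hι h₁_ne_zero h0, if_pos rfl, k₁]
    simp only [map_add, map_sub, map_mul]
    abel
  · rw [hD.map_f, inv_mul_lie_eq hι h₁_ne_zero h1, if_neg (by decide), add_zero]
    simp
  · rw [hD.map_f, inv_mul_lie_eq hι h₁_ne_zero h2, if_neg (by decide), add_zero]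
    simp
  · rw [hD.map_α, inv_mul_lie_eq_zero ι _ (α₁_mem_center i)]
  · rw [hD.map_h, inv_mul_lie_eq_zero ι _ h₁_mem_center]

end One

end QPainleve

namespace QPainleve

/-! ## Runs of subsets of `ZMod (l + 1)` and the products `fSet` -/

section Runs

variable {l : ℕ} {C K : Finset (ZMod (l + 1))}

/-- A shortcut instance; the ones below make negation and subtraction in `Alg l` syntactically those
of this ring structure. -/
noncomputable scoped instance instRingAlg : Ring (Alg l) := inferInstance

noncomputable scoped instance instNegAlg : Neg (Alg l) := instRingAlg.toNeg

noncomputable scoped instance instSubAlg : Sub (Alg l) := instRingAlg.toSub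

theorem exists_natCast_add_eq (x y : ZMod (l + 1)) : ∃ t ≤ l, x + (t : ZMod (l + 1)) = y :=
  ⟨(y - x).val, Nat.lt_succ_iff.mp (ZMod.val_lt _), by rw [ZMod.natCast_zmod_val]; ring⟩

theorem add_natCast_inj (x : ZMod (l + 1)) {s t : ℕ} (hs : s ≤ l) (ht : t ≤ l) :
    x + (s : ZMod (l + 1)) = x + (t : ZMod (l + 1)) ↔ s = t := by
  rw [add_right_inj, ZMod.natCast_eq_natCast_iff']
  rw [Nat.mod_eq_of_lt (by omega), Nat.mod_eq_of_lt (by omega)]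

theorem natCast_self_eq_neg_one : ((l : ℕ) : ZMod (l + 1)) = -1 := by
  have := ZMod.natCast_self (l + 1)
  push_cast at this
  linear_combination this

theorem sum_range_natCast_add {M : Type*} [AddCommMonoid M] (b : ZMod (l + 1))
    (F : ZMod (l + 1) → M) :
    ∑ t ∈ Finset.range (l + 1), F (b + (t : ZMod (l + 1))) = ∑ j, F j := by
  refine Finset.sum_bij (fun t _ => b + (t : ZMod (l + 1))) (fun _ _ => Finset.mem_univ _)
    (fun s hs t ht hst => ?_) (fun j _ => ?_) (fun _ _ => rfl)
  · rw [Finset.mem_range] at hs ht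
    exact (add_natCast_inj b (by omega) (by omega)).mp hst
  · obtain ⟨t, ht, rfl⟩ := exists_natCast_add_eq b j
    exact ⟨t, Finset.mem_range.mpr (by omega), rfl⟩

/-- The largest `m ≤ l` such that `i, i + 1, …, i + m - 1` all belong to `C`. -/
def runLength (C : Finset (ZMod (l + 1))) (i : ZMod (l + 1)) : ℕ :=
  Nat.findGreatest (fun m => ∀ t < m, i + (t : ZMod (l + 1)) ∈ C) l

theorem compLength_eq (C : Finset (ZMod (l + 1))) (i : ZMod (l + 1)) :
    compLength C i = if i ∈ C ∧ i - 1 ∉ C then runLength C i else 0 := rfl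

theorem add_mem_of_lt_runLength (i : ZMod (l + 1)) {t : ℕ} (ht : t < runLength C i) :
    i + (t : ZMod (l + 1)) ∈ C :=
  Nat.findGreatest_spec (P := fun m => ∀ t < m, i + (t : ZMod (l + 1)) ∈ C) (Nat.zero_le l)
    (fun _ h => absurd h (Nat.not_lt_zero _)) t ht

theorem add_runLength_notMem (hC : C ≠ Finset.univ) (i : ZMod (l + 1)) :
    i + (runLength C i : ZMod (l + 1)) ∉ C := by
  intro hmem
  have hall : ∀ t < runLength C i + 1, i + (t : ZMod (l + 1)) ∈ C := by
    intro t ht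
    rcases Nat.lt_succ_iff_lt_or_eq.mp ht with h | rfl
    · exact add_mem_of_lt_runLength i h
    · exact hmem
  rcases Nat.lt_or_ge (runLength C i) l with hlt | hge
  · exact Nat.findGreatest_is_greatest (P := fun m => ∀ t < m, i + (t : ZMod (l + 1)) ∈ C)
      (Nat.lt_succ_self (runLength C i)) hlt hall
  -- The search is capped at `l`, so in this case the points `i, …, i + l` all lie in `C`, and they
  -- exhaust the cycle.
  · apply hC
    rw [Finset.eq_univ_iff_forall]
    intro y
    obtain ⟨t, ht, rfl⟩ := exists_natCast_add_eq i y
    exact hall t (by omega)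

theorem runLength_eq (hC : C ≠ Finset.univ) {i : ZMod (l + 1)} {m : ℕ}
    (h₁ : ∀ t < m, i + (t : ZMod (l + 1)) ∈ C) (h₂ : i + (m : ZMod (l + 1)) ∉ C) :
    runLength C i = m := by
  refine le_antisymm ?_ ?_
  · by_contra! hlt
    exact h₂ (add_mem_of_lt_runLength i hlt)
  · by_contra! hlt
    exact add_runLength_notMem hC i (h₁ _ hlt)

theorem runLength_of_notMem {i : ZMod (l + 1)} (hi : i ∉ C) : runLength C i = 0 := by
  by_contra h0
  have := add_mem_of_lt_runLength (C := C) i (Nat.pos_of_ne_zero h0)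
  simp [hi] at this

/-- This recursion, with value zero off `C`, is what later inductions along a run use in place of
the definition by search. -/
theorem runLength_of_mem (hC : C ≠ Finset.univ) {i : ZMod (l + 1)} (hi : i ∈ C) :
    runLength C i = runLength C (i + 1) + 1 := by
  refine runLength_eq hC (fun t ht => ?_) ?_
  · cases t with
    | zero => simpa using hi
    | succ t =>
      have := add_mem_of_lt_runLength (C := C) (i + 1) (t := t) (by omega)
      push_cast
      rwa [add_comm (t : ZMod (l + 1)), ← add_assoc]
  · have := add_runLength_notMem hC (i + 1)
    push_cast
    rwa [add_comm (runLength C (i + 1) : ZMod (l + 1)), ← add_assoc]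

theorem compLength_succ_of_notMem {i : ZMod (l + 1)} (hi : i ∉ C) :
    compLength C (i + 1) = runLength C (i + 1) := by
  rw [compLength_eq, add_sub_cancel_right]
  split_ifs with h
  · rfl
  · rw [runLength_of_notMem fun h' => h ⟨h', hi⟩]

theorem compLength_succ_of_mem {i : ZMod (l + 1)} (hi : i ∈ C) : compLength C (i + 1) = 0 := by
  rw [compLength_eq, add_sub_cancel_right, if_neg fun h => h.2 hi]

theorem list_range_succ_map_prod {M : Type*} [Monoid M] (F : ZMod (l + 1) → M) (i : ZMod (l + 1))
    (n : ℕ) : ((List.range (n + 1)).map fun t : ℕ => F (i + (t : ZMod (l + 1)))).prod =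
      F i * ((List.range n).map fun t : ℕ => F (i + 1 + (t : ZMod (l + 1)))).prod := by
  rw [List.range_succ_eq_map, List.map_cons, List.prod_cons, List.map_map, Nat.cast_zero, add_zero]
  congr 3
  funext t
  simp only [Function.comp_apply, Nat.cast_succ]
  congr 1
  ring

theorem list_range_succ_map_prod' {M : Type*} [Monoid M] (F : ZMod (l + 1) → M) (i : ZMod (l + 1))
    (n : ℕ) : ((List.range (n + 1)).map fun t : ℕ => F (i + (t : ZMod (l + 1)))).prod =
      ((List.range n).map fun t : ℕ => F (i + (t : ZMod (l + 1)))).prod * F (i + (n : ZMod (l + 1))) := by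
  rw [List.range_succ, List.map_append, List.prod_append, List.map_singleton, List.prod_singleton]

theorem fSegment_eq (i : ZMod (l + 1)) (m : ℕ) :
    fSegment i m = ((List.range m).map fun t : ℕ => f (i + (t : ZMod (l + 1)))).prod := by
  simp [fSegment, ← List.map_eq_flatMap, Function.comp_def]

theorem fSet_eq (K : Finset (ZMod (l + 1))) :
    fSet K = ((List.range (l + 1)).map fun t : ℕ =>
      fSegment (t : ZMod (l + 1)) (compLength K (t : ZMod (l + 1)))).prod := by
  simp [fSet, ← List.map_eq_flatMap, Function.comp_def]

theorem fSegment_succ (i : ZMod (l + 1)) (m : ℕ) :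
    fSegment i (m + 1) = f i * fSegment (i + 1) m := by
  rw [fSegment_eq, fSegment_eq]; exact list_range_succ_map_prod f i m

theorem fSegment_zero (i : ZMod (l + 1)) : fSegment i 0 = 1 := rfl

/-! ### The product `f_K` read in cyclic order -/

/-- The factor of `fSet K` at position `j`. -/
noncomputable def fAt (K : Finset (ZMod (l + 1))) (j : ZMod (l + 1)) : Alg l :=
  if j ∈ K then f j else 1

/-- The product of the factors of `fSet K` at the positions `b, b + 1, …, b + n - 1`. -/
noncomputable def fArc (K : Finset (ZMod (l + 1))) (b : ZMod (l + 1)) (n : ℕ) : Alg l :=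
  ((List.range n).map fun t : ℕ => fAt K (b + (t : ZMod (l + 1)))).prod

theorem fArc_succ (K : Finset (ZMod (l + 1))) (b : ZMod (l + 1)) (n : ℕ) :
    fArc K b (n + 1) = fAt K b * fArc K (b + 1) n :=
  list_range_succ_map_prod (fAt K) b n

theorem fArc_succ' (K : Finset (ZMod (l + 1))) (b : ZMod (l + 1)) (n : ℕ) :
    fArc K b (n + 1) = fArc K b n * fAt K (b + (n : ZMod (l + 1))) :=
  list_range_succ_map_prod' (fAt K) b n

/-- The product of the components of `K` that start at `b, b + 1, …, b + n - 1`. -/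
noncomputable def compArc (K : Finset (ZMod (l + 1))) (b : ZMod (l + 1)) (n : ℕ) : Alg l :=
  ((List.range n).map fun t : ℕ =>
    fSegment (b + (t : ZMod (l + 1))) (compLength K (b + (t : ZMod (l + 1))))).prod

theorem compArc_succ (K : Finset (ZMod (l + 1))) (b : ZMod (l + 1)) (n : ℕ) :
    compArc K b (n + 1) = fSegment b (compLength K b) * compArc K (b + 1) n :=
  list_range_succ_map_prod (fun j => fSegment j (compLength K j)) b n

theorem compArc_succ' (K : Finset (ZMod (l + 1))) (b : ZMod (l + 1)) (n : ℕ) :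
    compArc K b (n + 1) = compArc K b n *
      fSegment (b + (n : ZMod (l + 1))) (compLength K (b + (n : ZMod (l + 1)))) :=
  list_range_succ_map_prod' (fun j => fSegment j (compLength K j)) b n

/-- Reading from the left, a point of `K` prolongs the current run, and a point outside `K` makes
the next run a full component. The gap at the right end ensures that no component is cut off. -/
theorem fArc_eq_fSegment_mul_compArc (hK : K ≠ Finset.univ) (n : ℕ) :
    ∀ i : ZMod (l + 1), i + (n : ZMod (l + 1)) ∉ K →
      fArc K i (n + 1) = fSegment i (runLength K i) * compArc K (i + 1) n := by
  induction n with
  | zero =>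
    intro i hi
    rw [Nat.cast_zero, add_zero] at hi
    rw [runLength_of_notMem hi, fSegment_zero]
    simp [fArc, compArc, fAt, hi]
  | succ n ih =>
    intro i hi
    have hi' : i + 1 + (n : ZMod (l + 1)) ∉ K := by
      push_cast at hi
      rwa [add_assoc, add_comm 1]
    rw [fArc_succ, ih (i + 1) hi', compArc_succ]
    by_cases h : i ∈ K
    · rw [runLength_of_mem hK h, fSegment_succ, compLength_succ_of_mem h, fSegment_zero, one_mul,
        fAt, if_pos h, mul_assoc]
    · rw [runLength_of_notMem h, fSegment_zero, one_mul, compLength_succ_of_notMem h,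
        fAt, if_neg h, one_mul]

/-- A component is preceded by a gap, so the start of one component cannot lie strictly inside
another. -/
theorem eq_of_add_eq_add_of_lt_compLength {i j : ZMod (l + 1)} {s t : ℕ} (hs : s < compLength K i)
    (ht : t < compLength K j) (hst : i + (s : ZMod (l + 1)) = j + (t : ZMod (l + 1))) : i = j := by
  wlog hle : s ≤ t generalizing i j s t
  · exact (this ht hs hst.symm (by omega)).symm
  obtain ⟨d, rfl⟩ := Nat.exists_eq_add_of_le hle
  rw [compLength_eq] at hs ht
  split_ifs at hs ht with hi hj
  · have h1 : i = j + (d : ZMod (l + 1)) := by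
      push_cast at hst
      linear_combination hst
    cases d with
    | zero => simpa using h1
    | succ d =>
      exfalso
      apply hi.2
      have := add_mem_of_lt_runLength (C := K) j (t := d) (by omega)
      rw [h1]
      push_cast
      rwa [← add_assoc, add_sub_cancel_right]
  all_goals omega

/-- Distinct components are not even adjacent, so their factors commute. -/
theorem add_ne_succ_of_lt_compLength {i j : ZMod (l + 1)} (hij : i ≠ j) {s t : ℕ}
    (hs : s < compLength K i) (ht : t < compLength K j) :
    j + (t : ZMod (l + 1)) ≠ i + (s : ZMod (l + 1)) + 1 := by
  intro h
  cases t with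
  | zero =>
    have h1 : j - 1 ∉ K := by
      rw [compLength_eq] at ht
      split_ifs at ht with hj
      exacts [hj.2, absurd ht (Nat.not_lt_zero _)]
    rw [compLength_eq] at hs
    split_ifs at hs with hi
    · apply h1
      rw [Nat.cast_zero, add_zero] at h
      rw [h, add_sub_cancel_right]
      exact add_mem_of_lt_runLength i hs
    · omega
  | succ t =>
    refine hij (eq_of_add_eq_add_of_lt_compLength hs (t := t) (by omega) ?_)
    push_cast at h
    linear_combination -h

theorem commute_fSegment {i j : ZMod (l + 1)} :
    Commute (fSegment i (compLength K i)) (fSegment j (compLength K j)) := by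
  by_cases hij : i = j
  · rw [hij]
  rw [fSegment_eq, fSegment_eq]
  refine Commute.list_prod_left _ _ fun a ha => Commute.list_prod_right _ _ fun b hb => ?_
  obtain ⟨s, hs, rfl⟩ := List.mem_map.mp ha
  obtain ⟨t, ht, rfl⟩ := List.mem_map.mp hb
  rw [List.mem_range] at hs ht
  refine commute_f_of_ne (add_ne_succ_of_lt_compLength hij hs ht) ?_
  have := add_ne_succ_of_lt_compLength (Ne.symm hij) ht hs
  intro h
  exact this (by rw [h, sub_add_cancel])

theorem compArc_rotate (b : ZMod (l + 1)) :
    compArc K b (l + 1) = compArc K (b + 1) (l + 1) := by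
  rw [compArc_succ, compArc_succ', natCast_self_eq_neg_one, add_neg_cancel_right]
  refine (Commute.list_prod_right _ _ fun a ha => ?_).eq
  obtain ⟨t, -, rfl⟩ := List.mem_map.mp ha
  exact commute_fSegment

theorem fSet_eq_compArc (b : ZMod (l + 1)) : fSet K = compArc K b (l + 1) := by
  have h : ∀ t : ℕ, fSet K = compArc K (t : ZMod (l + 1)) (l + 1) := by
    intro t
    induction t with
    | zero => simp [fSet_eq, compArc]
    | succ t ih => rw [ih, compArc_rotate, Nat.cast_succ]
  rw [h b.val, ZMod.natCast_zmod_val]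

/-- `fSet K` is the product of its factors in cyclic order, starting after any gap. -/
theorem fSet_eq_fArc {b : ZMod (l + 1)} (hb : b - 1 ∉ K) : fSet K = fArc K b (l + 1) := by
  have hK : K ≠ Finset.univ := fun h => hb (h ▸ Finset.mem_univ _)
  have hl : b + (l : ZMod (l + 1)) = b - 1 := by rw [natCast_self_eq_neg_one, sub_eq_add_neg]
  rw [fArc_eq_fSegment_mul_compArc hK l b (by rwa [hl]), fSet_eq_compArc b, compArc_succ]
  have := compLength_succ_of_notMem hb
  rw [sub_add_cancel] at this
  rw [this]

theorem fSet_empty : fSet (∅ : Finset (ZMod (l + 1))) = 1 := by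
  rw [fSet_eq_fArc (b := 0) (Finset.notMem_empty _)]
  refine List.prod_eq_one fun a ha => ?_
  obtain ⟨t, -, rfl⟩ := List.mem_map.mp ha
  simp [fAt]

theorem fArc_congr {K' : Finset (ZMod (l + 1))} {b : ZMod (l + 1)} {n : ℕ}
    (h : ∀ t < n, (b + (t : ZMod (l + 1)) ∈ K ↔ b + (t : ZMod (l + 1)) ∈ K')) :
    fArc K b n = fArc K' b n := by
  unfold fArc
  congr 1
  refine List.map_congr_left fun t ht => ?_
  simp only [fAt, h t (List.mem_range.mp ht)]

/-- The gap before `x` allows the cyclic reading to start at `x`, so its factor comes first even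
when `x + 1 ∈ K`. -/
theorem fSet_insert_left {x : ZMod (l + 1)} (hl : 1 ≤ l) (hx : x ∉ K) (hx' : x - 1 ∉ K) :
    fSet (insert x K) = f x * fSet K := by
  have hne : x - 1 ∉ insert x K := by
    rw [Finset.mem_insert, not_or]
    refine ⟨fun h => ?_, hx'⟩
    have h2 := (add_natCast_inj x (s := l) (t := 0) le_rfl (Nat.zero_le _)).mp
    rw [natCast_self_eq_neg_one, ← sub_eq_add_neg, Nat.cast_zero, add_zero] at h2
    have := h2 h
    omega
  rw [fSet_eq_fArc hne, fSet_eq_fArc hx', fArc_succ, fArc_succ, fAt, fAt, if_neg hx,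
    if_pos (Finset.mem_insert_self _ _), one_mul]
  congr 1
  refine fArc_congr fun t ht => ?_
  rw [Finset.mem_insert, or_iff_right]
  intro h
  have h2 := (add_natCast_inj x (s := t + 1) (t := 0) (by omega) (Nat.zero_le _)).mp
    (by push_cast; linear_combination h)
  omega

/-- Mirror image: the reading starts at `x + 2`, so its last two positions are `x` and the gap `x +
1`. -/
theorem fSet_insert_right {x : ZMod (l + 1)} (hl : 1 ≤ l) (hx : x ∉ K) (hx' : x + 1 ∉ K) :
    fSet (insert x K) = fSet K * f x := by
  have hlast : x + 1 + 1 + ((l : ℕ) : ZMod (l + 1)) = x + 1 := by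
    rw [natCast_self_eq_neg_one]; ring
  have h1 : x + 1 ≠ x := by
    intro h
    have := (add_natCast_inj x (s := 1) (t := 0) hl (Nat.zero_le _)).mp (by simpa using h)
    omega
  rw [fSet_eq_fArc (b := x + 1 + 1) (by simp [h1, hx']),
    fSet_eq_fArc (K := K) (b := x + 1 + 1) (by simp [hx']), fArc_succ', fArc_succ', hlast, fAt, fAt,
    if_neg hx', if_neg (by simp [h1, hx']), mul_one, mul_one]
  obtain ⟨n, rfl⟩ : ∃ n, l = n + 1 := ⟨l - 1, by omega⟩
  have hlast' : x + 1 + 1 + ((n : ℕ) : ZMod (n + 1 + 1)) = x := by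
    have := natCast_self_eq_neg_one (l := n + 1)
    push_cast at this
    linear_combination this
  rw [fArc_succ', fArc_succ', hlast', fAt, fAt, if_neg hx, if_pos (Finset.mem_insert_self _ _),
    mul_one]
  congr 1
  refine fArc_congr fun t ht => ?_
  rw [Finset.mem_insert, or_iff_right]
  intro h
  have h2 := (add_natCast_inj (x + 1 + 1) (s := t) (t := n) (by omega) (by omega)).mp
    (by rw [h, hlast'])
  omega

theorem fSet_singleton (hl : 1 ≤ l) (x : ZMod (l + 1)) : fSet {x} = f x := by
  rw [← insert_empty_eq, fSet_insert_left hl (Finset.notMem_empty _) (Finset.notMem_empty _),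
    fSet_empty, mul_one]

/-! ### Commutators of `f_K` with a generator -/

theorem lie_mul_right_eq {A : Type*} [Ring A] (a b c : A) : ⁅a * b, c⁆ = a * ⁅b, c⁆ + ⁅a, c⁆ * b := by
  simp only [Ring.lie_def]
  noncomm_ring

theorem lie_f_f_mem_center (i j : ZMod (l + 1)) :
    (⁅f i, f j⁆ : Alg l) ∈ Subalgebra.center ℂ (Alg l) := by
  by_cases h1 : j = i + 1
  · rw [h1, lie_f_succ]; exact h_mem_center
  by_cases h2 : j = i - 1
  · rw [h2, lie_f_pred]; exact neg_mem h_mem_center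
  rw [lie_f_of_ne h1 h2]; exact zero_mem _

/-- The Leibniz rule for an ordered product; each bracket `[f_j, f_i]` is central and moves to the
front, leaving the product without position `j`. The bound on `n` ensures that no position is
visited twice. -/
theorem lie_fArc (K : Finset (ZMod (l + 1))) (b i : ZMod (l + 1)) {n : ℕ} (hn : n ≤ l + 1) :
    ⁅fArc K b n, f i⁆ = ∑ t ∈ Finset.range n, if b + (t : ZMod (l + 1)) ∈ K then
      ⁅f (b + (t : ZMod (l + 1))), f i⁆ * fArc (K.erase (b + (t : ZMod (l + 1)))) b n else 0 := by
  induction n with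
  | zero => simp [fArc, Ring.lie_def]
  | succ n ih =>
    rw [fArc_succ', lie_mul_right_eq, ih (by omega), Finset.sum_range_succ, add_comm]
    congr 1
    · rw [Finset.sum_mul]
      refine Finset.sum_congr rfl fun t ht => ?_
      rw [Finset.mem_range] at ht
      split_ifs with h
      · rw [fArc_succ', ← mul_assoc, fAt, fAt]
        have hne : b + (n : ZMod (l + 1)) ≠ b + (t : ZMod (l + 1)) := by
          rw [ne_eq, add_natCast_inj b (by omega) (by omega)]
          omega
        simp only [Finset.mem_erase, ne_eq, hne, not_false_eq_true, true_and]
      · rw [zero_mul]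
    · by_cases h : b + (n : ZMod (l + 1)) ∈ K
      · rw [fAt, if_pos h, if_pos h, fArc_succ', fAt, if_neg (Finset.notMem_erase _ _), mul_one,
          (commute_of_mem_center (lie_f_f_mem_center _ _) _).eq]
        congr 1
        refine fArc_congr fun t ht => ?_
        have hne : b + (t : ZMod (l + 1)) ≠ b + (n : ZMod (l + 1)) := by
          rw [ne_eq, add_natCast_inj b (by omega) (by omega)]
          omega
        simp [hne]
      · rw [fAt, if_neg h, if_neg h, Ring.lie_def, one_mul, mul_one, sub_self, mul_zero]

theorem sub_one_ne_add_one (hl : 2 ≤ l) (i : ZMod (l + 1)) : i - 1 ≠ i + 1 := by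
  intro h
  have := (add_natCast_inj i (s := l) (t := 1) le_rfl (by omega)).mp
    (by rw [natCast_self_eq_neg_one, ← sub_eq_add_neg, h, Nat.cast_one])
  omega

/-- Only the neighbours of `i` fail to commute with `f_i`. Reading from a gap of `K` works for all
terms at once, since it remains a gap after any deletion. -/
theorem lie_fSet (hl : 2 ≤ l) (hK : K ≠ Finset.univ) (i : ZMod (l + 1)) :
    ⁅fSet K, f i⁆ = h * ((if i - 1 ∈ K then fSet (K.erase (i - 1)) else 0)
      - if i + 1 ∈ K then fSet (K.erase (i + 1)) else 0) := by
  obtain ⟨c, hc⟩ : ∃ c, c ∉ K := by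
    by_contra! hall
    exact hK (Finset.eq_univ_iff_forall.mpr hall)
  have hb : c + 1 - 1 ∉ K := by rwa [add_sub_cancel_right]
  rw [fSet_eq_fArc hb, lie_fArc K (c + 1) i le_rfl,
    sum_range_natCast_add (c + 1) fun j =>
      if j ∈ K then ⁅f j, f i⁆ * fArc (K.erase j) (c + 1) (l + 1) else 0]
  have hfs : ∀ j, fArc (K.erase j) (c + 1) (l + 1) = fSet (K.erase j) := fun j =>
    (fSet_eq_fArc fun hmem => hb (Finset.mem_of_mem_erase hmem)).symm
  simp only [hfs]
  have hne := sub_one_ne_add_one hl i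
  rw [Finset.sum_eq_add (i - 1) (i + 1) hne]
  · have h1 : ⁅f (i - 1), f i⁆ = (h : Alg l) := by
      have := lie_f_succ (i - 1)
      rwa [sub_add_cancel] at this
    have h2 : ⁅f (i + 1), f i⁆ = (-h : Alg l) := by
      have := lie_f_pred (i + 1)
      rwa [add_sub_cancel_right] at this
    rw [h1, h2, mul_sub]
    split_ifs <;> simp [← sub_eq_add_neg]
  · rintro j - ⟨hj1, hj2⟩
    have : ⁅f j, f i⁆ = (0 : Alg l) := by
      refine lie_f_of_ne (fun h => hj1 ?_) (fun h => hj2 ?_)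
      · rw [h, add_sub_cancel_right]
      · rw [h, sub_add_cancel]
    rw [this, zero_mul, ite_self]
  · exact fun h => absurd (Finset.mem_univ _) h
  · exact fun h => absurd (Finset.mem_univ _) h

end Runs

/-! ## Domino tilings of complements -/

section Tilings

variable {l : ℕ} {C K T : Finset (ZMod (l + 1))}

/-- The dominoes `{x, x + 1}`, `x ∈ T`, partition `C`. -/
def IsTiling (T C : Finset (ZMod (l + 1))) : Prop :=
  ∀ x, (x ∈ C ↔ x ∈ T ∨ x - 1 ∈ T) ∧ ¬(x ∈ T ∧ x - 1 ∈ T)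

/-- A tiling of a proper subset is unique: going backwards from the end of a run, domino starts are
exactly the points from which an even number of points of the run remain. -/
theorem IsTiling.mem_iff (hT : IsTiling T C) (hC : C ≠ Finset.univ) (x : ZMod (l + 1)) :
    x ∈ T ↔ x ∈ C ∧ Even (runLength C x) := by
  suffices ∀ m, ∀ x, runLength C x = m → (x ∈ T ↔ x ∈ C ∧ Even (runLength C x)) from
    this _ x rfl
  intro m
  induction m with
  | zero =>
    intro x hx
    have hxC : x ∉ C := fun h => by rw [runLength_of_mem hC h] at hx; omega
    exact ⟨fun h => absurd ((hT x).1.mpr (Or.inl h)) hxC, fun h => absurd h.1 hxC⟩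
  | succ m ih =>
    intro x hx
    have hxC : x ∈ C := by
      by_contra h
      rw [runLength_of_notMem h] at hx
      omega
    rw [runLength_of_mem hC hxC] at hx ⊢
    have h1 := ih (x + 1) (by omega)
    have h2 := hT (x + 1)
    rw [add_sub_cancel_right] at h2
    rw [Nat.even_add_one]
    by_cases hx1 : x + 1 ∈ C
    · tauto
    · rw [runLength_of_notMem hx1]
      have h3 := (hT x).1
      simp only [Even.zero, not_true_eq_false, and_false, iff_false]
      tauto

theorem IsTiling.even_compLength (hT : IsTiling T C) (hC : C ≠ Finset.univ) (i : ZMod (l + 1)) :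
    Even (compLength C i) := by
  rw [compLength_eq]
  split_ifs with h
  · have h1 := hT i
    have h2 := hT (i - 1)
    exact ((hT.mem_iff hC i).mp (by tauto)).2
  · exact Even.zero

/-- The parity rule that characterizes domino starts also defines a tiling, because every component
has even length. -/
theorem exists_isTiling (hC : C ≠ Finset.univ) (h : ∀ i, Even (compLength C i)) :
    ∃ T, IsTiling T C := by
  refine ⟨{x ∈ C | Even (runLength C x)}, fun x => ?_⟩
  simp only [Finset.mem_filter]
  have h1 : x - 1 ∈ C → runLength C (x - 1) = runLength C x + 1 := by
    intro hx
    have := runLength_of_mem hC hx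
    rwa [sub_add_cancel] at this
  have h2 := h x
  rw [compLength_eq] at h2
  have h3 : x ∉ C → runLength C x = 0 := runLength_of_notMem
  by_cases hx : x ∈ C <;> by_cases hx1 : x - 1 ∈ C
  · simp only [hx, hx1, h1, true_and, Nat.even_add_one]
    tauto
  · simp only [hx, hx1, not_false_eq_true, and_self, if_true] at h2
    simp [hx, hx1, h2]
  · simp [hx, hx1, h1 hx1, h3 hx]
  · simp [hx, hx1]

theorem compl_ne_univ_of_mem {x : ZMod (l + 1)} (hx : x ∈ K) : Kᶜ ≠ Finset.univ := by
  intro h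
  have := h ▸ Finset.mem_univ x
  exact Finset.mem_compl.mp this hx

/-- Replaces a condition on components by the existence of a tiling, which is easy to follow under
local moves. A point of `K` guarantees that the complement is proper. -/
theorem mem_S_iff {d : ℕ} {x : ZMod (l + 1)} (hx : x ∈ K) :
    K ∈ S l d ↔ K.card = d ∧ ∃ T, IsTiling T Kᶜ := by
  have hC := compl_ne_univ_of_mem hx
  simp only [S, Finset.mem_filter, Finset.mem_powersetCard, Finset.subset_univ, true_and]
  exact and_congr_right fun _ => ⟨exists_isTiling hC, fun ⟨T, hT⟩ => hT.even_compLength hC⟩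

/-- The alternating sum of fundamental weights along the run of `C` starting at `x`. -/
noncomputable def runWeight (C : Finset (ZMod (l + 1))) (x : ZMod (l + 1)) : Alg l :=
  ∑ t ∈ Finset.range (runLength C x), (-1) ^ t * fundWeight (x + (t : ZMod (l + 1)))

theorem runWeight_of_notMem {x : ZMod (l + 1)} (hx : x ∉ C) : runWeight C x = 0 := by
  rw [runWeight, runLength_of_notMem hx, Finset.range_zero, Finset.sum_empty]

theorem runWeight_of_mem (hC : C ≠ Finset.univ) {x : ZMod (l + 1)} (hx : x ∈ C) :
    runWeight C x = fundWeight x - runWeight C (x + 1) := by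
  rw [runWeight, runLength_of_mem hC hx, Finset.sum_range_succ', runWeight, sub_eq_neg_add,
    ← Finset.sum_neg_distrib]
  congr 1
  · refine Finset.sum_congr rfl fun t _ => ?_
    rw [pow_succ, mul_neg_one, neg_mul, Nat.cast_succ, add_comm (t : ZMod (l + 1)), ← add_assoc]
  · simp

theorem chi_eq_sum_runWeight (C : Finset (ZMod (l + 1))) :
    chi C = ∑ x, if x ∈ C ∧ x - 1 ∉ C then runWeight C x else 0 := by
  refine Finset.sum_congr rfl fun x _ => ?_
  rw [compLength_eq]
  split_ifs
  · rfl
  · simp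

/-- A domino at `x` contributes the run weight at `x` minus the one at `x + 2`, and this telescopes
along each component to the weight at its start. -/
theorem IsTiling.chi_eq (hT : IsTiling T C) (hC : C ≠ Finset.univ) :
    chi C = ∑ x ∈ T, (fundWeight x - fundWeight (x + 1)) := by
  have h1 : ∀ x ∈ T, fundWeight x - fundWeight (x + 1) =
      runWeight C x - runWeight C (x + 2) := by
    intro x hx
    have hx1 : x ∈ C := (hT x).1.mpr (Or.inl hx)
    have hx2 : x + 1 ∈ C := (hT (x + 1)).1.mpr (Or.inr (by rwa [add_sub_cancel_right]))
    rw [runWeight_of_mem hC hx1, runWeight_of_mem hC hx2, add_assoc, one_add_one_eq_two]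
    abel
  have h2 : ∑ x ∈ T, runWeight C (x + 2) = ∑ x, if x - 2 ∈ T then runWeight C x else 0 := by
    rw [← Equiv.sum_comp (Equiv.addRight (2 : ZMod (l + 1)))]
    simp [Finset.sum_ite_mem]
  have h3 : ∑ x ∈ T, runWeight C x = ∑ x, if x ∈ T then runWeight C x else 0 := by
    simp [Finset.sum_ite_mem]
  rw [Finset.sum_congr rfl h1, Finset.sum_sub_distrib, h2, h3, chi_eq_sum_runWeight,
    ← Finset.sum_sub_distrib]
  -- For a point of `C`, the indicators of `x ∈ T` and `x - 2 ∈ T` agree unless `x` starts a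
  -- component, in which case only the first holds.
  refine Finset.sum_congr rfl fun x _ => ?_
  by_cases hx : x ∈ C
  · have e0 := hT x
    have e1 := hT (x - 1)
    rw [sub_sub, one_add_one_eq_two] at e1
    by_cases hx1 : x - 1 ∈ C
    · by_cases hx2 : x ∈ T
      · have : x - 2 ∈ T := by tauto
        simp [hx1, hx2, this]
      · have : x - 2 ∉ T := by tauto
        simp [hx1, hx2, this]
    · have h3 : x - 2 ∉ T := by tauto
      have h4 : x ∈ T := by tauto
      simp [hx, hx1, h3, h4]
  · simp [runWeight_of_notMem hx]

/-! ### Sliding a domino across a point of `K` -/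

/-- Moving a point of `K` two steps forward. -/
def shift (i : ZMod (l + 1)) (K : Finset (ZMod (l + 1))) : Finset (ZMod (l + 1)) :=
  insert (i + 1) (K.erase (i - 1))

/-- Moving a point of `K` two steps backward. -/
def shiftBack (i : ZMod (l + 1)) (K : Finset (ZMod (l + 1))) : Finset (ZMod (l + 1)) :=
  insert (i - 1) (K.erase (i + 1))

theorem add_one_ne_self (hl : 1 ≤ l) (i : ZMod (l + 1)) : i + 1 ≠ i := by
  intro h
  have := (add_natCast_inj i (s := 1) (t := 0) hl (Nat.zero_le _)).mp (by simpa using h)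
  omega

theorem sub_one_ne_self (hl : 1 ≤ l) (i : ZMod (l + 1)) : i - 1 ≠ i := by
  intro h
  exact add_one_ne_self hl (i - 1) (by rw [sub_add_cancel]; exact h.symm)

/-- The uncovered neighbour on the left forces `i` to be the first cell of its domino, so `i + 1` is
its second cell. -/
theorem IsTiling.mem_of_sub_one_mem {i : ZMod (l + 1)} (hT : IsTiling T Kᶜ) (h : i - 1 ∈ K)
    (hi : i ∉ K) : i ∈ T ∧ i + 1 ∉ K := by
  have h1 := hT i
  have h2 := hT (i - 1)
  have h3 := hT (i + 1)
  rw [add_sub_cancel_right] at h3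
  simp only [Finset.mem_compl] at h1 h2 h3
  tauto

theorem IsTiling.mem_of_add_one_mem {i : ZMod (l + 1)} (hT : IsTiling T Kᶜ) (h : i + 1 ∈ K)
    (hi : i ∉ K) : i - 1 ∈ T ∧ i - 1 ∉ K := by
  have h1 := hT i
  have h2 := hT (i - 1)
  have h3 := hT (i + 1)
  rw [add_sub_cancel_right] at h3
  simp only [Finset.mem_compl] at h1 h2 h3
  tauto

/-- The domino starting at `i` slides to start at `i - 1`, vacating `i + 1` for the moved point of
`K`; all other dominoes stay. -/
theorem IsTiling.shift (hl : 2 ≤ l) {i : ZMod (l + 1)} (hT : IsTiling T Kᶜ) (h : i - 1 ∈ K)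
    (hi : i ∉ K) : IsTiling (insert (i - 1) (T.erase i)) (shift i K)ᶜ := by
  obtain ⟨hiT, hi1⟩ := hT.mem_of_sub_one_mem h hi
  have n1 := sub_one_ne_add_one hl i
  have n2 := add_one_ne_self (by omega) i
  have n3 := sub_one_ne_self (by omega) i
  have n4 := sub_one_ne_self (by omega) (i - 1)
  have h2 : i - 1 - 1 ∉ T := fun h' => Finset.mem_compl.mp ((hT (i - 1)).1.mpr (Or.inr h')) h
  have h3 : i + 1 ∉ T := by
    have := (hT (i + 1)).2
    rw [add_sub_cancel_right] at this
    exact fun h' => this ⟨h', hiT⟩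
  intro x
  have hx := hT x
  rw [Finset.mem_compl] at hx ⊢
  simp only [QPainleve.shift, Finset.mem_insert, Finset.mem_erase]
  by_cases hx1 : x = i
  · subst hx1
    simp [n3.symm, n2.symm, hi]
  by_cases hx2 : x = i - 1
  · subst hx2
    simp [n1, n4, h2]
  by_cases hx3 : x = i + 1
  · subst hx3
    simp [n1.symm, n3.symm, h3]
  have hx4 : x - 1 ≠ i := fun h' => hx3 (sub_eq_iff_eq_add.mp h')
  have hx5 : x - 1 ≠ i - 1 := fun h' => hx1 (sub_left_injective h')
  simpa only [hx1, hx2, hx3, hx4, hx5, false_or, ne_eq, not_false_eq_true, true_and] using hx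

theorem IsTiling.shiftBack (hl : 2 ≤ l) {i : ZMod (l + 1)} (hT : IsTiling T Kᶜ) (h : i + 1 ∈ K)
    (hi : i ∉ K) : IsTiling (insert i (T.erase (i - 1))) (shiftBack i K)ᶜ := by
  obtain ⟨hiT, hi1⟩ := hT.mem_of_add_one_mem h hi
  have n1 := sub_one_ne_add_one hl i
  have n2 := add_one_ne_self (by omega) i
  have n3 := sub_one_ne_self (by omega) i
  have n4 : i - 1 - 1 ≠ i := fun h' => n1 (sub_eq_iff_eq_add.mp h')
  have h2 : i - 1 - 1 ∉ T := fun h' => (hT (i - 1)).2 ⟨hiT, h'⟩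
  have h3 : i + 1 ∉ T := fun h' => Finset.mem_compl.mp ((hT (i + 1)).1.mpr (Or.inl h')) h
  intro x
  have hx := hT x
  rw [Finset.mem_compl] at hx ⊢
  simp only [QPainleve.shiftBack, Finset.mem_insert, Finset.mem_erase]
  by_cases hx1 : x = i
  · subst hx1
    simp [n3, n3.symm, hi]
  by_cases hx2 : x = i - 1
  · subst hx2
    simp [n3, n4, h2]
  by_cases hx3 : x = i + 1
  · subst hx3
    simp [n1.symm, n2, h3]
  have hx4 : x - 1 ≠ i := fun h' => hx3 (sub_eq_iff_eq_add.mp h')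
  have hx5 : x - 1 ≠ i - 1 := fun h' => hx1 (sub_left_injective h')
  simpa only [hx1, hx2, hx3, hx4, hx5, false_or, ne_eq, not_false_eq_true, true_and] using hx

theorem shift_erase {i : ZMod (l + 1)} (hi : i + 1 ∉ K) :
    (shift i K).erase (i + 1) = K.erase (i - 1) :=
  Finset.erase_insert fun h => hi (Finset.mem_of_mem_erase h)

theorem shiftBack_erase {i : ZMod (l + 1)} (hi : i - 1 ∉ K) :
    (shiftBack i K).erase (i - 1) = K.erase (i + 1) :=
  Finset.erase_insert fun h => hi (Finset.mem_of_mem_erase h)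

theorem shiftBack_shift {i : ZMod (l + 1)} (h : i - 1 ∈ K) (hi : i + 1 ∉ K) :
    shiftBack i (shift i K) = K := by
  rw [shiftBack, shift_erase hi, Finset.insert_erase h]

theorem shift_shiftBack {i : ZMod (l + 1)} (h : i + 1 ∈ K) (hi : i - 1 ∉ K) :
    shift i (shiftBack i K) = K := by
  rw [shift, shiftBack_erase hi, Finset.insert_erase h]

theorem card_shift {i : ZMod (l + 1)} (h : i - 1 ∈ K) (hi : i + 1 ∉ K) :
    (shift i K).card = K.card := by
  rw [shift, Finset.card_insert_of_notMem fun h => hi (Finset.mem_of_mem_erase h),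
    Finset.card_erase_add_one h]

theorem card_shiftBack {i : ZMod (l + 1)} (h : i + 1 ∈ K) (hi : i - 1 ∉ K) :
    (shiftBack i K).card = K.card := by
  rw [shiftBack, Finset.card_insert_of_notMem fun h => hi (Finset.mem_of_mem_erase h),
    Finset.card_erase_add_one h]

variable {d : ℕ}

theorem shift_mem_S (hl : 2 ≤ l) {i : ZMod (l + 1)} (hK : K ∈ S l d) (h : i - 1 ∈ K)
    (hi : i ∉ K) : i + 1 ∉ K ∧ shift i K ∈ S l d := by
  obtain ⟨hc, T, hT⟩ := (mem_S_iff h).mp hK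
  have h1 := (hT.mem_of_sub_one_mem h hi).2
  refine ⟨h1, (mem_S_iff (x := i + 1) (Finset.mem_insert_self _ _)).mpr
    ⟨(card_shift h h1).trans hc, _, hT.shift hl h hi⟩⟩

theorem shiftBack_mem_S (hl : 2 ≤ l) {i : ZMod (l + 1)} (hK : K ∈ S l d) (h : i + 1 ∈ K)
    (hi : i ∉ K) : i - 1 ∉ K ∧ shiftBack i K ∈ S l d := by
  obtain ⟨hc, T, hT⟩ := (mem_S_iff h).mp hK
  have h1 := (hT.mem_of_add_one_mem h hi).2
  refine ⟨h1, (mem_S_iff (x := i - 1) (Finset.mem_insert_self _ _)).mpr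
    ⟨(card_shiftBack h h1).trans hc, _, hT.shiftBack hl h hi⟩⟩

/-- Only one domino moves, so the difference is `(ϖ_i - ϖ_{i+1}) - (ϖ_{i-1} - ϖ_i)`. -/
theorem chi_sub_chi_shift (hl : 2 ≤ l) {i : ZMod (l + 1)} (hK : K ∈ S l d) (h : i - 1 ∈ K)
    (hi : i ∉ K) : chi Kᶜ - chi (shift i K)ᶜ =
      fundWeight i + fundWeight i - fundWeight (i - 1) - fundWeight (i + 1) := by
  obtain ⟨-, T, hT⟩ := (mem_S_iff h).mp hK
  obtain ⟨hiT, h1⟩ := hT.mem_of_sub_one_mem h hi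
  have h2 : i - 1 ∉ T.erase i := fun h' =>
    Finset.mem_compl.mp ((hT (i - 1)).1.mpr (Or.inl (Finset.mem_of_mem_erase h'))) h
  rw [hT.chi_eq (compl_ne_univ_of_mem h),
    (hT.shift hl h hi).chi_eq (compl_ne_univ_of_mem (x := i + 1) (Finset.mem_insert_self _ _)),
    Finset.sum_insert h2, ← Finset.add_sum_erase _ _ hiT, sub_add_cancel]
  abel

theorem sum_shift {M : Type*} [AddCommMonoid M] (hl : 2 ≤ l) (i : ZMod (l + 1))
    (F : Finset (ZMod (l + 1)) → M) :
    ∑ K ∈ S l d with i + 1 ∈ K ∧ i ∉ K, F K = ∑ K ∈ S l d with i - 1 ∈ K ∧ i ∉ K, F (shift i K) := by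
  have n2 := add_one_ne_self (by omega) i
  have n3 := sub_one_ne_self (by omega) i
  refine Finset.sum_bij' (fun K _ => shiftBack i K) (fun K _ => shift i K) ?_ ?_ ?_ ?_ ?_
  · intro K hK
    simp only [Finset.mem_filter] at hK ⊢
    refine ⟨(shiftBack_mem_S hl hK.1 hK.2.1 hK.2.2).2, Finset.mem_insert_self _ _, ?_⟩
    simp [shiftBack, n3.symm, hK.2.2]
  · intro K hK
    simp only [Finset.mem_filter] at hK ⊢
    refine ⟨(shift_mem_S hl hK.1 hK.2.1 hK.2.2).2, Finset.mem_insert_self _ _, ?_⟩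
    simp [shift, n2.symm, hK.2.2]
  · intro K hK
    simp only [Finset.mem_filter] at hK
    exact shift_shiftBack hK.2.1 (shiftBack_mem_S hl hK.1 hK.2.1 hK.2.2).1
  · intro K hK
    simp only [Finset.mem_filter] at hK
    exact shiftBack_shift hK.2.1 (shift_mem_S hl hK.1 hK.2.1 hK.2.2).1
  · intro K hK
    simp only [Finset.mem_filter] at hK
    rw [shift_shiftBack hK.2.1 (shiftBack_mem_S hl hK.1 hK.2.1 hK.2.2).1]

theorem ne_univ_of_mem_S (hd : d ≤ l) (hK : K ∈ S l d) : K ≠ Finset.univ := by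
  rintro rfl
  have h1 := (Finset.mem_powersetCard.mp (Finset.mem_filter.mp hK).1).2
  rw [Finset.card_univ, ZMod.card] at h1
  omega

/-- The commutator of a weighted sum of the `fSet K`, `K ∈ S l d`, with `f i`. The terms with
`i ∉ K` cancel in pairs, up to a change of weight. -/
theorem lie_sum_fSet (hl : 2 ≤ l) (hd : d ≤ l) (i : ZMod (l + 1))
    {W : Finset (ZMod (l + 1)) → Alg l} (hW : ∀ K, W K ∈ Subalgebra.center ℂ (Alg l)) :
    ⁅∑ K ∈ S l d, W K * fSet K, f i⁆ = h * (
      ∑ K ∈ S l d with i - 1 ∈ K ∧ i ∈ K, W K * fSet (K.erase (i - 1))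
      - ∑ K ∈ S l d with i ∈ K ∧ i + 1 ∈ K, W K * fSet (K.erase (i + 1))
      + ∑ K ∈ S l d with i - 1 ∈ K ∧ i ∉ K, (W K - W (shift i K)) * fSet (K.erase (i - 1))) := by
  have h1 : ⁅∑ K ∈ S l d, W K * fSet K, f i⁆ = ∑ K ∈ S l d, W K * ⁅fSet K, f i⁆ := by
    rw [Ring.lie_def, Finset.sum_mul, Finset.mul_sum, ← Finset.sum_sub_distrib]
    refine Finset.sum_congr rfl fun K _ => ?_
    rw [Ring.lie_def, mul_sub, ← mul_assoc (f i), ← (commute_of_mem_center (hW K) (f i)).eq]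
    simp only [mul_assoc]
  have h2 : ∀ K ∈ S l d, W K * ⁅fSet K, f i⁆ =
      h * ((if i - 1 ∈ K then W K * fSet (K.erase (i - 1)) else 0)
        - if i + 1 ∈ K then W K * fSet (K.erase (i + 1)) else 0) := by
    intro K hK
    rw [lie_fSet hl (ne_univ_of_mem_S hd hK), ← mul_assoc, (commute_of_mem_center (hW K) _).eq,
      mul_assoc, mul_sub, mul_ite, mul_ite, mul_zero]
  rw [h1, Finset.sum_congr rfl h2, ← Finset.mul_sum, Finset.sum_sub_distrib,
    ← Finset.sum_filter, ← Finset.sum_filter]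
  have hsplit : ∀ (p : Finset (ZMod (l + 1)) → Prop) [DecidablePred p]
      (F : Finset (ZMod (l + 1)) → Alg l), ∑ K ∈ S l d with p K, F K =
        ∑ K ∈ S l d with p K ∧ i ∈ K, F K + ∑ K ∈ S l d with p K ∧ i ∉ K, F K := by
    intro p _ F
    rw [← Finset.sum_filter_add_sum_filter_not _ (fun K => i ∈ K), Finset.filter_filter,
      Finset.filter_filter]
  rw [hsplit (fun K => i - 1 ∈ K), hsplit (fun K => i + 1 ∈ K), sum_shift hl i, add_sub_add_comm,
    ← Finset.sum_sub_distrib]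
  simp only [and_comm (a := i + 1 ∈ _)]
  congr 2
  -- Deleting `i - 1` from `K` and `i + 1` from its shift gives the same set, so only the weights
  -- differ.
  refine Finset.sum_congr rfl fun K hK => ?_
  simp only [Finset.mem_filter] at hK
  rw [shift_erase (shift_mem_S hl hK.1 hK.2.1 hK.2.2).1, sub_mul]

end Tilings

/-! ## Enumeration of the sets in `S l d` with two given neighbours -/

section Positions

variable {l : ℕ}

/-- The subset of `ZMod (l + 1)` at the positions `P` relative to `y`. -/
def posSet (y : ZMod (l + 1)) (P : Finset ℕ) : Finset (ZMod (l + 1)) :=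
  P.image fun p : ℕ => y + (p : ZMod (l + 1))

theorem mem_posSet (y : ZMod (l + 1)) {P : Finset ℕ} (hP : ∀ q ∈ P, q ≤ l) {p : ℕ} (hp : p ≤ l) :
    y + (p : ZMod (l + 1)) ∈ posSet y P ↔ p ∈ P := by
  rw [posSet, Finset.mem_image]
  constructor
  · rintro ⟨q, hq, h⟩
    rwa [← (add_natCast_inj y (hP q hq) hp).mp h]
  · exact fun h => ⟨p, h, rfl⟩

theorem posSet_injOn (y : ZMod (l + 1)) {P Q : Finset ℕ} (hP : ∀ q ∈ P, q ≤ l)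
    (hQ : ∀ q ∈ Q, q ≤ l) (h : posSet y P = posSet y Q) : P = Q := by
  ext p
  by_cases hp : p ≤ l
  · rw [← mem_posSet y hP hp, h, mem_posSet y hQ hp]
  · exact ⟨fun h' => absurd (hP p h') hp, fun h' => absurd (hQ p h') hp⟩

theorem card_posSet (y : ZMod (l + 1)) {P : Finset ℕ} (hP : ∀ q ∈ P, q ≤ l) :
    (posSet y P).card = P.card :=
  Finset.card_image_of_injOn fun _ hp _ hq h => (add_natCast_inj y (hP _ hp) (hP _ hq)).mp h

theorem sum_posSet {M : Type*} [AddCommMonoid M] (y : ZMod (l + 1)) {P : Finset ℕ}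
    (hP : ∀ q ∈ P, q ≤ l) (F : ZMod (l + 1) → M) :
    ∑ x ∈ posSet y P, F x = ∑ p ∈ P, F (y + (p : ZMod (l + 1))) :=
  Finset.sum_image fun _ hp _ hq h => (add_natCast_inj y (hP _ hp) (hP _ hq)).mp h

theorem exists_posSet_eq (y : ZMod (l + 1)) (K : Finset (ZMod (l + 1))) :
    ∃ P : Finset ℕ, (∀ q ∈ P, q ≤ l) ∧ K = posSet y P := by
  refine ⟨{p ∈ Finset.range (l + 1) | y + ((p : ℕ) : ZMod (l + 1)) ∈ K}, fun q hq => ?_, ?_⟩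
  · have := Finset.mem_range.mp (Finset.mem_filter.mp hq).1
    omega
  · ext x
    obtain ⟨p, hp, rfl⟩ := exists_natCast_add_eq y x
    rw [mem_posSet y _ hp]
    · simp only [Finset.mem_filter, Finset.mem_range]
      exact ⟨fun h => ⟨by omega, h⟩, fun h => h.2⟩
    · intro q hq
      have := Finset.mem_range.mp (Finset.mem_filter.mp hq).1
      omega

/-- Dominoes start at positions below `l`, so none wraps around from `l` to `0` and the check
becomes arithmetic on natural numbers. -/
theorem isTiling_posSet (y : ZMod (l + 1)) {P T : Finset ℕ} (hP : ∀ q ∈ P, q ≤ l)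
    (hT : ∀ q ∈ T, q < l) (h : ∀ p ≤ l, (p ∉ P ↔ p ∈ T ∨ (1 ≤ p ∧ p - 1 ∈ T)) ∧
      ¬(p ∈ T ∧ 1 ≤ p ∧ p - 1 ∈ T)) :
    IsTiling (posSet y T) (posSet y P)ᶜ := by
  have hT' : ∀ q ∈ T, q ≤ l := fun q hq => (hT q hq).le
  intro x
  obtain ⟨p, hp, rfl⟩ := exists_natCast_add_eq y x
  have h1 := h p hp
  rw [Finset.mem_compl, mem_posSet y hP hp, mem_posSet y hT' hp]
  cases p with
  | zero =>
    have h2 : y + ((0 : ℕ) : ZMod (l + 1)) - 1 = y + ((l : ℕ) : ZMod (l + 1)) := by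
      rw [natCast_self_eq_neg_one, Nat.cast_zero]; ring
    rw [h2, mem_posSet y hT' le_rfl]
    have h3 : l ∉ T := fun h' => lt_irrefl _ (hT l h')
    simpa [h3] using h1
  | succ p =>
    have h2 : y + ((p + 1 : ℕ) : ZMod (l + 1)) - 1 = y + ((p : ℕ) : ZMod (l + 1)) := by
      push_cast; ring
    rw [h2, mem_posSet y hT' (by omega)]
    simpa using h1

theorem posSet_mem_S (y : ZMod (l + 1)) {P T : Finset ℕ} (hP : ∀ q ∈ P, q ≤ l) (h0 : 0 ∈ P)
    (hT : ∀ q ∈ T, q < l) (h : ∀ p ≤ l, (p ∉ P ↔ p ∈ T ∨ (1 ≤ p ∧ p - 1 ∈ T)) ∧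
      ¬(p ∈ T ∧ 1 ≤ p ∧ p - 1 ∈ T)) {d : ℕ} (hd : P.card = d) : posSet y P ∈ S l d :=
  (mem_S_iff (x := y + ((0 : ℕ) : ZMod (l + 1))) ((mem_posSet y hP (Nat.zero_le _)).mpr h0)).mpr
    ⟨(card_posSet y hP).trans hd, _, isTiling_posSet y hP hT h⟩

/-- Strictly between two consecutive points of `K` lies a component of the complement, possibly
empty, of even length `q - p - 1`. -/
theorem odd_gap {y : ZMod (l + 1)} {P : Finset ℕ} (hP : ∀ q ∈ P, q ≤ l) {d : ℕ}
    (hS : posSet y P ∈ S l d) {p q : ℕ} (hp : p ∈ P) (hq : q ∈ P) (hpq : p < q)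
    (hgap : ∀ t, p < t → t < q → t ∉ P) : Odd (q - p) := by
  obtain ⟨m, rfl⟩ := Nat.exists_eq_add_of_lt hpq
  have hql := hP _ hq
  have hpm : y + (p : ZMod (l + 1)) ∈ posSet y P := (mem_posSet y hP (by omega)).mpr hp
  have h1 := (Finset.mem_filter.mp hS).2 (y + (p : ZMod (l + 1)) + 1)
  rw [compLength_succ_of_notMem (fun h => Finset.mem_compl.mp h hpm),
    runLength_eq (m := m) (compl_ne_univ_of_mem hpm)] at h1
  · rw [show p + m + 1 - p = m + 1 by omega]
    exact h1.add_one
  · intro t ht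
    rw [show y + (p : ZMod (l + 1)) + 1 + (t : ZMod (l + 1)) =
      y + ((p + 1 + t : ℕ) : ZMod (l + 1)) by push_cast; ring, Finset.mem_compl,
      mem_posSet y hP (by omega)]
    exact hgap _ (by omega) (by omega)
  · rw [show y + (p : ZMod (l + 1)) + 1 + (m : ZMod (l + 1)) =
      y + ((p + m + 1 : ℕ) : ZMod (l + 1)) by push_cast; ring, Finset.mem_compl, not_not,
      mem_posSet y hP (by omega)]
    exact hq

theorem mem_posSet_zero_one (hl : 1 ≤ l) (y : ZMod (l + 1)) {P : Finset ℕ} (hP : ∀ q ∈ P, q ≤ l) :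
    (y ∈ posSet y P ↔ 0 ∈ P) ∧ (y + 1 ∈ posSet y P ↔ 1 ∈ P) := by
  rw [← mem_posSet y hP (Nat.zero_le _), ← mem_posSet y hP hl, Nat.cast_zero, add_zero,
    Nat.cast_one]
  exact ⟨Iff.rfl, Iff.rfl⟩

theorem card_of_posSet_mem_S {y : ZMod (l + 1)} {P : Finset ℕ} (hP : ∀ q ∈ P, q ≤ l) {d : ℕ}
    (hS : posSet y P ∈ S l d) : P.card = d := by
  rw [← card_posSet y hP]
  exact (Finset.mem_powersetCard.mp (Finset.mem_filter.mp hS).1).2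

end Positions

section Enumeration

variable {n : ℕ} {M : Type*} [AddCommMonoid M]

theorem sum_S_one (hn : 1 ≤ n) (y : ZMod (2 * n + 1)) (F : Finset (ZMod (2 * n + 1)) → M) :
    ∑ K ∈ S (2 * n) 1 with y ∈ K ∧ y + 1 ∉ K, F K = F {y} := by
  have hy : ({y} : Finset (ZMod (2 * n + 1))) = posSet y {0} := by simp [posSet]
  rw [Finset.sum_eq_single_of_mem {y}]
  · rw [Finset.mem_filter, Finset.mem_singleton, Finset.mem_singleton]
    refine ⟨?_, rfl, add_one_ne_self (by omega) y⟩
    rw [hy]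
    -- The `2n` remaining positions are tiled by dominoes starting at the odd ones.
    refine posSet_mem_S y (T := {p ∈ Finset.range (2 * n) | p % 2 = 1}) (by simp) (by simp) ?_ ?_
      (by simp)
    · simp +contextual
    · intro p hp
      simp only [Finset.mem_filter, Finset.mem_range, Finset.mem_singleton]
      omega
  · intro K hK hne
    rw [Finset.mem_filter] at hK
    obtain ⟨a, rfl⟩ := Finset.card_eq_one.mp
      (Finset.mem_powersetCard.mp (Finset.mem_filter.mp hK.1).1).2
    rw [Finset.mem_singleton] at hK
    exact absurd (by rw [hK.2.1]) hne

theorem sum_S_one_pair (hn : 1 ≤ n) (y : ZMod (2 * n + 1)) (F : Finset (ZMod (2 * n + 1)) → M) :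
    ∑ K ∈ S (2 * n) 1 with y ∈ K ∧ y + 1 ∈ K, F K = 0 := by
  refine Finset.sum_eq_zero fun K hK => ?_
  rw [Finset.mem_filter] at hK
  obtain ⟨a, rfl⟩ := Finset.card_eq_one.mp
    (Finset.mem_powersetCard.mp (Finset.mem_filter.mp hK.1).1).2
  simp only [Finset.mem_singleton] at hK
  exact absurd (hK.2.2.trans hK.2.1.symm) (add_one_ne_self (by omega) y)

theorem pair_eq_posSet (y : ZMod (2 * n + 1 + 1)) : {y, y + 1} = posSet y {0, 1} := by
  simp [posSet]

theorem isTiling_pair (y : ZMod (2 * n + 1 + 1)) :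
    IsTiling (posSet y {p ∈ Finset.range (2 * n + 1) | p % 2 = 0 ∧ 2 ≤ p}) {y, y + 1}ᶜ := by
  rw [pair_eq_posSet]
  refine isTiling_posSet y (fun q hq => ?_) (fun q hq => ?_) fun p hp => ?_
  · simp only [Finset.mem_insert, Finset.mem_singleton] at hq
    omega
  · simp only [Finset.mem_filter, Finset.mem_range] at hq
    omega
  · simp only [Finset.mem_filter, Finset.mem_range, Finset.mem_insert, Finset.mem_singleton]
    omega

theorem sum_S_two_pair (y : ZMod (2 * n + 1 + 1)) (F : Finset (ZMod (2 * n + 1 + 1)) → M) :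
    ∑ K ∈ S (2 * n + 1) 2 with y ∈ K ∧ y + 1 ∈ K, F K = F {y, y + 1} := by
  have hne := add_one_ne_self (l := 2 * n + 1) (by omega) y
  have hcard : ({y, y + 1} : Finset (ZMod (2 * n + 1 + 1))).card = 2 := Finset.card_pair hne.symm
  rw [Finset.sum_eq_single_of_mem {y, y + 1}]
  · rw [Finset.mem_filter]
    refine ⟨(mem_S_iff (x := y) (by simp)).mpr ⟨hcard, _, isTiling_pair y⟩, by simp, by simp⟩
  · intro K hK hne'
    rw [Finset.mem_filter] at hK
    refine absurd (Finset.eq_of_subset_of_card_le ?_ ?_).symm hne'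
    · intro z hz
      rw [Finset.mem_insert, Finset.mem_singleton] at hz
      rcases hz with rfl | rfl
      exacts [hK.2.1, hK.2.2]
    · rw [hcard, (Finset.mem_powersetCard.mp (Finset.mem_filter.mp hK.1).1).2]

/-- The complement is the single run at positions `2, …, 2n + 1`, whose dominoes start at the even
positions `2r`. -/
theorem chi_compl_pair (y : ZMod (2 * n + 1 + 1)) :
    chi {y, y + 1}ᶜ = ∑ r ∈ Finset.Icc 1 n, (fundWeight (y + 2 * (r : ZMod (2 * n + 1 + 1)))
      - fundWeight (y + 2 * (r : ZMod (2 * n + 1 + 1)) + 1)) := by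
  have himg : {p ∈ Finset.range (2 * n + 1) | p % 2 = 0 ∧ 2 ≤ p} =
      (Finset.Icc 1 n).image fun r => 2 * r := by
    ext p
    simp only [Finset.mem_filter, Finset.mem_range, Finset.mem_image, Finset.mem_Icc]
    constructor
    · intro h
      exact ⟨p / 2, by omega, by omega⟩
    · rintro ⟨r, hr, rfl⟩
      omega
  rw [(isTiling_pair y).chi_eq (compl_ne_univ_of_mem (x := y) (by simp)), himg, sum_posSet,
    Finset.sum_image fun a _ b _ h => by omega]
  · push_cast
    rfl
  · intro q hq
    obtain ⟨r, hr, rfl⟩ := Finset.mem_image.mp hq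
    rw [Finset.mem_Icc] at hr
    omega

/-- Relative to `y` the second point sits at an odd position by the gap parity, and position `1` is
excluded, leaving `2r + 1` with `1 ≤ r ≤ n`. -/
theorem sum_S_two (y : ZMod (2 * n + 1 + 1)) (F : Finset (ZMod (2 * n + 1 + 1)) → M) :
    ∑ K ∈ S (2 * n + 1) 2 with y ∈ K ∧ y + 1 ∉ K, F K =
      ∑ r ∈ Finset.Icc 1 n, F {y, y + 1 + 2 * (r : ZMod (2 * n + 1 + 1))} := by
  have hset : ∀ r : ℕ, ({y, y + 1 + 2 * (r : ZMod (2 * n + 1 + 1))} : Finset _) =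
      posSet y {0, 2 * r + 1} := by
    intro r
    simp only [posSet, Finset.image_insert, Finset.image_singleton]
    push_cast
    rw [add_zero, show y + 1 + 2 * (r : ZMod (2 * n + 1 + 1)) =
      y + (2 * (r : ZMod (2 * n + 1 + 1)) + 1) by ring]
  have hbd : ∀ r ∈ Finset.Icc 1 n, ∀ q ∈ ({0, 2 * r + 1} : Finset ℕ), q ≤ 2 * n + 1 := by
    intro r hr q hq
    simp only [Finset.mem_Icc, Finset.mem_insert, Finset.mem_singleton] at hr hq
    omega
  symm
  refine Finset.sum_bij (fun r _ => posSet y {0, 2 * r + 1}) ?_ ?_ ?_ (fun r _ => by rw [hset])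
  · intro r hr
    have hP := hbd r hr
    have hz := mem_posSet_zero_one (by omega) y hP
    rw [Finset.mem_Icc] at hr
    rw [Finset.mem_filter, hz.1, hz.2]
    refine ⟨posSet_mem_S y (T := {p ∈ Finset.range (2 * n + 1) |
      (p % 2 = 1 ∧ p < 2 * r + 1) ∨ (p % 2 = 0 ∧ 2 * r + 1 < p)}) hP (by simp) ?_ ?_ ?_,
      by simp, by simp; omega⟩
    · intro q hq
      exact Finset.mem_range.mp (Finset.mem_filter.mp hq).1
    · intro p hp
      simp only [Finset.mem_filter, Finset.mem_range, Finset.mem_insert, Finset.mem_singleton]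
      omega
    · exact Finset.card_pair (by omega)
  · intro r hr r' hr' h
    have := posSet_injOn y (hbd r hr) (hbd r' hr') h
    have h2 : 2 * r + 1 ∈ ({0, 2 * r' + 1} : Finset ℕ) := by rw [← this]; simp
    simp only [Finset.mem_insert, Finset.mem_singleton] at h2
    omega
  · intro K hK
    obtain ⟨P, hP, rfl⟩ := exists_posSet_eq y K
    have hz := mem_posSet_zero_one (by omega) y hP
    rw [Finset.mem_filter, hz.1, hz.2] at hK
    obtain ⟨c, hc⟩ := Finset.card_eq_one.mp ((Finset.card_erase_of_mem hK.2.1).trans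
      (by rw [card_of_posSet_mem_S hP hK.1]))
    have hPc : P = {0, c} := by rw [← hc, Finset.insert_erase hK.2.1]
    have hc0 : c ≠ 0 := fun h => by
      have : c ∈ P.erase 0 := by rw [hc]; simp
      exact (Finset.ne_of_mem_erase this) h
    subst hPc
    have hodd := odd_gap hP hK.1 (p := 0) (q := c) (by simp) (by simp) (by omega) (by
      intro t h1 h2
      simp only [Finset.mem_insert, Finset.mem_singleton]
      omega)
    have hcl := hP c (by simp)
    have hc1 : c ≠ 1 := fun h => hK.2.2 (by simp [h])
    obtain ⟨r, hr⟩ := hodd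
    rw [Nat.sub_zero] at hr
    subst hr
    exact ⟨r, Finset.mem_Icc.mpr (by omega), rfl⟩

/-- Beyond positions `0` and `1`, an odd gap after `1` places the third point at an even position
`2r`. -/
theorem sum_S_three (hn : 1 ≤ n) (y : ZMod (2 * n + 1)) (F : Finset (ZMod (2 * n + 1)) → M) :
    ∑ K ∈ S (2 * n) 3 with y ∈ K ∧ y + 1 ∈ K, F K =
      ∑ r ∈ Finset.Icc 1 n, F {y, y + 1, y + 2 * (r : ZMod (2 * n + 1))} := by
  have hset : ∀ r : ℕ, ({y, y + 1, y + 2 * (r : ZMod (2 * n + 1))} : Finset _) =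
      posSet y {0, 1, 2 * r} := by
    intro r
    simp only [posSet, Finset.image_insert, Finset.image_singleton]
    push_cast
    rw [add_zero]
  have hbd : ∀ r ∈ Finset.Icc 1 n, ∀ q ∈ ({0, 1, 2 * r} : Finset ℕ), q ≤ 2 * n := by
    intro r hr q hq
    simp only [Finset.mem_Icc, Finset.mem_insert, Finset.mem_singleton] at hr hq
    omega
  symm
  refine Finset.sum_bij (fun r _ => posSet y {0, 1, 2 * r}) ?_ ?_ ?_ (fun r _ => by rw [hset])
  · intro r hr
    have hP := hbd r hr
    have hz := mem_posSet_zero_one (by omega) y hP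
    rw [Finset.mem_Icc] at hr
    rw [Finset.mem_filter, hz.1, hz.2]
    refine ⟨posSet_mem_S y (T := {p ∈ Finset.range (2 * n) |
      (p % 2 = 0 ∧ 1 < p ∧ p < 2 * r) ∨ (p % 2 = 1 ∧ 2 * r < p)}) hP (by simp) ?_ ?_ ?_,
      by simp, by simp⟩
    · intro q hq
      exact Finset.mem_range.mp (Finset.mem_filter.mp hq).1
    · intro p hp
      simp only [Finset.mem_filter, Finset.mem_range, Finset.mem_insert, Finset.mem_singleton]
      omega
    · rw [Finset.card_insert_of_notMem, Finset.card_pair]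
      · omega
      · simp only [Finset.mem_insert, Finset.mem_singleton]; omega
  · intro r hr r' hr' h
    have := posSet_injOn y (hbd r hr) (hbd r' hr') h
    have h2 : 2 * r ∈ ({0, 1, 2 * r'} : Finset ℕ) := by rw [← this]; simp
    simp only [Finset.mem_insert, Finset.mem_singleton, Finset.mem_Icc] at h2 hr
    omega
  · intro K hK
    obtain ⟨P, hP, rfl⟩ := exists_posSet_eq y K
    have hz := mem_posSet_zero_one (by omega) y hP
    rw [Finset.mem_filter, hz.1, hz.2] at hK
    have h1 : 1 ∈ P.erase 0 := Finset.mem_erase.mpr ⟨one_ne_zero, hK.2.2⟩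
    obtain ⟨c, hc⟩ := Finset.card_eq_one.mp ((Finset.card_erase_of_mem h1).trans
      (by rw [Finset.card_erase_of_mem hK.2.1, card_of_posSet_mem_S hP hK.1]))
    have hPc : P = {0, 1, c} := by rw [← hc, Finset.insert_erase h1, Finset.insert_erase hK.2.1]
    have hc0 : c ∈ (P.erase 0).erase 1 := by rw [hc]; simp
    simp only [Finset.mem_erase] at hc0
    subst hPc
    have hodd := odd_gap hP hK.1 (p := 1) (q := c) (by simp) (by simp) (by omega) (by
      intro t h1 h2
      simp only [Finset.mem_insert, Finset.mem_singleton]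
      omega)
    have hcl := hP c (by simp)
    obtain ⟨r, hr⟩ := hodd
    obtain rfl : c = 2 * (r + 1) := by omega
    exact ⟨r + 1, Finset.mem_Icc.mpr (by omega), rfl⟩

/-- Beyond positions `0` and `1`, two further odd gaps give `2r` and then `2s + 1` with `r ≤ s`. -/
theorem sum_S_four (y : ZMod (2 * n + 1 + 1)) (F : Finset (ZMod (2 * n + 1 + 1)) → M) :
    ∑ K ∈ S (2 * n + 1) 4 with y ∈ K ∧ y + 1 ∈ K, F K =
      ∑ r ∈ Finset.Icc 1 n, ∑ s ∈ Finset.Icc r n,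
        F {y, y + 1, y + 2 * (r : ZMod (2 * n + 1 + 1)), y + 2 * (s : ZMod (2 * n + 1 + 1)) + 1} := by
  have hset : ∀ r s : ℕ, ({y, y + 1, y + 2 * (r : ZMod (2 * n + 1 + 1)),
      y + 2 * (s : ZMod (2 * n + 1 + 1)) + 1} : Finset _) = posSet y {0, 1, 2 * r, 2 * s + 1} := by
    intro r s
    simp only [posSet, Finset.image_insert, Finset.image_singleton]
    push_cast
    rw [add_zero, add_assoc y (2 * (s : ZMod (2 * n + 1 + 1)))]
  rw [Finset.sum_sigma']
  have hbd : ∀ z ∈ (Finset.Icc 1 n).sigma fun r => Finset.Icc r n,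
      ∀ q ∈ ({0, 1, 2 * z.1, 2 * z.2 + 1} : Finset ℕ), q ≤ 2 * n + 1 := by
    intro z hz q hq
    simp only [Finset.mem_sigma, Finset.mem_Icc, Finset.mem_insert, Finset.mem_singleton] at hz hq
    omega
  symm
  refine Finset.sum_bij (fun z _ => posSet y {0, 1, 2 * z.1, 2 * z.2 + 1}) ?_ ?_ ?_
    (fun z _ => by rw [hset])
  · intro z hzm
    have hP := hbd z hzm
    have hz := mem_posSet_zero_one (by omega) y hP
    obtain ⟨r, s⟩ := z
    simp only [Finset.mem_sigma, Finset.mem_Icc] at hzm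
    rw [Finset.mem_filter, hz.1, hz.2]
    -- Domino starts change parity after each point of `K`: even up to `2r`, odd up to `2s + 1`,
    -- even afterwards.
    refine ⟨posSet_mem_S y (T := {p ∈ Finset.range (2 * n + 1) |
      (p % 2 = 0 ∧ 1 < p ∧ p < 2 * r) ∨ (p % 2 = 1 ∧ 2 * r < p ∧ p < 2 * s + 1) ∨
        (p % 2 = 0 ∧ 2 * s + 1 < p)}) hP (by simp) ?_ ?_ ?_,
      by simp, by simp⟩
    · intro q hq
      exact Finset.mem_range.mp (Finset.mem_filter.mp hq).1
    · intro p hp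
      simp only [Finset.mem_filter, Finset.mem_range, Finset.mem_insert, Finset.mem_singleton]
      omega
    · rw [Finset.card_insert_of_notMem, Finset.card_insert_of_notMem, Finset.card_pair]
      · omega
      · simp only [Finset.mem_insert, Finset.mem_singleton]; omega
      · simp only [Finset.mem_insert, Finset.mem_singleton]; omega
  · intro z hz z' hz' h
    have := posSet_injOn y (hbd z hz) (hbd z' hz') h
    have h2 : 2 * z.1 ∈ ({0, 1, 2 * z'.1, 2 * z'.2 + 1} : Finset ℕ) := by rw [← this]; simp
    have h3 : 2 * z.2 + 1 ∈ ({0, 1, 2 * z'.1, 2 * z'.2 + 1} : Finset ℕ) := by rw [← this]; simp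
    obtain ⟨r, s⟩ := z
    obtain ⟨r', s'⟩ := z'
    simp only [Finset.mem_insert, Finset.mem_singleton, Finset.mem_sigma, Finset.mem_Icc] at h2 h3 hz
    obtain rfl : r = r' := by omega
    obtain rfl : s = s' := by omega
    rfl
  · intro K hK
    obtain ⟨P, hP, rfl⟩ := exists_posSet_eq y K
    have hz := mem_posSet_zero_one (by omega) y hP
    rw [Finset.mem_filter, hz.1, hz.2] at hK
    have h1 : 1 ∈ P.erase 0 := Finset.mem_erase.mpr ⟨one_ne_zero, hK.2.2⟩
    obtain ⟨a, b, hab, hc⟩ := Finset.card_eq_two.mp ((Finset.card_erase_of_mem h1).trans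
      (by rw [Finset.card_erase_of_mem hK.2.1, card_of_posSet_mem_S hP hK.1]))
    wlog hlt : a < b generalizing a b
    · exact this b a hab.symm (by rw [hc, Finset.pair_comm]) (by omega)
    have hPc : P = {0, 1, a, b} := by rw [← hc, Finset.insert_erase h1, Finset.insert_erase hK.2.1]
    have ha0 : a ∈ (P.erase 0).erase 1 := by rw [hc]; simp
    have hb0 : b ∈ (P.erase 0).erase 1 := by rw [hc]; simp
    simp only [Finset.mem_erase] at ha0 hb0
    subst hPc
    have hodd := odd_gap hP hK.1 (p := 1) (q := a) (by simp) (by simp) (by omega) (by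
      intro t h1 h2
      simp only [Finset.mem_insert, Finset.mem_singleton]
      omega)
    have hodd' := odd_gap hP hK.1 (p := a) (q := b) (by simp) (by simp) hlt (by
      intro t h1 h2
      simp only [Finset.mem_insert, Finset.mem_singleton]
      omega)
    have hbl := hP b (by simp)
    obtain ⟨r, hr⟩ := hodd
    obtain ⟨s, hs⟩ := hodd'
    obtain rfl : a = 2 * (r + 1) := by omega
    obtain rfl : b = 2 * (r + 1 + s) + 1 := by omega
    exact ⟨⟨r + 1, r + 1 + s⟩, by simp only [Finset.mem_sigma, Finset.mem_Icc]; omega, rfl⟩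

end Enumeration

/-! ## Fundamental weights -/

section Weights

variable {l : ℕ}

/-- The formula remains valid at `v = l + 1`, where every coefficient `r - r` vanishes. This spares
a wrap-around case at `i = l` in the second difference. -/
theorem fundWeight_natCast {v : ℕ} (hv : v ≤ l + 1) :
    (fundWeight (v : ZMod (l + 1)) : Alg l) = ∑ r ∈ Finset.Icc 1 l,
      ((min v r : ℕ) - (v * r : ℂ) / (l + 1) : ℂ) • α (r : ZMod (l + 1)) := by
  rcases Nat.lt_succ_iff_lt_or_eq.mp (Nat.lt_succ_of_le hv) with h1 | rfl
  · rw [fundWeight, ZMod.val_natCast_of_lt h1]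
  · have hl : (l + 1 : ℂ) ≠ 0 := by exact_mod_cast Nat.succ_ne_zero l
    rw [ZMod.natCast_self, fundWeight, ZMod.val_zero]
    refine Finset.sum_congr rfl fun r hr => ?_
    rw [Finset.mem_Icc] at hr
    rw [min_eq_right (show r ≤ l + 1 by omega)]
    congr 1
    push_cast
    field_simp
    simp

theorem fundWeight_zero : (fundWeight 0 : Alg l) = 0 := by
  simp [fundWeight]

theorem k_eq_add_sum : (k : Alg l) = α 0 + ∑ r ∈ Finset.Icc 1 l, α (r : ZMod (l + 1)) := by
  have h1 := sum_range_natCast_add (0 : ZMod (l + 1)) (α : _ → Alg l)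
  simp only [zero_add] at h1
  rw [k, ← h1, Finset.range_eq_Ico, Finset.sum_eq_sum_Ico_succ_bot (Nat.succ_pos l), Nat.cast_zero]
  rfl

/-- The second difference of the fundamental weights. -/
theorem fundWeight_second_difference (i : ZMod (l + 1)) :
    (fundWeight i + fundWeight i - fundWeight (i - 1) - fundWeight (i + 1) : Alg l) =
      α i - if i = 0 then k else 0 := by
  have hl : (l + 1 : ℂ) ≠ 0 := by exact_mod_cast Nat.succ_ne_zero l
  obtain ⟨v, hv, hi⟩ : ∃ v ≤ l, (v : ZMod (l + 1)) = i :=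
    ⟨i.val, Nat.lt_succ_iff.mp (ZMod.val_lt i), ZMod.natCast_zmod_val i⟩
  rcases v with _ | v
  · rw [Nat.cast_zero] at hi
    subst hi
    have h1 := fundWeight_natCast (l := l) (v := l) (by omega)
    have h2 := fundWeight_natCast (l := l) (v := 1) (by omega)
    rw [natCast_self_eq_neg_one] at h1
    rw [Nat.cast_one] at h2
    -- At `i = 0` the neighbours are `l` and `1`; the coefficients of `α_r` add up to `r - r * l /
    -- (l + 1) + 1 - r / (l + 1) = 1`.
    have h3 : (fundWeight (-1) + fundWeight 1 : Alg l) =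
        ∑ r ∈ Finset.Icc 1 l, α (r : ZMod (l + 1)) := by
      rw [h1, h2, ← Finset.sum_add_distrib]
      refine Finset.sum_congr rfl fun r hr => ?_
      rw [Finset.mem_Icc] at hr
      rw [← add_smul, min_eq_right hr.2, min_eq_left hr.1]
      convert one_smul ℂ (α (r : ZMod (l + 1)) : Alg l) using 2
      push_cast
      field_simp
      ring
    rw [if_pos rfl, zero_sub, zero_add, fundWeight_zero, k_eq_add_sum, ← h3]
    abel
  · have hne : i ≠ 0 := by
      rw [← hi, ← Nat.cast_zero, ne_eq, ZMod.natCast_eq_natCast_iff', Nat.zero_mod,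
        Nat.mod_eq_of_lt (by omega)]
      omega
    have e1 : i - 1 = (v : ZMod (l + 1)) := by rw [← hi]; push_cast; ring
    have e2 : i + 1 = ((v + 2 : ℕ) : ZMod (l + 1)) := by rw [← hi]; push_cast; ring
    rw [e1, e2, if_neg hne, sub_zero, ← hi, fundWeight_natCast (by omega),
      fundWeight_natCast (by omega), fundWeight_natCast (by omega), ← Finset.sum_add_distrib,
      ← Finset.sum_sub_distrib, ← Finset.sum_sub_distrib]
    -- The linear term has no second difference, and `min(·, r)` is linear except for a kink at `r`,
    -- so only `r = v + 1` contributes.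
    rw [Finset.sum_eq_single (v + 1)]
    · rw [← add_smul, ← sub_smul, ← sub_smul]
      convert one_smul ℂ (α ((v + 1 : ℕ) : ZMod (l + 1)) : Alg l) using 2
      rw [min_self, min_eq_left (by omega), min_eq_right (by omega)]
      push_cast
      field_simp
      ring
    · intro r hr hrv
      rw [← add_smul, ← sub_smul, ← sub_smul]
      convert zero_smul ℂ (α (r : ZMod (l + 1)) : Alg l) using 2
      rcases Nat.lt_or_gt_of_ne hrv with h | h
      · rw [min_eq_right (by omega), min_eq_right (by omega), min_eq_right (by omega)]
        push_cast
        field_simp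
        ring
      · rw [min_eq_left (by omega), min_eq_left (by omega), min_eq_left (by omega)]
        push_cast
        field_simp
        ring
    · intro h
      exact absurd (Finset.mem_Icc.mpr ⟨by omega, hv⟩) h

theorem fundWeight_mem_center (i : ZMod (l + 1)) :
    (fundWeight i : Alg l) ∈ Subalgebra.center ℂ (Alg l) :=
  sum_mem fun _ _ => Subalgebra.smul_mem _ (α_mem_center _) _

theorem chi_mem_center (C : Finset (ZMod (l + 1))) :
    (chi C : Alg l) ∈ Subalgebra.center ℂ (Alg l) :=
  sum_mem fun _ _ => sum_mem fun _ _ =>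
    mul_mem (pow_mem (neg_mem (one_mem _)) _) (fundWeight_mem_center _)

theorem add_natCast_ne (x : ZMod (l + 1)) {s t : ℕ} (hs : s ≤ l) (ht : t ≤ l) (hst : s ≠ t) :
    x + (s : ZMod (l + 1)) ≠ x + (t : ZMod (l + 1)) :=
  fun h => hst ((add_natCast_inj x hs ht).mp h)

/-- With constant weight the paired terms cancel completely. The condition `i ∈ K` appears as `i - 1
+ 1 ∈ K` to fit the enumeration at base point `i - 1`. -/
theorem lie_sum_fSet_one (hl : 2 ≤ l) {d : ℕ} (hd : d ≤ l) (i : ZMod (l + 1)) :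
    ⁅∑ K ∈ S l d, fSet K, f i⁆ = h * (
      ∑ K ∈ S l d with i - 1 ∈ K ∧ i - 1 + 1 ∈ K, fSet (K.erase (i - 1))
      - ∑ K ∈ S l d with i ∈ K ∧ i + 1 ∈ K, fSet (K.erase (i + 1))) := by
  have h1 := lie_sum_fSet hl hd i (W := fun _ => 1) fun _ => one_mem _
  simp only [one_mul, sub_self, zero_mul, Finset.sum_const_zero, add_zero] at h1
  simp only [sub_add_cancel]
  exact h1

theorem lie_sum_chi_mul_fSet (hl : 2 ≤ l) {d : ℕ} (hd : d ≤ l) (i : ZMod (l + 1)) :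
    ⁅∑ K ∈ S l d, chi Kᶜ * fSet K, f i⁆ = h * (
      ∑ K ∈ S l d with i - 1 ∈ K ∧ i - 1 + 1 ∈ K, chi Kᶜ * fSet (K.erase (i - 1))
      - ∑ K ∈ S l d with i ∈ K ∧ i + 1 ∈ K, chi Kᶜ * fSet (K.erase (i + 1))
      + ∑ K ∈ S l d with i - 1 ∈ K ∧ i - 1 + 1 ∉ K,
        (α i - if i = 0 then k else 0) * fSet (K.erase (i - 1))) := by
  rw [lie_sum_fSet hl hd i fun K => chi_mem_center Kᶜ]
  simp only [sub_add_cancel]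
  congr 2
  refine Finset.sum_congr rfl fun K hK => ?_
  rw [Finset.mem_filter] at hK
  rw [chi_sub_chi_shift hl hK.1 hK.2.1 hK.2.2, fundWeight_second_difference]

theorem lie_add_left_eq {A : Type*} [Ring A] {a b c x y z : A} (ha : ⁅a, c⁆ = z * x)
    (hb : ⁅b, c⁆ = z * y) : ⁅a + b, c⁆ = z * (x + y) := by
  rw [mul_add, ← ha, ← hb, Ring.lie_def, Ring.lie_def, Ring.lie_def, add_mul, mul_add,
    add_sub_add_comm]

end Weights

/-! ## The case `l = 2n` -/

section Even

variable {n : ℕ}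

/-- After deletion of `i - 1` there is a gap before `i`, so `f_i` stands on the left; after deletion
of `i + 1` there is a gap after `i`, so it stands on the right. This produces the ordering in the
equations. -/
theorem lie_sum_S_three (hn : 2 ≤ n) (i : ZMod (2 * n + 1)) :
    ⁅∑ K ∈ S (2 * n) 3, fSet K, f i⁆ = h * (
      f i * (∑ r ∈ Finset.Icc 1 n, f (i + 2 * (r : ZMod (2 * n + 1)) - 1))
        - (∑ r ∈ Finset.Icc 1 n, f (i + 2 * (r : ZMod (2 * n + 1)))) * f i) := by
  rw [lie_sum_fSet_one (by omega) (by omega),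
    sum_S_three (by omega) (i - 1) fun K => fSet (K.erase (i - 1)),
    sum_S_three (by omega) i fun K => fSet (K.erase (i + 1)), Finset.mul_sum, Finset.sum_mul]
  congr 2
  · refine Finset.sum_congr rfl fun r hr => ?_
    rw [Finset.mem_Icc] at hr
    have e1 := add_natCast_ne (i - 1) (show 0 ≤ 2 * n by omega) (show 1 ≤ 2 * n by omega)
      (by omega)
    have e2 := add_natCast_ne (i - 1) (show 0 ≤ 2 * n by omega) (show 2 * r ≤ 2 * n by omega)
      (by omega)
    have e3 := add_natCast_ne (i - 1) (show 1 ≤ 2 * n by omega) (show 2 * r ≤ 2 * n by omega)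
      (by omega)
    push_cast at e1 e2 e3
    rw [add_zero, sub_add_cancel] at e1
    rw [add_zero] at e2
    rw [sub_add_cancel] at e3
    rw [sub_add_cancel, Finset.erase_insert (by simp [e1, e2]),
      fSet_insert_left (by omega) (by simpa using e3) (by simpa using e2),
      fSet_singleton (by omega), sub_add_eq_add_sub]
  · refine Finset.sum_congr rfl fun r hr => ?_
    rw [Finset.mem_Icc] at hr
    have e1 := add_natCast_ne i (show 0 ≤ 2 * n by omega) (show 1 ≤ 2 * n by omega)
      (by omega)
    have e2 := add_natCast_ne i (show 0 ≤ 2 * n by omega) (show 2 * r ≤ 2 * n by omega)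
      (by omega)
    have e3 := add_natCast_ne i (show 1 ≤ 2 * n by omega) (show 2 * r ≤ 2 * n by omega)
      (by omega)
    push_cast at e1 e2 e3
    rw [add_zero] at e1 e2
    rw [Finset.insert_comm, Finset.erase_insert (by simp [e1.symm, e3]),
      fSet_insert_right (by omega) (by simpa using e2) (by simpa using e3),
      fSet_singleton (by omega)]

/-- A singleton contains no two neighbours, so only the weight-difference term from `K = {i - 1}`
survives, and its deleted set is empty. -/
theorem lie_sum_chi_S_one (hn : 1 ≤ n) (i : ZMod (2 * n + 1)) :
    ⁅∑ K ∈ S (2 * n) 1, chi Kᶜ * fSet K, f i⁆ = h * (α i - if i = 0 then k else 0) := by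
  rw [lie_sum_chi_mul_fSet (by omega) (by omega),
    sum_S_one_pair hn (i - 1) fun K => chi Kᶜ * fSet (K.erase (i - 1)),
    sum_S_one_pair hn i fun K => chi Kᶜ * fSet (K.erase (i + 1)),
    sum_S_one hn (i - 1) fun K => (α i - if i = 0 then k else 0) * fSet (K.erase (i - 1)),
    Finset.erase_singleton, fSet_empty, mul_one, sub_zero, zero_add]

/-- For `l = 2` the only three-element set is the whole cycle, which has no gap to start from. The
correction `z * b` makes the cubic invariant under cyclic rotation, so the three formulas are
rotations of one another. -/
theorem lie_cubic {A : Type*} [Ring A] {a b c z : A} (hab : a * b - b * a = z)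
    (hbc : b * c - c * b = z) (hca : c * a - a * c = z) (hza : z * a = a * z)
    (hzb : z * b = b * z) (hzc : z * c = c * z) :
    ⁅a * b * c + z * b, a⁆ = z * (a * b - c * a) ∧ ⁅a * b * c + z * b, b⁆ = z * (b * c - a * b) ∧
    ⁅a * b * c + z * b, c⁆ = z * (c * a - b * c) := by
  -- Rewriting rules towards the normal order `z, a, b, c`; the primed versions act inside
  -- right-associated products.
  have h1 : b * a = a * b - z := by rw [← hab]; abel
  have h2 : c * b = b * c - z := by rw [← hbc]; abel
  have h3 : c * a = a * c + z := by rw [← hca]; abel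
  have h1' : ∀ x, b * (a * x) = a * (b * x) - z * x := fun x => by
    rw [← mul_assoc, h1, sub_mul, mul_assoc]
  have h2' : ∀ x, c * (b * x) = b * (c * x) - z * x := fun x => by
    rw [← mul_assoc, h2, sub_mul, mul_assoc]
  have h3' : ∀ x, c * (a * x) = a * (c * x) + z * x := fun x => by
    rw [← mul_assoc, h3, add_mul, mul_assoc]
  have ha' : ∀ x, a * (z * x) = z * (a * x) := fun x => by rw [← mul_assoc, ← hza, mul_assoc]
  have hb' : ∀ x, b * (z * x) = z * (b * x) := fun x => by rw [← mul_assoc, ← hzb, mul_assoc]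
  have hc' : ∀ x, c * (z * x) = z * (c * x) := fun x => by rw [← mul_assoc, ← hzc, mul_assoc]
  simp only [Ring.lie_def, mul_assoc, mul_add, mul_sub, add_mul, h1, h2, h3, h1', h2', h3', ha',
    hb', hc', ← hzb]
  refine ⟨?_, ?_, ?_⟩ <;> abel

theorem lie_cubic_three (i : ZMod (2 * 1 + 1)) :
    ⁅(f 0 * f 1 * f 2 + h * f 1 : Alg (2 * 1)), f i⁆ = h * (
      f i * (∑ r ∈ Finset.Icc (1 : ℕ) 1, f (i + 2 * (r : ZMod (2 * 1 + 1)) - 1))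
        - (∑ r ∈ Finset.Icc (1 : ℕ) 1, f (i + 2 * (r : ZMod (2 * 1 + 1)))) * f i) := by
  have hz := fun a : Alg (2 * 1) => (commute_of_mem_center h_mem_center a).eq
  obtain ⟨h0, h1, h2⟩ := lie_cubic (lie_f_succ (l := 2 * 1) 0) (lie_f_succ (l := 2 * 1) 1)
    (lie_f_succ (l := 2 * 1) 2) (hz _) (hz _) (hz _)
  rw [Finset.Icc_self, Finset.sum_singleton, Finset.sum_singleton, Nat.cast_one]
  have hi : ∀ i : ZMod (2 * 1 + 1), i = 0 ∨ i = 1 ∨ i = 2 := by decide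
  rcases hi i with rfl | rfl | rfl
  · exact h0
  · exact h1
  · exact h2

theorem lie_hamiltonianEven (hn : 1 ≤ n) (i : ZMod (2 * n + 1)) :
    ⁅hamiltonianEven n, f i⁆ = h * (
      f i * (∑ r ∈ Finset.Icc 1 n, f (i + 2 * (r : ZMod (2 * n + 1)) - 1))
        - (∑ r ∈ Finset.Icc 1 n, f (i + 2 * (r : ZMod (2 * n + 1)))) * f i
        + (α i - if i = 0 then k else 0)) := by
  refine lie_add_left_eq ?_ (lie_sum_chi_S_one hn i)
  split_ifs with h1
  · subst h1
    exact lie_cubic_three i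
  · exact lie_sum_S_three (by omega) i

theorem exists_isPainleveDerivationEven {K : Type*} [DivisionRing K] [Algebra ℂ K]
    {ι : Alg (2 * n) →ₐ[ℂ] K} (hι : IsQuotientSkewField ι) :
    ∃ D : K →ₗ[ℂ] K, IsPainleveDerivationEven ι D := by
  -- The perturbation is central, so it drops out of the linearized relations.
  have he : ∀ i j : ZMod (2 * n + 1), (if i = 0 then (k : Alg (2 * n)) else 0) * f j +
      f i * (if j = 0 then k else 0) - ((if j = 0 then k else 0) * f i +
        f j * (if i = 0 then k else 0)) = 0 := by
    intro i j
    have hk := fun a : Alg (2 * n) => (commute_of_mem_center k_mem_center a).eq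
    split_ifs <;> simp only [hk, zero_mul, mul_zero] <;> abel
  obtain ⟨D, hD, h1, h2, h3⟩ := exists_derivation_alg hι (fun i => if i = 0 then k else 0)
    (fun i => he _ _) (fun i j _ _ => he _ _) (hamiltonianEven n)
  refine ⟨D, hD, fun i => ?_, h2, h3⟩
  rw [h1, apply_ite ι, map_zero]

theorem IsPainleveDerivationEven.unique {K : Type*} [DivisionRing K] [Algebra ℂ K]
    {ι : Alg (2 * n) →ₐ[ℂ] K} (hι : IsQuotientSkewField ι) {D D' : K →ₗ[ℂ] K}
    (hD : IsPainleveDerivationEven ι D) (hD' : IsPainleveDerivationEven ι D') : D = D' := by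
  refine hι.derivation_ext adjoin_range_gen hD.leibniz hD'.leibniz ?_
  rintro _ ⟨(i | i | _), rfl⟩
  · exact (hD.map_f i).trans (hD'.map_f i).symm
  · exact (hD.map_α i).trans (hD'.map_α i).symm
  · exact hD.map_h.trans hD'.map_h.symm

theorem IsPainleveDerivationEven.apply_f {K : Type*} [DivisionRing K] [Algebra ℂ K]
    {ι : Alg (2 * n) →ₐ[ℂ] K} (hι : IsQuotientSkewField ι) (hn : 1 ≤ n) {D : K →ₗ[ℂ] K}
    (hD : IsPainleveDerivationEven ι D) (i : ZMod (2 * n + 1)) :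
    D (ι (f i)) = ι (f i) * (∑ r ∈ Finset.Icc 1 n, ι (f (i + 2 * (r : ZMod (2 * n + 1)) - 1)))
      - (∑ r ∈ Finset.Icc 1 n, ι (f (i + 2 * (r : ZMod (2 * n + 1))))) * ι (f i) + ι (α i) := by
  rw [hD.map_f, inv_mul_lie_eq hι (h_ne_zero (by omega)) (lie_hamiltonianEven hn i)]
  simp only [map_add, map_sub, map_mul, map_sum, apply_ite ι, map_zero]
  abel

end Even

/-! ## The case `l = 2n + 1` -/

section Odd

variable {n : ℕ}

/-- The surviving sets become `{i, i + 2r - 1, i + 2s}` and `{i, i + 2r, i + 2s + 1}`; gap placement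
puts `f_i` first in the former and last in the latter. -/
theorem lie_sum_S_four (hn : 2 ≤ n) (i : ZMod (2 * n + 1 + 1)) :
    ⁅∑ K ∈ S (2 * n + 1) 4, fSet K, f i⁆ = h * (
      f i * (∑ r ∈ Finset.Icc 1 n, ∑ s ∈ Finset.Icc r n,
          f (i + 2 * (r : ZMod (2 * n + 1 + 1)) - 1) * f (i + 2 * (s : ZMod (2 * n + 1 + 1))))
        - (∑ r ∈ Finset.Icc 1 n, ∑ s ∈ Finset.Icc r n,
          f (i + 2 * (r : ZMod (2 * n + 1 + 1))) * f (i + 2 * (s : ZMod (2 * n + 1 + 1)) + 1))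
          * f i) := by
  rw [lie_sum_fSet_one (by omega) (by omega),
    sum_S_four (i - 1) fun K => fSet (K.erase (i - 1)),
    sum_S_four i fun K => fSet (K.erase (i + 1)), Finset.mul_sum, Finset.sum_mul]
  have hne : ∀ (y : ZMod (2 * n + 1 + 1)) (s t : ℕ), s ≤ 2 * n + 1 → t ≤ 2 * n + 1 → s ≠ t →
      y + (s : ZMod (2 * n + 1 + 1)) ≠ y + (t : ZMod (2 * n + 1 + 1)) :=
    fun y s t => add_natCast_ne y
  congr 2
  · refine Finset.sum_congr rfl fun r hr => ?_
    rw [Finset.mul_sum]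
    refine Finset.sum_congr rfl fun s hs => ?_
    rw [Finset.mem_Icc] at hr hs
    obtain ⟨y, rfl⟩ : ∃ y, i = y + 1 := ⟨i - 1, by ring⟩
    -- Position `2r - 1` becomes `2p + 1`; it differs from `2s + 1` since `p < r ≤ s`, which gives
    -- the gap needed before position `2r`.
    obtain ⟨p, rfl⟩ : ∃ p, r = p + 1 := ⟨r - 1, by omega⟩
    have e1 := hne y 0 1 (by omega) (by omega) (by omega)
    have e2 := hne y 0 (2 * (p + 1)) (by omega) (by omega) (by omega)
    have e3 := hne y 0 (2 * s + 1) (by omega) (by omega) (by omega)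
    have e4 := hne y 1 (2 * (p + 1)) (by omega) (by omega) (by omega)
    have e5 := hne y 1 (2 * s + 1) (by omega) (by omega) (by omega)
    have e6 := hne y (2 * (p + 1)) (2 * s + 1) (by omega) (by omega) (by omega)
    have e7 := hne y (2 * p + 1) (2 * s + 1) (by omega) (by omega) (by omega)
    push_cast at e1 e2 e3 e4 e5 e6 e7 ⊢
    rw [add_zero] at e1 e2 e3
    rw [← add_assoc y _ 1] at e3 e5 e6
    rw [← add_assoc y _ 1, ← add_assoc y _ 1] at e7
    have e8 : y + 2 * ((p : ZMod (2 * n + 1 + 1)) + 1) - 1 =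
        y + 2 * (p : ZMod (2 * n + 1 + 1)) + 1 := by
      ring
    rw [add_sub_cancel_right, Finset.erase_insert (by simp [e1, e2, e3]),
      fSet_insert_left (by omega) (by simp [e4, e5])
        (by simpa only [add_sub_cancel_right, Finset.mem_insert, Finset.mem_singleton, not_or]
          using ⟨e2, e3⟩),
      fSet_insert_left (by omega) (by simpa using e6)
        (by rw [e8, Finset.mem_singleton]; exact e7),
      fSet_singleton (by omega)]
    congr 3 <;> ring
  · refine Finset.sum_congr rfl fun r hr => ?_
    rw [Finset.sum_mul]
    refine Finset.sum_congr rfl fun s hs => ?_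
    rw [Finset.mem_Icc] at hr hs
    obtain ⟨p, rfl⟩ : ∃ p, r = p + 1 := ⟨r - 1, by omega⟩
    have e1 := hne i 0 1 (by omega) (by omega) (by omega)
    have e2 := hne i 0 (2 * (p + 1)) (by omega) (by omega) (by omega)
    have e3 := hne i 0 (2 * s + 1) (by omega) (by omega) (by omega)
    have e4 := hne i 1 (2 * (p + 1)) (by omega) (by omega) (by omega)
    have e5 := hne i 1 (2 * s + 1) (by omega) (by omega) (by omega)
    have e6 := hne i (2 * (p + 1)) (2 * s + 1) (by omega) (by omega) (by omega)
    have e7 := hne i (2 * p + 1) (2 * s + 1) (by omega) (by omega) (by omega)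
    push_cast at e1 e2 e3 e4 e5 e6 e7 ⊢
    rw [add_zero] at e1 e2 e3
    rw [← add_assoc i _ 1] at e3 e5 e6
    rw [← add_assoc i _ 1, ← add_assoc i _ 1] at e7
    have e8 : i + 2 * ((p : ZMod (2 * n + 1 + 1)) + 1) - 1 =
        i + 2 * (p : ZMod (2 * n + 1 + 1)) + 1 := by
      ring
    rw [Finset.insert_comm, Finset.erase_insert (by simp [e1.symm, e4, e5]),
      fSet_insert_right (by omega) (by simp [e2, e3]) (by simp [e4, e5]),
      fSet_insert_left (by omega) (by simpa using e6)
        (by rw [e8, Finset.mem_singleton]; exact e7),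
      fSet_singleton (by omega)]

/-- The case `l = 3` is treated like `lie_cubic`: the only four-element set is the whole cycle, the
correction `z * b * c` restores cyclic invariance, and the proof rewrites to the normal order `z, a,
b, c, d`. -/
theorem lie_quartic {A : Type*} [Ring A] {a b c d z : A} (hab : a * b - b * a = z)
    (hbc : b * c - c * b = z) (hcd : c * d - d * c = z) (hda : d * a - a * d = z)
    (hca : c * a = a * c) (hdb : d * b = b * d) (hza : z * a = a * z)
    (hzb : z * b = b * z) (hzc : z * c = c * z) (hzd : z * d = d * z) :
    ⁅a * b * c * d + z * b * c, a⁆ = z * (a * (b * c) - c * d * a) ∧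
    ⁅a * b * c * d + z * b * c, b⁆ = z * (b * (c * d) - d * a * b) ∧
    ⁅a * b * c * d + z * b * c, c⁆ = z * (c * (d * a) - a * b * c) ∧
    ⁅a * b * c * d + z * b * c, d⁆ = z * (d * (a * b) - b * c * d) := by
  have h1 : b * a = a * b - z := by rw [← hab]; abel
  have h2 : c * b = b * c - z := by rw [← hbc]; abel
  have h3 : d * c = c * d - z := by rw [← hcd]; abel
  have h4 : d * a = a * d + z := by rw [← hda]; abel
  have h1' : ∀ x, b * (a * x) = a * (b * x) - z * x := fun x => by
    rw [← mul_assoc, h1, sub_mul, mul_assoc]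
  have h2' : ∀ x, c * (b * x) = b * (c * x) - z * x := fun x => by
    rw [← mul_assoc, h2, sub_mul, mul_assoc]
  have h3' : ∀ x, d * (c * x) = c * (d * x) - z * x := fun x => by
    rw [← mul_assoc, h3, sub_mul, mul_assoc]
  have h4' : ∀ x, d * (a * x) = a * (d * x) + z * x := fun x => by
    rw [← mul_assoc, h4, add_mul, mul_assoc]
  have hca' : ∀ x, c * (a * x) = a * (c * x) := fun x => by rw [← mul_assoc, hca, mul_assoc]
  have hdb' : ∀ x, d * (b * x) = b * (d * x) := fun x => by rw [← mul_assoc, hdb, mul_assoc]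
  have ha' : ∀ x, a * (z * x) = z * (a * x) := fun x => by rw [← mul_assoc, ← hza, mul_assoc]
  have hb' : ∀ x, b * (z * x) = z * (b * x) := fun x => by rw [← mul_assoc, ← hzb, mul_assoc]
  have hc' : ∀ x, c * (z * x) = z * (c * x) := fun x => by rw [← mul_assoc, ← hzc, mul_assoc]
  have hd' : ∀ x, d * (z * x) = z * (d * x) := fun x => by rw [← mul_assoc, ← hzd, mul_assoc]
  simp only [Ring.lie_def, mul_assoc, mul_add, mul_sub, add_mul, h2, h3, h4, h1', h2', h3', h4', hca,
    hdb, hca', hdb', ha', hb', hc', hd', ← hzb, ← hzc]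
  refine ⟨?_, ?_, ?_, ?_⟩ <;> abel

theorem lie_quartic_four (i : ZMod (2 * 1 + 1 + 1)) :
    ⁅(f 0 * f 1 * f 2 * f 3 + h * f 1 * f 2 : Alg (2 * 1 + 1)), f i⁆ = h * (
      f i * (∑ r ∈ Finset.Icc (1 : ℕ) 1, ∑ s ∈ Finset.Icc (r : ℕ) 1,
          f (i + 2 * (r : ZMod (2 * 1 + 1 + 1)) - 1) * f (i + 2 * (s : ZMod (2 * 1 + 1 + 1))))
        - (∑ r ∈ Finset.Icc (1 : ℕ) 1, ∑ s ∈ Finset.Icc (r : ℕ) 1,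
          f (i + 2 * (r : ZMod (2 * 1 + 1 + 1))) * f (i + 2 * (s : ZMod (2 * 1 + 1 + 1)) + 1))
          * f i) := by
  have hz := fun a : Alg (2 * 1 + 1) => (commute_of_mem_center h_mem_center a).eq
  obtain ⟨h0, h1, h2, h3⟩ := lie_quartic (lie_f_succ (l := 2 * 1 + 1) 0)
    (lie_f_succ (l := 2 * 1 + 1) 1) (lie_f_succ (l := 2 * 1 + 1) 2) (lie_f_succ (l := 2 * 1 + 1) 3)
    (commute_f_of_ne (by decide) (by decide)).eq (commute_f_of_ne (by decide) (by decide)).eq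
    (hz _) (hz _) (hz _) (hz _)
  simp only [Finset.Icc_self, Finset.sum_singleton, Nat.cast_one]
  have hi : ∀ i : ZMod (2 * 1 + 1 + 1), i = 0 ∨ i = 1 ∨ i = 2 ∨ i = 3 := by decide
  rcases hi i with rfl | rfl | rfl | rfl
  · exact h0
  · exact h1
  · exact h2
  · exact h3

/-- Matching dominoes of the two complements are offset by one step, so each `r` contributes minus a
second difference at `i + 2r`; the term in `k` appears when that index is `0`. -/
theorem chi_compl_pair_sub (i : ZMod (2 * n + 1 + 1)) :
    (chi {i - 1, i - 1 + 1}ᶜ - chi {i, i + 1}ᶜ : Alg (2 * n + 1)) =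
      (∑ r ∈ Finset.Icc 1 n, if i + 2 * (r : ZMod (2 * n + 1 + 1)) = 0 then k else 0)
        - ∑ r ∈ Finset.Icc 1 n, α (i + 2 * (r : ZMod (2 * n + 1 + 1))) := by
  rw [chi_compl_pair, chi_compl_pair, ← Finset.sum_sub_distrib, ← Finset.sum_sub_distrib]
  refine Finset.sum_congr rfl fun r _ => ?_
  have h1 := fundWeight_second_difference (i + 2 * (r : ZMod (2 * n + 1 + 1)))
  rw [← neg_sub (α _), ← h1, sub_add_eq_add_sub i 1, sub_add_cancel]
  abel

/-- The sets `{i - 1, i}` and `{i, i + 1}` both reduce to `f_i` and contribute a difference of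
weights; the sets `{i - 1, i + 2r}` reduce to `f_{i+2r}` and contribute through the shift. -/
theorem lie_sum_chi_S_two (hn : 1 ≤ n) (i : ZMod (2 * n + 1 + 1)) :
    ⁅∑ K ∈ S (2 * n + 1) 2, chi Kᶜ * fSet K, f i⁆ = h * (
      ((∑ r ∈ Finset.Icc 1 n, if i + 2 * (r : ZMod (2 * n + 1 + 1)) = 0 then k else 0)
        - ∑ r ∈ Finset.Icc 1 n, α (i + 2 * (r : ZMod (2 * n + 1 + 1)))) * f i
      + (α i - if i = 0 then k else 0) *
        ∑ r ∈ Finset.Icc 1 n, f (i + 2 * (r : ZMod (2 * n + 1 + 1)))) := by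
  have h1 : i - 1 ≠ i := sub_one_ne_self (by omega) i
  have h2 : i + 1 ≠ i := add_one_ne_self (by omega) i
  rw [lie_sum_chi_mul_fSet (by omega) (by omega),
    sum_S_two_pair (i - 1) fun K => chi Kᶜ * fSet (K.erase (i - 1)),
    sum_S_two_pair i fun K => chi Kᶜ * fSet (K.erase (i + 1)),
    sum_S_two (i - 1) fun K => (α i - if i = 0 then k else 0) * fSet (K.erase (i - 1)),
    ← chi_compl_pair_sub, sub_add_cancel, Finset.erase_insert (by simpa using h1),
    Finset.pair_comm i (i + 1), Finset.erase_insert (by simpa using h2),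
    fSet_singleton (by omega), ← Finset.mul_sum, ← sub_mul]
  congr 3
  refine Finset.sum_congr rfl fun r hr => ?_
  rw [Finset.mem_Icc] at hr
  have h3 := add_natCast_ne (i - 1) (show 0 ≤ 2 * n + 1 by omega)
    (show 2 * r + 1 ≤ 2 * n + 1 by omega) (by omega)
  push_cast at h3
  rw [add_zero, add_comm _ (1 : ZMod (2 * n + 1 + 1)), ← add_assoc, sub_add_cancel] at h3
  rw [Finset.erase_insert (by simpa using h3), fSet_singleton (by omega)]

theorem lie_hamiltonianOdd (hn : 1 ≤ n) (i : ZMod (2 * n + 1 + 1)) :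
    ⁅hamiltonianOdd n, f i⁆ = h * (
      f i * (∑ r ∈ Finset.Icc 1 n, ∑ s ∈ Finset.Icc r n,
          f (i + 2 * (r : ZMod (2 * n + 1 + 1)) - 1) * f (i + 2 * (s : ZMod (2 * n + 1 + 1))))
        - (∑ r ∈ Finset.Icc 1 n, ∑ s ∈ Finset.Icc r n,
          f (i + 2 * (r : ZMod (2 * n + 1 + 1))) * f (i + 2 * (s : ZMod (2 * n + 1 + 1)) + 1))
          * f i
      + (((∑ r ∈ Finset.Icc 1 n, if i + 2 * (r : ZMod (2 * n + 1 + 1)) = 0 then k else 0)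
        - ∑ r ∈ Finset.Icc 1 n, α (i + 2 * (r : ZMod (2 * n + 1 + 1)))) * f i
      + (α i - if i = 0 then k else 0) *
        ∑ r ∈ Finset.Icc 1 n, f (i + 2 * (r : ZMod (2 * n + 1 + 1)))) + 0) := by
  refine lie_add_left_eq (lie_add_left_eq ?_ (lie_sum_chi_S_two hn i)) ?_
  · split_ifs with h1
    · subst h1
      exact lie_quartic_four i
    · exact lie_sum_S_four (by omega) i
  · have hc : (∑ i ∈ Finset.Icc 1 (2 * n + 1),
        (-1) ^ (i - 1) * fundWeight (i : ZMod (2 * n + 1 + 1))) ^ 2 ∈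
        Subalgebra.center ℂ (Alg (2 * n + 1)) :=
      pow_mem (sum_mem fun _ _ =>
        mul_mem (pow_mem (neg_mem (one_mem _)) _) (fundWeight_mem_center _)) _
    rw [mul_zero]
    exact sub_eq_zero.mpr (commute_of_mem_center hc (f i)).eq

/-! ### The non-Hamiltonian part of the derivation in the odd case -/

theorem lie_f_f_eq {l : ℕ} (hl : 2 ≤ l) (i j : ZMod (l + 1)) :
    (⁅f i, f j⁆ : Alg l) = (if j = i + 1 then h else 0) - if j = i - 1 then h else 0 := by
  by_cases h1 : j = i + 1
  · have h2 : j ≠ i - 1 := fun h2 => sub_one_ne_add_one hl i (h2.symm.trans h1)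
    rw [if_pos h1, if_neg h2, sub_zero, h1, lie_f_succ]
  · by_cases h2 : j = i - 1
    · rw [if_neg h1, if_pos h2, zero_sub, h2, lie_f_pred]
    · rw [if_neg h1, if_neg h2, sub_zero, lie_f_of_ne h1 h2]

/-- The bracket of `f_{2r}` with `f_j` is `G (r + 1) - G r`, where `G r` detects `j = 2r - 1`. The
sum telescopes around the cycle, whose length `2n + 2` makes both ends agree. -/
theorem x₀_mem_center (hn : 1 ≤ n) : x₀ n ∈ Subalgebra.center ℂ (Alg (2 * n + 1)) := by
  refine mem_center_of_commute_gen adjoin_range_gen fun g => ?_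
  rcases g with j | j | _
  · refine sub_eq_zero.mp ?_
    change x₀ n * f j - f j * x₀ n = 0
    let G : ℕ → Alg (2 * n + 1) := fun r =>
      if j = 2 * (r : ZMod (2 * n + 1 + 1)) - 1 then h else 0
    have h1 : ∀ r ∈ Finset.range (n + 1), f (2 * (r : ZMod (2 * n + 1 + 1))) * f j -
        f j * f (2 * (r : ZMod (2 * n + 1 + 1))) = G (r + 1) - G r := by
      intro r _
      have h2 : 2 * ((r + 1 : ℕ) : ZMod (2 * n + 1 + 1)) - 1 = 2 * (r : ZMod (2 * n + 1 + 1)) + 1 := by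
        push_cast; ring
      simp only [G, h2]
      exact lie_f_f_eq (by omega) _ _
    have h3 : 2 * ((n + 1 : ℕ) : ZMod (2 * n + 1 + 1)) = 2 * ((0 : ℕ) : ZMod (2 * n + 1 + 1)) := by
      have := ZMod.natCast_self (2 * n + 1 + 1)
      push_cast at this ⊢
      linear_combination this
    rw [x₀, Finset.sum_mul, Finset.mul_sum, ← Finset.sum_sub_distrib, Finset.sum_congr rfl h1,
      Finset.sum_range_sub, sub_eq_zero]
    simp only [G, h3]
  · exact (commute_of_mem_center (α_mem_center j) _).symm
  · exact (commute_of_mem_center h_mem_center _).symm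

/-- Parity survives the wrap-around because the modulus is even. -/
theorem neg_one_pow_val_add_one {A : Type*} [Ring A] (i : ZMod (2 * n + 1 + 1)) :
    (-1 : A) ^ (i + 1).val = -(-1) ^ i.val := by
  have h1 : (i + 1).val = (i.val + 1) % (2 * n + 1 + 1) := by
    rw [ZMod.val_add, ZMod.val_one_eq_one_mod, Nat.add_mod_mod]
  have h2 : (i + 1).val % 2 = (i.val + 1) % 2 := by
    rw [h1]
    exact Nat.mod_mod_of_dvd _ ⟨n + 1, by ring⟩
  rw [neg_one_pow_eq_pow_mod_two, h2, ← neg_one_pow_eq_pow_mod_two, pow_succ, mul_neg_one]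

theorem sum_ite_add_two_mul_eq_zero {M : Type*} [AddCommMonoid M] (c : M)
    (i : ZMod (2 * n + 1 + 1)) :
    (∑ r ∈ Finset.Icc 1 n, if i + 2 * (r : ZMod (2 * n + 1 + 1)) = 0 then c else 0) =
      if i ≠ 0 ∧ Even i.val then c else 0 := by
  have hv := ZMod.val_lt i
  have h1 : ∀ r ∈ Finset.Icc 1 n,
      i + 2 * (r : ZMod (2 * n + 1 + 1)) = 0 ↔ i.val + 2 * r = 2 * n + 2 := by
    intro r hr
    rw [Finset.mem_Icc] at hr
    have h2 : i + 2 * (r : ZMod (2 * n + 1 + 1)) = ((i.val + 2 * r : ℕ) : ZMod (2 * n + 1 + 1)) := by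
      push_cast
      rw [ZMod.natCast_zmod_val]
    rw [h2, ZMod.natCast_eq_zero_iff]
    constructor
    · rintro ⟨q, hq⟩
      have : q = 1 := by
        rcases q with _ | _ | q
        · omega
        · rfl
        · nlinarith
      subst this
      omega
    · intro h
      exact ⟨1, by omega⟩
  have h0 : i ≠ 0 ↔ 1 ≤ i.val := by
    rw [Nat.one_le_iff_ne_zero, ne_eq, ne_eq, ZMod.val_eq_zero]
  split_ifs with h
  · rw [h0, Nat.even_iff] at h
    -- The condition reads `i.val + 2r = 2n + 2`, with unique solution `r = n + 1 - i.val / 2`.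
    rw [Finset.sum_eq_single_of_mem (n + 1 - i.val / 2) (Finset.mem_Icc.mpr ⟨by omega, by omega⟩)]
    · exact if_pos ((h1 _ (Finset.mem_Icc.mpr ⟨by omega, by omega⟩)).mpr (by omega))
    · intro r hr hne
      exact if_neg fun h2 => hne (by have := (h1 r hr).mp h2; omega)
  · rw [h0, Nat.even_iff] at h
    refine Finset.sum_eq_zero fun r hr => if_neg fun h2 => ?_
    have := (h1 r hr).mp h2
    rw [Finset.mem_Icc] at hr
    omega

/-- The part of `∂ (f i)` that does not come from the Hamiltonian. -/
noncomputable def oddPerturbation (n : ℕ) (i : ZMod (2 * n + 1 + 1)) : Alg (2 * n + 1) :=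
  -((-1) ^ i.val * ((1 / 2 : ℂ) • k) * f i) + if i = 0 then k * x₀ n else 0

/-- The multiples of `k` left over from the Hamiltonian always combine to `k / 2`. At `0`, `x₀`
minus the sum leaves `f₀`, and `-1/2 + 1 = 1/2`; at nonzero even `i` the indicator supplies the same
`+1`; at odd `i` the sign already gives `+1/2`. -/
theorem oddPerturbation_add (i : ZMod (2 * n + 1 + 1)) :
    oddPerturbation n i +
      ((∑ r ∈ Finset.Icc 1 n, if i + 2 * (r : ZMod (2 * n + 1 + 1)) = 0 then k else 0) * f i
      - (if i = 0 then k else 0) * ∑ r ∈ Finset.Icc 1 n, f (i + 2 * (r : ZMod (2 * n + 1 + 1)))) =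
      ((1 / 2 : ℂ) • k) * f i := by
  have hk : (k : Alg (2 * n + 1)) = (1 / 2 : ℂ) • k + (1 / 2 : ℂ) • k := by
    rw [← add_smul]; norm_num
  rw [oddPerturbation, sum_ite_add_two_mul_eq_zero]
  by_cases h0 : i = 0
  · have hx : x₀ n = f 0 + ∑ r ∈ Finset.Icc 1 n, f (2 * (r : ZMod (2 * n + 1 + 1))) := by
      rw [x₀, Finset.range_eq_Ico, Finset.sum_eq_sum_Ico_succ_bot (Nat.succ_pos n), Nat.cast_zero,
        mul_zero]
      rfl
    subst h0
    rw [if_pos rfl, if_pos rfl, if_neg (fun h => h.1 rfl), ZMod.val_zero, pow_zero, one_mul, hx]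
    simp only [zero_add, zero_mul, zero_sub, mul_add]
    have := congrArg (· * f 0) hk
    simp only [add_mul] at this
    rw [this]
    abel
  · rw [if_neg h0, if_neg h0, zero_mul, sub_zero, add_zero]
    by_cases he : Even i.val
    · rw [if_pos ⟨h0, he⟩, he.neg_one_pow, one_mul]
      have := congrArg (· * f i) hk
      simp only [add_mul] at this
      rw [this]
      abel
    · rw [if_neg fun h => he h.2, (Nat.not_even_iff_odd.mp he).neg_one_pow, zero_mul, add_zero,
        neg_one_mul, neg_mul, neg_neg]

/-- Central summands do not affect the linearized bracket, and rescaling by `-c` and `-d` multiplies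
it by `-(c + d)`. Hence it vanishes for commuting elements and for opposite weights. -/
theorem commutator_perturbation {A : Type*} [Ring A] {a b c d e g : A} (hc : ∀ x, c * x = x * c)
    (hd : ∀ x, d * x = x * d) (he : ∀ x, e * x = x * e) (hg : ∀ x, g * x = x * g)
    (h : a * b - b * a = 0 ∨ c + d = 0) :
    (-(c * a) + e) * b + a * (-(d * b) + g) - ((-(d * b) + g) * a + b * (-(c * a) + e)) = 0 := by
  have h1 : (-(c * a) + e) * b + a * (-(d * b) + g) - ((-(d * b) + g) * a + b * (-(c * a) + e)) =
      -((c + d) * (a * b - b * a)) := by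
    linear_combination (norm := noncomm_ring) hd a * b - hc b * a + he b - hg a
  rw [h1]
  rcases h with h | h <;> rw [h] <;> simp

theorem oddPerturbation_commutator (hn : 1 ≤ n) {i j : ZMod (2 * n + 1 + 1)}
    (hij : ⁅f i, f j⁆ = (0 : Alg (2 * n + 1)) ∨
      ((-1) ^ i.val + (-1) ^ j.val : Alg (2 * n + 1)) = 0) :
    oddPerturbation n i * f j + f i * oddPerturbation n j -
      (oddPerturbation n j * f i + f j * oddPerturbation n i) = 0 := by
  have h1 : ∀ i : ZMod (2 * n + 1 + 1), (-1) ^ i.val * ((1 / 2 : ℂ) • k) ∈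
      Subalgebra.center ℂ (Alg (2 * n + 1)) := fun i =>
    mul_mem (pow_mem (neg_mem (one_mem _)) _) (Subalgebra.smul_mem _ k_mem_center _)
  have h2 : ∀ i : ZMod (2 * n + 1 + 1), (if i = 0 then k * x₀ n else 0) ∈
      Subalgebra.center ℂ (Alg (2 * n + 1)) := by
    intro i
    split_ifs
    · exact mul_mem k_mem_center (x₀_mem_center hn)
    · exact zero_mem _
  exact commutator_perturbation (fun x => (commute_of_mem_center (h1 i) x).eq)
    (fun x => (commute_of_mem_center (h1 j) x).eq) (fun x => (commute_of_mem_center (h2 i) x).eq)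
    (fun x => (commute_of_mem_center (h2 j) x).eq)
    (hij.imp_right fun h => by rw [← add_mul, h, zero_mul])

theorem map_oddPerturbation {K : Type*} [DivisionRing K] [Algebra ℂ K]
    (ι : Alg (2 * n + 1) →ₐ[ℂ] K) (i : ZMod (2 * n + 1 + 1)) :
    ι (oddPerturbation n i) = -((-1) ^ i.val * ((1 / 2 : ℂ) • ι k) * ι (f i))
      + if i = 0 then ι k * ι (x₀ n) else 0 := by
  rw [oddPerturbation, map_add, apply_ite ι, map_zero, map_mul, map_neg, map_mul, map_mul, map_pow,
    map_neg, map_one, map_smul]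

theorem exists_isPainleveDerivationOdd {K : Type*} [DivisionRing K] [Algebra ℂ K] (hn : 1 ≤ n)
    {ι : Alg (2 * n + 1) →ₐ[ℂ] K} (hι : IsQuotientSkewField ι) :
    ∃ D : K →ₗ[ℂ] K, IsPainleveDerivationOdd ι D := by
  obtain ⟨D, hD, h1, h2, h3⟩ := exists_derivation_alg hι (oddPerturbation n)
    -- Neighbouring generators carry opposite signs; the remaining pairs commute.
    (fun i => oddPerturbation_commutator hn
      (.inr (by rw [neg_one_pow_val_add_one, add_neg_cancel])))
    (fun i j h1 h2 => oddPerturbation_commutator hn (.inl (lie_f_of_ne h1 h2))) (hamiltonianOdd n)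
  refine ⟨D, hD, fun i => ?_, h2, h3⟩
  rw [h1, map_oddPerturbation, ← add_assoc, ← sub_eq_add_neg]

theorem IsPainleveDerivationOdd.unique {K : Type*} [DivisionRing K] [Algebra ℂ K]
    {ι : Alg (2 * n + 1) →ₐ[ℂ] K} (hι : IsQuotientSkewField ι) {D D' : K →ₗ[ℂ] K}
    (hD : IsPainleveDerivationOdd ι D) (hD' : IsPainleveDerivationOdd ι D') : D = D' := by
  refine hι.derivation_ext adjoin_range_gen hD.leibniz hD'.leibniz ?_
  rintro _ ⟨(i | i | _), rfl⟩
  · exact (hD.map_f i).trans (hD'.map_f i).symm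
  · exact (hD.map_α i).trans (hD'.map_α i).symm
  · exact hD.map_h.trans hD'.map_h.symm

theorem IsPainleveDerivationOdd.apply_f {K : Type*} [DivisionRing K] [Algebra ℂ K]
    {ι : Alg (2 * n + 1) →ₐ[ℂ] K} (hι : IsQuotientSkewField ι) (hn : 1 ≤ n) {D : K →ₗ[ℂ] K}
    (hD : IsPainleveDerivationOdd ι D) (i : ZMod (2 * n + 1 + 1)) :
    D (ι (f i)) =
      ι (f i) * (∑ r ∈ Finset.Icc 1 n, ∑ s ∈ Finset.Icc r n,
          ι (f (i + 2 * (r : ZMod (2 * n + 1 + 1)) - 1)) *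
            ι (f (i + 2 * (s : ZMod (2 * n + 1 + 1)))))
        - (∑ r ∈ Finset.Icc 1 n, ∑ s ∈ Finset.Icc r n,
          ι (f (i + 2 * (r : ZMod (2 * n + 1 + 1)))) *
            ι (f (i + 2 * (s : ZMod (2 * n + 1 + 1)) + 1))) * ι (f i)
        + ((1 / 2 : ℂ) • (∑ j, ι (α j)) -
            ∑ r ∈ Finset.Icc 1 n, ι (α (i + 2 * (r : ZMod (2 * n + 1 + 1))))) * ι (f i)
        + ι (α i) * (∑ r ∈ Finset.Icc 1 n, ι (f (i + 2 * (r : ZMod (2 * n + 1 + 1))))) := by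
  have h1 := congrArg ι (oddPerturbation_add i)
  have hk : ∑ j, ι (α j) = ι k := (map_sum ι _ _).symm
  simp only [map_add, map_sub, map_mul, map_smul] at h1
  rw [hD.map_f, inv_mul_lie_eq hι (h_ne_zero (by omega)) (lie_hamiltonianOdd hn i), hk,
    sub_eq_add_neg (ι _), add_assoc (ι _), ← map_oddPerturbation,
    sub_mul ((1 / 2 : ℂ) • ι k), ← h1]
  simp only [map_add, map_sub, map_mul, sub_mul, add_zero]
  simp only [map_sum, map_mul]
  abel

end Odd

end QPainleve

theorem theorem1p1 :
    -- the case `l = 1`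
    (QPainleve.HasQuotientSkewField QPainleve.Alg₁ ∧
      ∀ (K : Type*) [DivisionRing K] [Algebra ℂ K] (ι : QPainleve.Alg₁ →ₐ[ℂ] K),
        QPainleve.IsQuotientSkewField ι →
        (∃! D : K →ₗ[ℂ] K, QPainleve.IsPainleveDerivation₁ ι D) ∧
        ∀ D : K →ₗ[ℂ] K, QPainleve.IsPainleveDerivation₁ ι D →
          let f : Fin 3 → K := fun i => ι (QPainleve.f₁ i)
          let α : Fin 2 → K := fun i => ι (QPainleve.α₁ i)
          let h : K := ι QPainleve.h₁
          D (f 0) = f 0 * f 2 + f 2 * f 0 + α 0 ∧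
          D (f 1) = -(f 1 * f 2) - f 2 * f 1 + α 1 ∧
          D (f 2) = f 1 - f 0 ∧
          (∀ i, D (α i) = 0) ∧
          D h = 0) ∧
    -- the case `l = 2n`, `n ≥ 1`
    (∀ n : ℕ, 1 ≤ n → QPainleve.HasQuotientSkewField (QPainleve.Alg (2 * n)) ∧
      ∀ (K : Type*) [DivisionRing K] [Algebra ℂ K] (ι : QPainleve.Alg (2 * n) →ₐ[ℂ] K),
        QPainleve.IsQuotientSkewField ι →
        (∃! D : K →ₗ[ℂ] K, QPainleve.IsPainleveDerivationEven ι D) ∧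
        ∀ D : K →ₗ[ℂ] K, QPainleve.IsPainleveDerivationEven ι D →
          let f : ZMod (2 * n + 1) → K := fun i => ι (QPainleve.f i)
          let α : ZMod (2 * n + 1) → K := fun i => ι (QPainleve.α i)
          let h : K := ι QPainleve.h
          (∀ i, D (f i) =
            f i * (∑ r ∈ Finset.Icc 1 n, f (i + 2 * (r : ZMod (2 * n + 1)) - 1))
              - (∑ r ∈ Finset.Icc 1 n, f (i + 2 * (r : ZMod (2 * n + 1)))) * f i
              + α i) ∧
          (∀ i, D (α i) = 0) ∧
          D h = 0) ∧
    -- the case `l = 2n + 1`, `n ≥ 1`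
    (∀ n : ℕ, 1 ≤ n → QPainleve.HasQuotientSkewField (QPainleve.Alg (2 * n + 1)) ∧
      ∀ (K : Type*) [DivisionRing K] [Algebra ℂ K] (ι : QPainleve.Alg (2 * n + 1) →ₐ[ℂ] K),
        QPainleve.IsQuotientSkewField ι →
        (∃! D : K →ₗ[ℂ] K, QPainleve.IsPainleveDerivationOdd ι D) ∧
        ∀ D : K →ₗ[ℂ] K, QPainleve.IsPainleveDerivationOdd ι D →
          let f : ZMod (2 * n + 1 + 1) → K := fun i => ι (QPainleve.f i)
          let α : ZMod (2 * n + 1 + 1) → K := fun i => ι (QPainleve.α i)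
          let h : K := ι QPainleve.h
          let k : K := ∑ i, α i
          (∀ i, D (f i) =
            f i * (∑ r ∈ Finset.Icc 1 n, ∑ s ∈ Finset.Icc r n,
                f (i + 2 * (r : ZMod (2 * n + 1 + 1)) - 1) * f (i + 2 * (s : ZMod (2 * n + 1 + 1))))
              - (∑ r ∈ Finset.Icc 1 n, ∑ s ∈ Finset.Icc r n,
                f (i + 2 * (r : ZMod (2 * n + 1 + 1))) * f (i + 2 * (s : ZMod (2 * n + 1 + 1)) + 1))
                * f i
              + ((1 / 2 : ℂ) • k - ∑ r ∈ Finset.Icc 1 n, α (i + 2 * (r : ZMod (2 * n + 1 + 1)))) * f i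
              + α i * (∑ r ∈ Finset.Icc 1 n, f (i + 2 * (r : ZMod (2 * n + 1 + 1))))) ∧
          (∀ i, D (α i) = 0) ∧
          D h = 0) := by
  refine ⟨⟨QPainleve.hasQuotientSkewField_alg₁, fun K _ _ ι hι => ⟨?_, fun D hD =>
      hD.equations hι⟩⟩, fun n hn => ⟨QPainleve.hasQuotientSkewField_alg (by omega),
      fun K _ _ ι hι => ⟨?_, fun D hD => ⟨hD.apply_f hι hn, fun i => ?_, ?_⟩⟩⟩,
    fun n hn => ⟨QPainleve.hasQuotientSkewField_alg (by omega),
      fun K _ _ ι hι => ⟨?_, fun D hD => ⟨hD.apply_f hι hn, fun i => ?_, ?_⟩⟩⟩⟩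
  · obtain ⟨D, hD⟩ := QPainleve.exists_derivation₁ hι
    exact ⟨D, hD, fun D' hD' => hD'.unique hι hD⟩
  · obtain ⟨D, hD⟩ := QPainleve.exists_isPainleveDerivationEven hι
    exact ⟨D, hD, fun D' hD' => hD'.unique hι hD⟩
  · rw [hD.map_α, QPainleve.inv_mul_lie_eq_zero ι _ (QPainleve.α_mem_center i)]
  · rw [hD.map_h, QPainleve.inv_mul_lie_eq_zero ι _ QPainleve.h_mem_center]
  · obtain ⟨D, hD⟩ := QPainleve.exists_isPainleveDerivationOdd hn hι
    exact ⟨D, hD, fun D' hD' => hD'.unique hι hD⟩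
  · rw [hD.map_α, QPainleve.inv_mul_lie_eq_zero ι _ (QPainleve.α_mem_center i)]
  · rw [hD.map_h, QPainleve.inv_mul_lie_eq_zero ι _ QPainleve.h_mem_center]
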